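/- Let $k$ be a field of characteristic $0$ and let $X$ be any set of leaf labels (a one-point set gives unlabelled trees). A tree is a nonplanar rooted full binary tree with leaves labelled by $X$, a forest is a finite multiset of trees, $L$ is the $k$-vector space with basis the trees, and $\mathrm{Sym}(L)$ is the polynomial algebra on the trees; its basis is the set of forests and its product is the disjoint union $\sqcup$. Every tree is regarded as having an additional virtual edge above its root. *The algebra $U(L)$.* For trees $T,S$ let $T\triangleleft S=\sum_e T\triangleleft_e S$, the sum over all edges $e$ of $T$, including the virtual root edge, where $T\triangleleft_e S$ is obtained by splitting $e$ by a new vertex and joining the root of $S$ to it (for the root edge, $T$ and $S$ are grafted to a common root). This makes $L$ a right pre-Lie algebra, hence a Lie algebra with $[x,y]=x\triangleleft y-y\triangleleft x$. Let Ш be the unshuffle coproduct of $\mathrm{Sym}(L)$, Ш$(x_1\cdots x_n)=\sum_{I\subseteq[n]}x_I\otimes x_{[n]\setminus I}$ for $x_i\in L$. The operation $\triangleleft$ extends uniquely to a bilinear operation on $\mathrm{Sym}(L)$ such that $A\triangleleft 1=A$, $x\triangleleft(Ay)=(x\triangleleft A)\triangleleft y-x\triangleleft(A\triangleleft y)$ and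 $AB\triangleleft C=\sum(A\triangleleft C_{(1)})(B\triangleleft C_{(2)})$ for $x,y\in L$ and $A,B,C\in\mathrm{Sym}(L)$, with Sweedler notation for Ш. Put $A*B=\sum(A\triangleleft B_{(1)})B_{(2)}$ and $U(L)=(\mathrm{Sym}(L),*,$Ш$)$. *The algebra $H$.* A binary-admissible cut $C$ of a tree $T$ is a set of edges of $T$ (the virtual root edge is allowed), no two of which lie on a common path from the root to a leaf and no two of which have the same parent vertex. Let $P^C(T)$ be the forest of the trees below the edges of $C$, and let $R^C(T)$ be what remains above them, turned into a full binary tree by contracting the vertices that have lost a child (empty if $C$ consists of the root edge). Put $\Delta(T)=\sum_C P^C(T)\otimes R^C(T)$, extend $\Delta$ multiplicatively to forests, and let $H=(\mathrm{Sym}(L),\sqcup,\Delta)$. *The pairing.* For a forest $F$ let $s_F$ be the order of its automorphism group (vertex permutations preserving roots, directed edges and leaf labels). Let $\langle F,F'\rangle=s_F\,\delta_{F,F'}$ for forests $F,F'$, extended bilinearly, and $\langle A\otimes B,A'\otimes B'\rangle=\langle A,A'\rangle\langle B,B'\rangle$. **Theorem.** 1. For all forests $F_1,F_2,F_3$, $\langle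 F_1*F_2,F_3\rangle=\langle F_2\otimes F_1,\Delta(F_3)\rangle$, and $\Delta$ is the only linear map with this property; that is, $\Delta$ is the coproduct $\Delta_*$ dual to $*$. 2. For all forests $F_1,F_2,F_3$, $\langle$Ш$(F_1),F_2\otimes F_3\rangle=\langle F_1,F_2\sqcup F_3\rangle$, and $\sqcup$ is the only bilinear product with this property. The unit $1$ on each side is dual to the counit $\varepsilon$ (the coefficient of the empty forest) on the other: $\langle 1,A\rangle=\varepsilon(A)=\langle A,1\rangle$. 3. If $n(F_1,F_2;F_3)$ is the coefficient of $F_3$ in $F_2*F_1$ and $m(F_1,F_2;F_3)$ is the coefficient of $F_1\otimes F_2$ in $\Delta(F_3)$, then $n(F_1,F_2;F_3)\,s_{F_3}=m(F_1,F_2;F_3)\,s_{F_1}s_{F_2}$. 4. $H$ is the graded dual of $U(L)$ (with the order of tensor factors as in 1). That is: $U(L)$ and $H$ are graded connected Hopf algebras, graded by the number of leaves; $(\mathrm{Sym}(L),*)$ is the universal enveloping algebra of the Lie algebra $L$, by an isomorphism that is the identity on $L$; parts of different degrees are orthogonal for the pairing, and the pairing is nondegenerate in every degree; and if $X$ is finite,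 every graded part is finite-dimensional and the pairing is perfect in every degree. -/

import Mathlib

open scoped TensorProduct

noncomputable section

namespace BinForest

universe u v

/-! ### Binary rooted trees and forests -/

/-- Full binary rooted trees with leaves labelled by `α`, with a planar embedding. -/
inductive PlaneTree (α : Type u) : Type u
  | leaf (a : α) : PlaneTree α
  | node (l r : PlaneTree α) : PlaneTree α

namespace PlaneTree

variable {α : Type u}

/-- Two plane trees are equivalent if they differ only by exchanging children of inner vertices,
that is, if they are plane embeddings of the same nonplanar tree. -/
inductive Equivalent : PlaneTree α → PlaneTree α → Prop
  | leaf (a : α) : Equivalent (leaf a) (leaf a)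
  | node {l r l' r' : PlaneTree α} :
      Equivalent l l' → Equivalent r r' → Equivalent (node l r) (node l' r')
  | swap {l r l' r' : PlaneTree α} :
      Equivalent l l' → Equivalent r r' → Equivalent (node l r) (node r' l')

theorem Equivalent.refl : ∀ t : PlaneTree α, Equivalent t t
  | .leaf a => .leaf a
  | .node l r => .node (refl l) (refl r)

theorem Equivalent.symm {s t : PlaneTree α} (h : Equivalent s t) : Equivalent t s := by
  induction h with
  | leaf a => exact .leaf a
  | node _ _ h₁ h₂ => exact .node h₁ h₂
  | swap _ _ h₁ h₂ => exact .swap h₂ h₁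

theorem Equivalent.trans {s t : PlaneTree α} (h : Equivalent s t) :
    ∀ {u : PlaneTree α}, Equivalent t u → Equivalent s u := by
  induction h with
  | leaf a => exact fun h => h
  | node _ _ h₁ h₂ =>
    intro u h
    cases h with
    | node k₁ k₂ => exact .node (h₁ k₁) (h₂ k₂)
    | swap k₁ k₂ => exact .swap (h₁ k₁) (h₂ k₂)
  | swap _ _ h₁ h₂ =>
    intro u h
    cases h with
    | node k₁ k₂ => exact .swap (h₁ k₂) (h₂ k₁)
    | swap k₁ k₂ => exact .node (h₁ k₂) (h₂ k₁)

instance setoid (α : Type u) : Setoid (PlaneTree α) where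
  r := Equivalent
  iseqv := ⟨Equivalent.refl, Equivalent.symm, fun h h' => Equivalent.trans h h'⟩

/-- The vertices of a plane tree; in a tree `node l r`, `none` is the root and the other vertices
are those of `l` and those of `r`.  A vertex also stands for the edge of which it is the lower
endpoint; the root stands for the virtual root edge. -/
def Vertex : PlaneTree α → Type
  | leaf _ => Unit
  | node l r => Option (l.Vertex ⊕ r.Vertex)

instance vertexFintype : (t : PlaneTree α) → Fintype t.Vertex
  | leaf _ => inferInstanceAs (Fintype Unit)
  | node l r =>
    have := vertexFintype l
    have := vertexFintype r
    inferInstanceAs (Fintype (Option (l.Vertex ⊕ r.Vertex)))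

def root : (t : PlaneTree α) → t.Vertex
  | leaf _ => ()
  | node _ _ => none

/-- `t.IsParent v w`: the vertex `v` is the parent of the vertex `w`. -/
def IsParent : (t : PlaneTree α) → t.Vertex → t.Vertex → Prop
  | leaf _, _, _ => False
  | node l _, none, some (.inl w) => w = l.root
  | node _ r, none, some (.inr w) => w = r.root
  | node l _, some (.inl v), some (.inl w) => l.IsParent v w
  | node _ r, some (.inr v), some (.inr w) => r.IsParent v w
  | node _ _, _, _ => False

/-- The label of a vertex: leaves carry labels, inner vertices do not. -/
def label : (t : PlaneTree α) → t.Vertex → Option α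
  | leaf a, _ => some a
  | node _ _, none => none
  | node l _, some (.inl v) => l.label v
  | node _ r, some (.inr v) => r.label v

/-- The subtree consisting of a vertex and all its descendants. -/
def subtree : (t : PlaneTree α) → t.Vertex → PlaneTree α
  | leaf a, _ => leaf a
  | node l r, none => node l r
  | node l _, some (.inl v) => l.subtree v
  | node _ r, some (.inr v) => r.subtree v

def numLeaves : PlaneTree α → ℕ
  | leaf _ => 1
  | node l r => l.numLeaves + r.numLeaves

/-- Insertion of `s` into `t` at the edge above the vertex `v`: that edge is split by a new vertex,
to which the root of `s` is joined.  For `v` the root, `t` and `s` are grafted to a common root. -/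
def insertAt (s : PlaneTree α) : (t : PlaneTree α) → t.Vertex → PlaneTree α
  | leaf a, _ => node (leaf a) s
  | node l r, none => node (node l r) s
  | node l r, some (.inl v) => node (insertAt s l v) r
  | node l r, some (.inr v) => node l (insertAt s r v)

/-- A set of edges (the virtual root edge is allowed) is a binary-admissible cut if no two of its
edges lie on the same path from root to leaf and no two of them share the same parent vertex. -/
def IsBinaryAdmissible (t : PlaneTree α) (C : Finset t.Vertex) : Prop :=
  (∀ v ∈ C, ∀ w ∈ C, ¬ Relation.TransGen t.IsParent v w) ∧
    ∀ u, ∀ v ∈ C, ∀ w ∈ C, t.IsParent u v → t.IsParent u w → v = w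

open Classical in
/-- The binary-admissible cuts of a tree.  The cut `{t.root}` is the total cut. -/
def cuts (t : PlaneTree α) : Finset (Finset t.Vertex) :=
  Finset.univ.filter t.IsBinaryAdmissible

open Classical in
/-- What remains above the edges of a cut `C`, as a full binary tree: everything below an edge of
`C` is removed, and a vertex that loses one of its children is contracted.
The value is `none` if nothing remains. -/
def remainder : (t : PlaneTree α) → Finset t.Vertex → Option (PlaneTree α)
  | leaf a, C => if (leaf a).root ∈ C then none else some (leaf a)
  | node l r, C =>
    if (node l r).root ∈ C then none
    else
      match l.remainder (Finset.univ.filter fun v => (some (.inl v) : (node l r).Vertex) ∈ C),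
        r.remainder (Finset.univ.filter fun v => (some (.inr v) : (node l r).Vertex) ∈ C) with
      | some l', some r' => some (node l' r')
      | some l', none => some l'
      | none, some r' => some r'
      | none, none => none

end PlaneTree

/-- Nonplanar full binary rooted trees with leaves labelled by `α`. -/
def BinTree (α : Type u) : Type u := Quotient (PlaneTree.setoid α)

/-- Forests: finite multisets of trees, `F = T₁ ^ a₁ ⋯ Tₙ ^ aₙ` being given by its exponents. -/
abbrev Forest (α : Type u) : Type u := BinTree α →₀ ℕ

section Trees

variable {α : Type u}

def PlaneTree.toBinTree (t : PlaneTree α) : BinTree α := Quotient.mk _ t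

/-- A plane embedding of a nonplanar tree. -/
def BinTree.plane (T : BinTree α) : PlaneTree α := Quotient.out T

theorem PlaneTree.Equivalent.numLeaves_eq {s t : PlaneTree α} (h : s.Equivalent t) :
    s.numLeaves = t.numLeaves := by
  induction h with
  | leaf a => rfl
  | node _ _ h₁ h₂ => simp only [PlaneTree.numLeaves, h₁, h₂]
  | swap _ _ h₁ h₂ => simp only [PlaneTree.numLeaves, h₁, h₂, add_comm]

def BinTree.numLeaves (T : BinTree α) : ℕ :=
  Quotient.lift PlaneTree.numLeaves (fun s t (h : s.Equivalent t) => h.numLeaves_eq) T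

/-- The connected components of a forest: `F T` copies of every tree `T`. -/
def Forest.Component (F : Forest α) : Type u := Σ T : F.support, Fin (F T.1)

def Forest.Vertex (F : Forest α) : Type u := Σ c : Forest.Component F, c.1.1.plane.Vertex

def Forest.IsRoot (F : Forest α) (v : Forest.Vertex F) : Prop := v.2 = PlaneTree.root _

def Forest.IsParent (F : Forest α) (v w : Forest.Vertex F) : Prop :=
  ∃ (c : Forest.Component F) (x y : c.1.1.plane.Vertex),
    v = ⟨c, x⟩ ∧ w = ⟨c, y⟩ ∧ PlaneTree.IsParent _ x y

def Forest.label (F : Forest α) (v : Forest.Vertex F) : Option α := PlaneTree.label _ v.2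

/-- The automorphism group of a forest: the permutations of its vertices that preserve roots,
directed edges and leaf labels. -/
def Forest.autGroup (F : Forest α) : Subgroup (Equiv.Perm (Forest.Vertex F)) where
  carrier := {σ | (∀ v, Forest.IsRoot F (σ v) ↔ Forest.IsRoot F v) ∧
    (∀ v w, Forest.IsParent F (σ v) (σ w) ↔ Forest.IsParent F v w) ∧
    ∀ v, Forest.label F (σ v) = Forest.label F v}
  mul_mem' := by
    rintro σ τ ⟨h₁, h₂, h₃⟩ ⟨k₁, k₂, k₃⟩
    exact ⟨fun v => (h₁ _).trans (k₁ v), fun v w => (h₂ _ _).trans (k₂ v w),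
      fun v => (h₃ _).trans (k₃ v)⟩
  one_mem' := ⟨fun _ => Iff.rfl, fun _ _ => Iff.rfl, fun _ => rfl⟩
  inv_mem' := by
    rintro σ ⟨h₁, h₂, h₃⟩
    refine ⟨fun v => ?_, fun v w => ?_, fun v => ?_⟩
    · simpa using (h₁ (σ⁻¹ v)).symm
    · simpa using (h₂ (σ⁻¹ v) (σ⁻¹ w)).symm
    · simpa using (h₃ (σ⁻¹ v)).symm

/-- The symmetry factor `s_F`: the order of the automorphism group of the forest `F`. -/
def Forest.symmetryFactor (F : Forest α) : ℕ := Nat.card (Forest.autGroup F)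

end Trees

/-! ### The pre-Lie algebra of edge insertions -/

/-- The vector space `L` with basis the set of trees. -/
def TreeSpace (k : Type v) (α : Type u) [Field k] : Type (max u v) := BinTree α →₀ k

section PreLie

variable (k : Type v) {α : Type u} [Field k]

instance : AddCommGroup (TreeSpace k α) := inferInstanceAs (AddCommGroup (BinTree α →₀ k))

instance : Module k (TreeSpace k α) := inferInstanceAs (Module k (BinTree α →₀ k))

/-- The basis vector of a tree. -/
def treeVec (T : BinTree α) : TreeSpace k α := Finsupp.single T 1

/-- The basis of `L` consisting of the trees. -/
def treeBasis : Module.Basis (BinTree α) k (TreeSpace k α) := Finsupp.basisSingleOne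

theorem treeBasis_apply (T : BinTree α) : treeBasis k T = treeVec k T := rfl

/-- The tree obtained by grafting two trees to a common root. -/
def BinTree.merge (T S : BinTree α) : BinTree α := (PlaneTree.node T.plane S.plane).toBinTree

/-- The sum of all insertions of a plane tree `s` into a plane tree `t`, over all edges of `t`
including the virtual root edge. -/
def planeInsertion (t s : PlaneTree α) : TreeSpace k α :=
  ∑ v : t.Vertex, treeVec k (PlaneTree.insertAt s t v).toBinTree

/-- `T ◁ S` for two trees: the sum of all insertions of `S` into `T`. -/
def insertion (T S : BinTree α) : TreeSpace k α := planeInsertion k T.plane S.plane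

/-- The bilinear extension of `T ◁ S` to `L`. -/
def insertionBilin : TreeSpace k α →ₗ[k] TreeSpace k α →ₗ[k] TreeSpace k α :=
  (treeBasis k).constr k fun T => (treeBasis k).constr k fun S => insertion k T S

/-- The bilinear extension of grafting to a common root. -/
def mergeBilin : TreeSpace k α →ₗ[k] TreeSpace k α →ₗ[k] TreeSpace k α :=
  (treeBasis k).constr k fun T => (treeBasis k).constr k fun S => treeVec k (T.merge S)

theorem insertionBilin_treeVec (T S : BinTree α) :
    insertionBilin k (treeVec k T) (treeVec k S) = insertion k T S := by
  simp [insertionBilin, ← treeBasis_apply]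

theorem mergeBilin_treeVec (T S : BinTree α) :
    mergeBilin k (treeVec k T) (treeVec k S) = treeVec k (T.merge S) := by
  simp [mergeBilin, ← treeBasis_apply]

theorem toBinTree_eq {s t : PlaneTree α} (h : s.Equivalent t) : s.toBinTree = t.toBinTree :=
  Quotient.sound h

theorem plane_toBinTree (t : PlaneTree α) : t.toBinTree.plane.Equivalent t :=
  Quotient.mk_out (s := PlaneTree.setoid α) t

theorem toBinTree_plane (T : BinTree α) : T.plane.toBinTree = T := Quotient.out_eq T

theorem merge_toBinTree (t s : PlaneTree α) :
    t.toBinTree.merge s.toBinTree = (PlaneTree.node t s).toBinTree :=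
  toBinTree_eq (.node (plane_toBinTree t) (plane_toBinTree s))

theorem merge_comm (T S : BinTree α) : T.merge S = S.merge T :=
  toBinTree_eq (.swap (.refl _) (.refl _))

theorem mergeBilin_comm (x y : TreeSpace k α) : mergeBilin k x y = mergeBilin k y x := by
  have h : mergeBilin k = (mergeBilin k (α := α)).flip := by
    refine (treeBasis k).ext fun T => (treeBasis k).ext fun S => ?_
    simp only [treeBasis_apply, LinearMap.flip_apply, mergeBilin_treeVec, merge_comm T S]
  exact LinearMap.congr_fun₂ h x y

theorem planeInsertion_leaf (a : α) (s : PlaneTree α) :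
    planeInsertion k (.leaf a) s =
      mergeBilin k (treeVec k (PlaneTree.leaf a).toBinTree) (treeVec k s.toBinTree) := by
  rw [mergeBilin_treeVec, merge_toBinTree]
  exact Fintype.sum_unique (ι := Unit) _

theorem planeInsertion_node (l r s : PlaneTree α) :
    planeInsertion k (.node l r) s =
      mergeBilin k (treeVec k (PlaneTree.node l r).toBinTree) (treeVec k s.toBinTree) +
      mergeBilin k (planeInsertion k l s) (treeVec k r.toBinTree) +
      mergeBilin k (treeVec k l.toBinTree) (planeInsertion k r s) := by
  have h : planeInsertion k (.node l r) s = ∑ v : Option (l.Vertex ⊕ r.Vertex),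
      treeVec k (PlaneTree.insertAt s (.node l r) v).toBinTree := rfl
  rw [h, Fintype.sum_option, Fintype.sum_sum_type, ← add_assoc]
  simp only [planeInsertion, map_sum, LinearMap.sum_apply, mergeBilin_treeVec, merge_toBinTree]
  rfl

theorem planeInsertion_congr {t t' s s' : PlaneTree α} (ht : t.Equivalent t')
    (hs : s.Equivalent s') : planeInsertion k t s = planeInsertion k t' s' := by
  induction ht with
  | leaf a => rw [planeInsertion_leaf, planeInsertion_leaf, toBinTree_eq hs]
  | node h₁ h₂ ih₁ ih₂ =>
    rw [planeInsertion_node, planeInsertion_node, ih₁, ih₂, toBinTree_eq hs, toBinTree_eq h₁,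
      toBinTree_eq h₂, toBinTree_eq (.node h₁ h₂)]
  | @swap l r l' r' h₁ h₂ ih₁ ih₂ =>
    rw [planeInsertion_node, planeInsertion_node, ih₁, ih₂, toBinTree_eq hs, toBinTree_eq h₁,
      toBinTree_eq h₂, toBinTree_eq (.swap h₁ h₂), mergeBilin_comm k (planeInsertion k l' s'),
      mergeBilin_comm k (treeVec k l'.toBinTree) (planeInsertion k r' s')]
    abel

theorem insertion_toBinTree (t s : PlaneTree α) :
    insertion k t.toBinTree s.toBinTree = planeInsertion k t s :=
  planeInsertion_congr k (plane_toBinTree t) (plane_toBinTree s)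

theorem insertionBilin_leaf (a : α) (y : TreeSpace k α) :
    insertionBilin k (treeVec k (PlaneTree.leaf a).toBinTree) y =
      mergeBilin k (treeVec k (PlaneTree.leaf a).toBinTree) y := by
  have h : insertionBilin k (treeVec k (PlaneTree.leaf a).toBinTree) =
      mergeBilin k (treeVec k (PlaneTree.leaf a).toBinTree) := by
    refine (treeBasis k).ext fun S => ?_
    rw [treeBasis_apply, insertionBilin_treeVec, ← toBinTree_plane S, insertion_toBinTree,
      planeInsertion_leaf]
  rw [h]

theorem treeSpace_induction {p : TreeSpace k α → Prop} (x : TreeSpace k α)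
    (zero : p 0) (add : ∀ x y, p x → p y → p (x + y)) (smul : ∀ (c : k) x, p x → p (c • x))
    (vec : ∀ t : PlaneTree α, p (treeVec k t.toBinTree)) : p x := by
  refine Finsupp.induction_linear (motive := p) x zero add fun T c => ?_
  have h : (Finsupp.single T c : BinTree α →₀ k) = c • Finsupp.single T 1 := by simp
  rw [h]
  refine smul c _ ?_
  have := vec T.plane
  rwa [toBinTree_plane] at this

theorem insertionBilin_merge (x y z : TreeSpace k α) :
    insertionBilin k (mergeBilin k x y) z =
      mergeBilin k (mergeBilin k x y) z + mergeBilin k (insertionBilin k x z) y +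
        mergeBilin k x (insertionBilin k y z) := by
  induction x using treeSpace_induction k with
  | zero => simp
  | add x x' h h' => simp only [map_add, LinearMap.add_apply, h, h']; abel
  | smul c x h => simp only [map_smul, LinearMap.smul_apply, h, smul_add]
  | vec t =>
  induction y using treeSpace_induction k with
  | zero => simp
  | add x x' h h' => simp only [map_add, LinearMap.add_apply, h, h']; abel
  | smul c x h => simp only [map_smul, LinearMap.smul_apply, h, smul_add]
  | vec s =>
  induction z using treeSpace_induction k with
  | zero => simp
  | add x x' h h' => simp only [map_add, LinearMap.add_apply, h, h']; abel
  | smul c x h => simp only [map_smul, LinearMap.smul_apply, h, smul_add]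
  | vec u =>
  simp only [mergeBilin_treeVec, merge_toBinTree, insertionBilin_treeVec, insertion_toBinTree,
    planeInsertion_node]

theorem vinberg (x y z : TreeSpace k α) :
    insertionBilin k (insertionBilin k x y) z - insertionBilin k x (insertionBilin k y z) =
      insertionBilin k (insertionBilin k x z) y - insertionBilin k x (insertionBilin k z y) := by
  induction x using treeSpace_induction k with
  | zero => simp
  | add x x' h h' =>
    simp only [map_add, LinearMap.add_apply] at *
    rw [add_sub_add_comm, h, h']
    abel
  | smul c x h =>
    simp only [map_smul, LinearMap.smul_apply] at *
    rw [← smul_sub, h, smul_sub]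
  | vec t =>
  induction t with
  | leaf a =>
    simp only [insertionBilin_leaf, insertionBilin_merge]
    abel
  | node l r hl hr =>
    have h : treeVec k (PlaneTree.node l r).toBinTree =
        mergeBilin k (treeVec k l.toBinTree) (treeVec k r.toBinTree) := by
      rw [mergeBilin_treeVec, merge_toBinTree]
    rw [sub_eq_iff_eq_add] at hl hr
    rw [h]
    simp only [insertionBilin_merge, map_add, LinearMap.add_apply, hl, hr, map_sub,
      LinearMap.sub_apply]
    abel

/-- `L` is a right pre-Lie algebra, with product `◁`.  Mathlib equips it with the Lie bracket
`⁅x, y⁆ = x ◁ y - y ◁ x`. -/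
instance : RightPreLieRing (TreeSpace k α) where
  mul x y := insertionBilin k x y
  left_distrib x y z := map_add (insertionBilin k x) y z
  right_distrib x y z := LinearMap.map_add₂ (insertionBilin k) x y z
  zero_mul x := LinearMap.map_zero₂ (insertionBilin k) x
  mul_zero x := map_zero (insertionBilin k x)
  assoc_symm' x y z := vinberg k x y z

instance : RightPreLieAlgebra k (TreeSpace k α) where
  smul_assoc c x y := LinearMap.map_smul₂ (insertionBilin k) c x y
  smul_comm c x y := (map_smul (insertionBilin k x) c y).symm

theorem mul_eq_insertionBilin (x y : TreeSpace k α) : x * y = insertionBilin k x y := rfl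

end PreLie

/-! ### The extension to the symmetric algebra -/

/-- `Sym(L) = k[𝒯]`: polynomials in trees; the monomials are the forests and the commutative
product is the disjoint union of forests. -/
abbrev ForestAlg (k : Type v) (α : Type u) [Field k] : Type (max u v) := MvPolynomial (BinTree α) k

section GuinOudom

variable (k : Type v) {α : Type u} [Field k]

/-- A forest as a basis element of `Sym(L)`. -/
def forestVec (F : Forest α) : ForestAlg k α := MvPolynomial.monomial F 1

/-- The inclusion `L → Sym(L)`. -/
def toSym : TreeSpace k α →ₗ[k] ForestAlg k α := (treeBasis k).constr k MvPolynomial.X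

/-- The unshuffle coproduct of `Sym(L)`: the algebra morphism for which the elements of `L` are
primitive. -/
def unshuffle : ForestAlg k α →ₐ[k] ForestAlg k α ⊗[k] ForestAlg k α :=
  MvPolynomial.aeval fun T => MvPolynomial.X T ⊗ₜ[k] 1 + 1 ⊗ₜ[k] MvPolynomial.X T

theorem toSym_treeVec (T : BinTree α) : toSym k (treeVec k T) = MvPolynomial.X T := by
  simp [toSym, ← treeBasis_apply]

theorem unshuffle_toSym (x : TreeSpace k α) :
    unshuffle k (toSym k x) = toSym k x ⊗ₜ[k] 1 + 1 ⊗ₜ[k] toSym k x := by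
  induction x using treeSpace_induction k with
  | zero => simp
  | add x y hx hy => simp only [map_add, hx, hy, TensorProduct.add_tmul, TensorProduct.tmul_add]; abel
  | smul c x hx => simp only [map_smul, hx, smul_add, TensorProduct.smul_tmul', TensorProduct.tmul_smul]
  | vec t => simp [toSym_treeVec, unshuffle]

/-- `Ш(x₁ ⋯ xₙ) = ∑_{I ⊆ [n]} x_I ⊗ x_{[n] ∖ I}` for elements `xᵢ` of `L`. -/
theorem unshuffle_prod {ι : Type*} [DecidableEq ι] (s : Finset ι) (x : ι → TreeSpace k α) :
    unshuffle k (∏ i ∈ s, toSym k (x i)) =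
      ∑ I ∈ s.powerset, (∏ i ∈ I, toSym k (x i)) ⊗ₜ[k] ∏ i ∈ s \ I, toSym k (x i) := by
  simp only [map_prod, unshuffle_toSym, Finset.prod_add]
  refine Finset.sum_congr rfl fun I _ => ?_
  have h₁ : ∀ J : Finset ι, ∏ i ∈ J, (toSym k (x i) ⊗ₜ[k] (1 : ForestAlg k α)) =
      (∏ i ∈ J, toSym k (x i)) ⊗ₜ[k] 1 := fun J =>
    (map_prod (Algebra.TensorProduct.includeLeft : ForestAlg k α →ₐ[k] ForestAlg k α ⊗[k] ForestAlg k α)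
      _ J).symm
  have h₂ : ∀ J : Finset ι, ∏ i ∈ J, ((1 : ForestAlg k α) ⊗ₜ[k] toSym k (x i)) =
      1 ⊗ₜ[k] (∏ i ∈ J, toSym k (x i)) := fun J =>
    (map_prod (Algebra.TensorProduct.includeRight : ForestAlg k α →ₐ[k] ForestAlg k α ⊗[k] ForestAlg k α)
      _ J).symm
  rw [h₁, h₂, Algebra.TensorProduct.tmul_mul_tmul, one_mul, mul_one]

/-- The properties that determine the extension of `◁` from `L` to `Sym(L)`; the last one is
`AB ◁ C = ∑ (A ◁ C₍₁₎) (B ◁ C₍₂₎)` with respect to the unshuffle coproduct. -/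
structure IsGuinOudomExtension (τ : ForestAlg k α →ₗ[k] ForestAlg k α →ₗ[k] ForestAlg k α) : Prop where
  base : ∀ x y : TreeSpace k α, τ (toSym k x) (toSym k y) = toSym k (x * y)
  one_right : ∀ A, τ A 1 = A
  mul_right : ∀ (x y : TreeSpace k α) (A : ForestAlg k α),
    τ (toSym k x) (A * toSym k y) =
      τ (τ (toSym k x) A) (toSym k y) - τ (toSym k x) (τ A (toSym k y))
  mul_left : ∀ A B C : ForestAlg k α,
    τ (A * B) C = LinearMap.mul' k (ForestAlg k α) (TensorProduct.map (τ A) (τ B) (unshuffle k C))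

/-- The derivation `A ↦ A ◁ y` of `Sym(L)` for `y` in `L`. -/
def actDeriv (y : TreeSpace k α) : Derivation k (ForestAlg k α) (ForestAlg k α) :=
  MvPolynomial.mkDerivation k fun T => toSym k (treeVec k T * y)

theorem actDeriv_toSym (x y : TreeSpace k α) : actDeriv k y (toSym k x) = toSym k (x * y) := by
  induction x using treeSpace_induction k with
  | zero => simp
  | add x y hx hy => simp only [map_add, hx, hy, add_mul]
  | smul c x hx => simp only [map_smul, hx, Derivation.map_smul, smul_mul_assoc]
  | vec t => simp [toSym_treeVec, actDeriv]

theorem actDeriv_X (T : BinTree α) (y : TreeSpace k α) :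
    actDeriv k y (MvPolynomial.X T) = toSym k (treeVec k T * y) := by
  simp [actDeriv]

theorem actDeriv_add (y z : TreeSpace k α) (A : ForestAlg k α) :
    actDeriv k (y + z) A = actDeriv k y A + actDeriv k z A := by
  have h : actDeriv k (y + z) = actDeriv k y + actDeriv k z :=
    MvPolynomial.derivation_ext fun T => by
      simp only [actDeriv_X, Derivation.add_apply, mul_add, map_add]
  rw [h, Derivation.add_apply]

theorem actDeriv_smul (c : k) (y : TreeSpace k α) (A : ForestAlg k α) :
    actDeriv k (c • y) A = c • actDeriv k y A := by
  have h : actDeriv k (c • y) = c • actDeriv k y :=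
    MvPolynomial.derivation_ext fun T => by
      simp only [actDeriv_X, Derivation.smul_apply, mul_smul_comm, map_smul]
  rw [h, Derivation.smul_apply]

theorem actDeriv_zero (A : ForestAlg k α) : actDeriv k (0 : TreeSpace k α) A = 0 := by
  have := actDeriv_smul k 0 (0 : TreeSpace k α) A
  simpa using this

/-- The commutator of two of the derivations, as forced by the pre-Lie identity. -/
theorem actDeriv_comm (y z : TreeSpace k α) (A : ForestAlg k α) :
    actDeriv k z (actDeriv k y A) - actDeriv k (y * z) A =
      actDeriv k y (actDeriv k z A) - actDeriv k (z * y) A := by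
  have h : ⁅actDeriv k z, actDeriv k y⁆ = actDeriv k (y * z) - actDeriv k (z * y) := by
    refine MvPolynomial.derivation_ext fun T => ?_
    simp only [Derivation.commutator_apply, actDeriv_X, actDeriv_toSym, Derivation.sub_apply,
      ← map_sub]
    congr 1
    have := vinberg k (treeVec k T) y z
    simp only [← mul_eq_insertionBilin] at this
    rw [sub_eq_sub_iff_add_eq_add] at this ⊢
    rw [this, add_comm]
  have h' := congrArg (fun D => D A) h
  simp only [Derivation.commutator_apply, Derivation.sub_apply] at h'
  rw [sub_eq_sub_iff_add_eq_add] at h' ⊢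
  rw [h', add_comm]

theorem isHomogeneous_toSym (x : TreeSpace k α) : (toSym k x).IsHomogeneous 1 := by
  induction x using treeSpace_induction k with
  | zero => simpa using MvPolynomial.isHomogeneous_zero _ _ _
  | add x y hx hy => simpa only [map_add] using hx.add hy
  | smul c x hx =>
    rw [map_smul]
    exact Submodule.smul_mem (MvPolynomial.homogeneousSubmodule _ _ _) c hx
  | vec t => rw [toSym_treeVec]; exact MvPolynomial.isHomogeneous_X _ _

/-- Elements homogeneous in the number of trees are linear combinations of forests. -/
theorem homogeneous_induction {n : ℕ} {p : ForestAlg k α → Prop} {A : ForestAlg k α}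
    (hA : A.IsHomogeneous n) (zero : p 0) (add : ∀ A B, p A → p B → p (A + B))
    (smul : ∀ (c : k) A, p A → p (c • A))
    (mon : ∀ F : Forest α, F.degree = n → p (forestVec k F)) : p A := by
  rw [MvPolynomial.as_sum A]
  refine Finset.sum_induction _ p (fun _ _ => add _ _) zero fun F hF => ?_
  have h : MvPolynomial.monomial F (A.coeff F) = A.coeff F • forestVec k F := by
    simp [forestVec, MvPolynomial.smul_monomial]
  rw [h]
  refine smul _ _ (mon F ?_)
  have := hA (MvPolynomial.mem_support_iff.1 hF)
  rwa [Finsupp.degree_eq_weight_one] 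

theorem forestVec_add_single (F : Forest α) (T : BinTree α) :
    forestVec k (F + Finsupp.single T 1) = forestVec k F * MvPolynomial.X T := by
  simp [forestVec, MvPolynomial.X, MvPolynomial.monomial_mul]

theorem forestVec_zero : forestVec k (0 : Forest α) = 1 := rfl

theorem isHomogeneous_forestVec (F : Forest α) : (forestVec k F).IsHomogeneous F.degree :=
  MvPolynomial.isHomogeneous_monomial _ rfl

theorem exists_add_single {F : Forest α} {n : ℕ} (hF : F.degree = n + 1) :
    ∃ (G : Forest α) (T : BinTree α), F = G + Finsupp.single T 1 ∧ G.degree = n := by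
  have hne : F ≠ 0 := by rintro rfl; simp at hF
  obtain ⟨T, hT⟩ := Finsupp.support_nonempty_iff.2 hne
  have hle : Finsupp.single T 1 ≤ F := by
    rw [Finsupp.single_le_iff]
    exact Nat.one_le_iff_ne_zero.2 (Finsupp.mem_support_iff.1 hT)
  refine ⟨F - Finsupp.single T 1, T, (tsub_add_cancel_of_le hle).symm, ?_⟩
  have h := congrArg Finsupp.degree (tsub_add_cancel_of_le hle)
  rw [map_add, Finsupp.degree_single, hF] at h
  omega

theorem isHomogeneous_actDeriv {n : ℕ} (y : TreeSpace k α) {A : ForestAlg k α}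
    (hA : A.IsHomogeneous n) : (actDeriv k y A).IsHomogeneous n := by
  induction n generalizing A with
  | zero =>
    refine homogeneous_induction (p := fun A => (actDeriv k y A).IsHomogeneous _) k hA ?_ ?_ ?_ ?_
    · simpa using MvPolynomial.isHomogeneous_zero _ _ _
    · intro A B h h'; simpa only [map_add] using h.add h'
    · intro c A h
      rw [Derivation.map_smul]
      exact Submodule.smul_mem (MvPolynomial.homogeneousSubmodule _ _ _) c h
    · intro F hF
      rw [Finsupp.degree_eq_zero_iff] at hF
      subst hF
      simpa [forestVec_zero] using MvPolynomial.isHomogeneous_zero _ _ _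
  | succ n ih =>
    refine homogeneous_induction (p := fun A => (actDeriv k y A).IsHomogeneous _) k hA ?_ ?_ ?_ ?_
    · simpa using MvPolynomial.isHomogeneous_zero _ _ _
    · intro A B h h'; simpa only [map_add] using h.add h'
    · intro c A h
      rw [Derivation.map_smul]
      exact Submodule.smul_mem (MvPolynomial.homogeneousSubmodule _ _ _) c h
    · intro F hF
      obtain ⟨G, T, rfl, hG⟩ := exists_add_single hF
      rw [forestVec_add_single, Derivation.leibniz, smul_eq_mul, smul_eq_mul, actDeriv_X]
      have hG' : (forestVec k G).IsHomogeneous n := hG ▸ isHomogeneous_forestVec k G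
      refine (hG'.mul (isHomogeneous_toSym k _)).add ?_
      rw [add_comm n 1]
      exact (MvPolynomial.isHomogeneous_X _ _).mul (ih hG')

open Classical in
/-- Auxiliary recursion for `A ◁ B` on `B` with `n` trees: one tree of `B` is split off. -/
def extAux : ℕ → ForestAlg k α →ₗ[k] ForestAlg k α →ₗ[k] ForestAlg k α
  | 0 => (MvPolynomial.basisMonomials (BinTree α) k).constr k fun _ => LinearMap.id
  | n + 1 => (MvPolynomial.basisMonomials (BinTree α) k).constr k fun F =>
      if h : ∃ (G : Forest α) (T : BinTree α), F = G + Finsupp.single T 1 then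
        (actDeriv k (treeVec k h.choose_spec.choose)).toLinearMap ∘ₗ
            extAux n (forestVec k h.choose) -
          extAux n (actDeriv k (treeVec k h.choose_spec.choose) (forestVec k h.choose))
      else 0

theorem extAux_zero_one : extAux k 0 (1 : ForestAlg k α) = LinearMap.id := by
  have : (1 : ForestAlg k α) = MvPolynomial.basisMonomials (BinTree α) k 0 := by simp
  rw [this, extAux, Module.Basis.constr_basis]

theorem extAux_succ_exists (n : ℕ) (F : Forest α)
    (hF : ∃ (G : Forest α) (T : BinTree α), F = G + Finsupp.single T 1) :
    ∃ (G : Forest α) (T : BinTree α), F = G + Finsupp.single T 1 ∧ ∀ A,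
      extAux k (n + 1) (forestVec k F) A = actDeriv k (treeVec k T) (extAux k n (forestVec k G) A) -
        extAux k n (actDeriv k (treeVec k T) (forestVec k G)) A := by
  refine ⟨hF.choose, hF.choose_spec.choose, hF.choose_spec.choose_spec, fun A => ?_⟩
  have h : forestVec k F = MvPolynomial.basisMonomials (BinTree α) k F := by simp [forestVec]
  conv_lhs => rw [extAux, h, Module.Basis.constr_basis, dif_pos hF]
  rfl

/-- The recursion holds whichever tree is split off. -/
theorem extAux_mul_toSym (n : ℕ) {B : ForestAlg k α} (hB : B.IsHomogeneous n) (y : TreeSpace k α)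
    (A : ForestAlg k α) :
    extAux k (n + 1) (B * toSym k y) A =
      actDeriv k y (extAux k n B A) - extAux k n (actDeriv k y B) A := by
  induction n using Nat.strong_induction_on generalizing A B y with
  | _ n ih =>
  refine homogeneous_induction (p := fun B => extAux k (n + 1) (B * toSym k y) A =
      actDeriv k y (extAux k n B A) - extAux k n (actDeriv k y B) A) k hB ?_ ?_ ?_ ?_
  · simp
  · intro B B' h h'
    simp only [add_mul, map_add, LinearMap.add_apply, h, h']; abel
  · intro c B h
    simp only [smul_mul_assoc, map_smul, LinearMap.smul_apply, Derivation.map_smul, h, smul_sub]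
  intro F hF
  induction y using treeSpace_induction k with
  | zero => simp [actDeriv_zero]
  | add y z hy hz =>
    simp only [mul_add, map_add, LinearMap.add_apply, actDeriv_add, hy, hz]; abel
  | smul c y hy =>
    simp only [mul_smul_comm, map_smul, LinearMap.smul_apply, actDeriv_smul, hy, smul_sub]
  | vec t =>
  rw [toSym_treeVec]
  generalize t.toBinTree = T
  rw [← forestVec_add_single]
  obtain ⟨G, S, hGS, h⟩ := extAux_succ_exists k n (F + Finsupp.single T 1) ⟨F, T, rfl⟩
  rw [h]
  by_cases hST : S = T
  · subst hST
    rw [add_right_cancel hGS]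
  -- both `F` and `G` arise from a common smaller forest
  cases n with
  | zero =>
    exfalso
    rw [Finsupp.degree_eq_zero_iff] at hF
    subst hF
    have := DFunLike.congr_fun hGS T
    simp [hST] at this
    have h2 := DFunLike.congr_fun hGS S
    simp [hST] at h2
  | succ m =>
  have hSF : Finsupp.single S 1 ≤ F := by
    rw [Finsupp.single_le_iff]
    have h2 := DFunLike.congr_fun hGS S
    simp [Ne.symm hST] at h2
    omega
  set K := F - Finsupp.single S 1 with hK
  have hFK : F = K + Finsupp.single S 1 := (tsub_add_cancel_of_le hSF).symm
  have hGK : G = K + Finsupp.single T 1 := by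
    have h3 : G + Finsupp.single S 1 = (K + Finsupp.single T 1) + Finsupp.single S 1 := by
      rw [← hGS, hFK]; abel
    exact add_right_cancel h3
  have hKd : K.degree = m := by
    rw [hFK, map_add, Finsupp.degree_single] at hF; omega
  have hKh : (forestVec k K).IsHomogeneous m := hKd ▸ isHomogeneous_forestVec k K
  clear_value K
  subst hFK hGK
  have e₁ : ∀ (U V : BinTree α),
      actDeriv k (treeVec k U) (extAux k (m + 1) (forestVec k (K + Finsupp.single V 1)) A) -
        extAux k (m + 1) (actDeriv k (treeVec k U) (forestVec k (K + Finsupp.single V 1))) A =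
      (actDeriv k (treeVec k U) (actDeriv k (treeVec k V) (extAux k m (forestVec k K) A)) -
        actDeriv k (treeVec k V * treeVec k U) (extAux k m (forestVec k K) A)) -
      (actDeriv k (treeVec k U) (extAux k m (actDeriv k (treeVec k V) (forestVec k K)) A) +
        actDeriv k (treeVec k V) (extAux k m (actDeriv k (treeVec k U) (forestVec k K)) A)) +
      (extAux k m (actDeriv k (treeVec k V) (actDeriv k (treeVec k U) (forestVec k K)) +
        actDeriv k (treeVec k V * treeVec k U) (forestVec k K)) A) := by
    intro U V
    rw [forestVec_add_single, Derivation.leibniz, smul_eq_mul, smul_eq_mul, actDeriv_X,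
      mul_comm (MvPolynomial.X V), ← toSym_treeVec]
    rw [map_add, LinearMap.add_apply, ih m (Nat.lt_succ_self m) hKh,
      ih m (Nat.lt_succ_self m) hKh, ih m (Nat.lt_succ_self m) (isHomogeneous_actDeriv k _ hKh)]
    simp only [map_sub, map_add, LinearMap.add_apply]
    abel
  rw [e₁ S T, e₁ T S, actDeriv_comm k (treeVec k T) (treeVec k S)]
  have e₂ : actDeriv k (treeVec k T) (actDeriv k (treeVec k S) (forestVec k K)) +
        actDeriv k (treeVec k T * treeVec k S) (forestVec k K) =
      actDeriv k (treeVec k S) (actDeriv k (treeVec k T) (forestVec k K)) +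
        actDeriv k (treeVec k S * treeVec k T) (forestVec k K) := by
    have := actDeriv_comm k (treeVec k T) (treeVec k S) (forestVec k K)
    rw [sub_eq_sub_iff_add_eq_add] at this
    rw [this]
  rw [e₂]
  abel


/-- The construction of the extension of `◁`, with the arguments exchanged. -/
def extFlip : ForestAlg k α →ₗ[k] ForestAlg k α →ₗ[k] ForestAlg k α :=
  (MvPolynomial.basisMonomials (BinTree α) k).constr k fun F => extAux k F.degree (forestVec k F)

theorem extFlip_forestVec (F : Forest α) :
    extFlip k (forestVec k F) = extAux k F.degree (forestVec k F) := by
  have h : forestVec k F = MvPolynomial.basisMonomials (BinTree α) k F := by simp [forestVec]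
  conv_lhs => rw [extFlip, h, Module.Basis.constr_basis]

theorem extFlip_eq {n : ℕ} {B : ForestAlg k α} (hB : B.IsHomogeneous n) :
    extFlip k B = extAux k n B := by
  refine homogeneous_induction (p := fun B => extFlip k B = extAux k n B) k hB ?_ ?_ ?_ ?_
  · simp
  · intro B B' h h'; simp only [map_add, h, h']
  · intro c B h; simp only [map_smul, h]
  · intro F hF; rw [extFlip_forestVec, hF]

theorem forestAlg_induction {p : ForestAlg k α → Prop} (A : ForestAlg k α)
    (add : ∀ A B, p A → p B → p (A + B)) (smul : ∀ (c : k) A, p A → p (c • A))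
    (mon : ∀ F : Forest α, p (forestVec k F)) : p A := by
  have zero : p 0 := by simpa using smul 0 _ (mon 0)
  rw [MvPolynomial.as_sum A]
  refine Finset.sum_induction _ p (fun _ _ => add _ _) zero fun F _ => ?_
  have h : MvPolynomial.monomial F (A.coeff F) = A.coeff F • forestVec k F := by
    simp [forestVec, MvPolynomial.smul_monomial]
  rw [h]
  exact smul _ _ (mon F)

theorem extFlip_mul_toSym (B : ForestAlg k α) (y : TreeSpace k α) (A : ForestAlg k α) :
    extFlip k (B * toSym k y) A =
      actDeriv k y (extFlip k B A) - extFlip k (actDeriv k y B) A := by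
  induction B using forestAlg_induction k with
  | add B B' h h' => simp only [add_mul, map_add, LinearMap.add_apply, h, h']; abel
  | smul c B h =>
    simp only [smul_mul_assoc, map_smul, LinearMap.smul_apply, Derivation.map_smul, h, smul_sub]
  | mon F =>
    have hF := isHomogeneous_forestVec k F
    rw [extFlip_eq k (hF.mul (isHomogeneous_toSym k y)), extFlip_eq k hF,
      extFlip_eq k (isHomogeneous_actDeriv k y hF), extAux_mul_toSym k _ hF]

theorem extFlip_one (A : ForestAlg k α) : extFlip k 1 A = A := by
  rw [extFlip_eq k (MvPolynomial.isHomogeneous_one _ _), extAux_zero_one, LinearMap.id_apply]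

theorem extFlip_toSym (y : TreeSpace k α) (A : ForestAlg k α) :
    extFlip k (toSym k y) A = actDeriv k y A := by
  have := extFlip_mul_toSym k 1 y A
  simpa [extFlip_one] using this

/-- The action of `y` on a tensor product: `a ⊗ b ↦ (a ◁ y) ⊗ b + a ⊗ (b ◁ y)`. -/
def coDeriv (y : TreeSpace k α) :
    ForestAlg k α ⊗[k] ForestAlg k α →ₗ[k] ForestAlg k α ⊗[k] ForestAlg k α :=
  (actDeriv k y : ForestAlg k α →ₗ[k] ForestAlg k α).rTensor (ForestAlg k α) +
    (actDeriv k y : ForestAlg k α →ₗ[k] ForestAlg k α).lTensor (ForestAlg k α)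

theorem coDeriv_tmul (y : TreeSpace k α) (a b : ForestAlg k α) :
    coDeriv k y (a ⊗ₜ b) = actDeriv k y a ⊗ₜ b + a ⊗ₜ actDeriv k y b := rfl

theorem unshuffle_actDeriv (y : TreeSpace k α) (B : ForestAlg k α) :
    unshuffle k (actDeriv k y B) = coDeriv k y (unshuffle k B) := by
  induction B using MvPolynomial.induction_on with
  | C c =>
    rw [← MvPolynomial.algebraMap_eq]
    simp [Algebra.algebraMap_eq_smul_one, Algebra.TensorProduct.one_def, coDeriv_tmul]
  | add B B' h h' => simp only [map_add, h, h']
  | mul_X B T h =>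
    have hX : unshuffle k (MvPolynomial.X T) = MvPolynomial.X T ⊗ₜ[k] (1 : ForestAlg k α) +
        1 ⊗ₜ[k] MvPolynomial.X T := by simp [unshuffle]
    have key : ∀ t : ForestAlg k α ⊗[k] ForestAlg k α,
        coDeriv k y
          (t * (MvPolynomial.X T ⊗ₜ[k] (1 : ForestAlg k α) + 1 ⊗ₜ[k] MvPolynomial.X T)) =
        t * (actDeriv k y (MvPolynomial.X T) ⊗ₜ[k] (1 : ForestAlg k α) +
          1 ⊗ₜ[k] actDeriv k y (MvPolynomial.X T)) +
        (MvPolynomial.X T ⊗ₜ[k] (1 : ForestAlg k α) + 1 ⊗ₜ[k] MvPolynomial.X T) *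
        coDeriv k y t := by
      intro t
      induction t using TensorProduct.induction_on with
      | zero => simp
      | add s t hs ht =>
        rw [add_mul, map_add, hs, ht, map_add]
        ring
      | tmul a b =>
        simp only [mul_add, add_mul, map_add, coDeriv_tmul,
          Algebra.TensorProduct.tmul_mul_tmul, mul_one, one_mul, Derivation.leibniz, smul_eq_mul,
          TensorProduct.add_tmul, TensorProduct.tmul_add, mul_comm (MvPolynomial.X T)]
        abel
    rw [Derivation.leibniz, smul_eq_mul, smul_eq_mul, map_add, map_mul, map_mul, map_mul, hX, h,
      actDeriv_X, key, actDeriv_X, unshuffle_toSym]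

theorem extFlip_mul_left (A B C : ForestAlg k α) :
    extFlip k C (A * B) = LinearMap.mul' k (ForestAlg k α)
      (TensorProduct.map ((extFlip k).flip A) ((extFlip k).flip B) (unshuffle k C)) := by
  suffices H : ∀ (n : ℕ) (C : ForestAlg k α), C.IsHomogeneous n → extFlip k C (A * B) =
      LinearMap.mul' k (ForestAlg k α)
        (TensorProduct.map ((extFlip k).flip A) ((extFlip k).flip B) (unshuffle k C)) by
    induction C using forestAlg_induction k with
    | add C C' h h' => simp only [map_add, LinearMap.add_apply, h, h']
    | smul c C h => simp only [map_smul, LinearMap.smul_apply, h]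
    | mon F => exact H _ _ (isHomogeneous_forestVec k F)
  intro n
  induction n with
  | zero =>
    intro C hC
    refine homogeneous_induction (p := fun C => extFlip k C (A * B) =
      LinearMap.mul' k (ForestAlg k α)
        (TensorProduct.map ((extFlip k).flip A) ((extFlip k).flip B) (unshuffle k C))) k hC
        ?_ ?_ ?_ ?_
    · simp
    · intro C C' h h'; simp only [map_add, LinearMap.add_apply, h, h']
    · intro c C h; simp only [map_smul, LinearMap.smul_apply, h]
    · intro F hF
      rw [Finsupp.degree_eq_zero_iff] at hF
      subst hF
      simp [forestVec_zero, extFlip_one, Algebra.TensorProduct.one_def]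
  | succ n ih =>
    intro C hC
    refine homogeneous_induction (p := fun C => extFlip k C (A * B) =
      LinearMap.mul' k (ForestAlg k α)
        (TensorProduct.map ((extFlip k).flip A) ((extFlip k).flip B) (unshuffle k C))) k hC
        ?_ ?_ ?_ ?_
    · simp
    · intro C C' h h'; simp only [map_add, LinearMap.add_apply, h, h']
    · intro c C h; simp only [map_smul, LinearMap.smul_apply, h]
    · intro F hF
      obtain ⟨G, T, rfl, hG⟩ := exists_add_single hF
      have hG' : (forestVec k G).IsHomogeneous n := hG ▸ isHomogeneous_forestVec k G
      rw [forestVec_add_single, ← toSym_treeVec, extFlip_mul_toSym, ih _ hG',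
        ih _ (isHomogeneous_actDeriv k _ hG'), unshuffle_actDeriv, map_mul, unshuffle_toSym]
      generalize unshuffle k (forestVec k G) = t
      generalize treeVec k T = y
      induction t using TensorProduct.induction_on with
      | zero => simp
      | add s t hs ht =>
        simp only [add_mul, map_add] at *
        rw [add_sub_add_comm, hs, ht]
      | tmul a b =>
        simp only [mul_add, map_add, coDeriv_tmul,
          Algebra.TensorProduct.tmul_mul_tmul, mul_one, TensorProduct.map_tmul,
          LinearMap.mul'_apply, LinearMap.flip_apply, extFlip_mul_toSym, Derivation.leibniz,
          smul_eq_mul]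
        ring

theorem isGuinOudomExtension_extFlip : IsGuinOudomExtension k (extFlip k (α := α)).flip where
  base x y := by rw [LinearMap.flip_apply, extFlip_toSym, actDeriv_toSym]
  one_right A := extFlip_one k A
  mul_right x y A := by
    simp only [LinearMap.flip_apply, extFlip_mul_toSym, extFlip_toSym]
  mul_left A B C := extFlip_mul_left k A B C


/-- The span of the tensors of two nonempty forests with `n` trees in total. -/
def reducedPart (n : ℕ) : Submodule k (ForestAlg k α ⊗[k] ForestAlg k α) :=
  Submodule.span k {x | ∃ G H : Forest α, G.degree ≠ 0 ∧ H.degree ≠ 0 ∧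
    G.degree + H.degree = n ∧ x = forestVec k G ⊗ₜ[k] forestVec k H}

theorem unshuffle_forestVec {n : ℕ} {F : Forest α} (hF : F.degree = n + 1) :
    ∃ r ∈ reducedPart k (n + 1), unshuffle k (forestVec k F) =
      forestVec k F ⊗ₜ[k] 1 + 1 ⊗ₜ[k] forestVec k F + r := by
  induction n generalizing F with
  | zero =>
    obtain ⟨G, T, rfl, hG⟩ := exists_add_single hF
    rw [Finsupp.degree_eq_zero_iff] at hG
    subst hG
    refine ⟨0, zero_mem _, ?_⟩
    rw [forestVec_add_single, forestVec_zero, one_mul, ← toSym_treeVec, unshuffle_toSym, add_zero]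
  | succ n ih =>
    obtain ⟨G, T, rfl, hG⟩ := exists_add_single hF
    obtain ⟨r, hr, h⟩ := ih hG
    have hT : forestVec k (Finsupp.single T 1 : Forest α) = MvPolynomial.X T := rfl
    refine ⟨forestVec k G ⊗ₜ[k] MvPolynomial.X T + MvPolynomial.X T ⊗ₜ[k] forestVec k G +
      r * (MvPolynomial.X T ⊗ₜ[k] (1 : ForestAlg k α) + 1 ⊗ₜ[k] MvPolynomial.X T),
      add_mem (add_mem ?_ ?_) ?_, ?_⟩
    · refine Submodule.subset_span ⟨G, Finsupp.single T 1, ?_, ?_, ?_, rfl⟩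
      · omega
      · simp
      · simp [hG]
    · refine Submodule.subset_span ⟨Finsupp.single T 1, G, ?_, ?_, ?_, rfl⟩
      · simp
      · omega
      · simp [hG]; omega
    · refine Submodule.span_induction (p := fun r _ => r * (MvPolynomial.X T ⊗ₜ[k]
        (1 : ForestAlg k α) + 1 ⊗ₜ[k] MvPolynomial.X T) ∈ reducedPart k (n + 1 + 1)) ?_ ?_ ?_ ?_ hr
      · rintro _ ⟨G, H, hG, hH, hGH, rfl⟩
        rw [mul_add, Algebra.TensorProduct.tmul_mul_tmul, Algebra.TensorProduct.tmul_mul_tmul,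
          mul_one, mul_one, ← forestVec_add_single, ← forestVec_add_single]
        refine add_mem (Submodule.subset_span ⟨_, _, ?_, hH, ?_, rfl⟩)
          (Submodule.subset_span ⟨_, _, hG, ?_, ?_, rfl⟩) <;>
        simp only [map_add, Finsupp.degree_single] <;> omega
      · rw [zero_mul]; exact zero_mem _
      · intro a b _ _ ha hb; rw [add_mul]; exact add_mem ha hb
      · intro c a _ ha; rw [smul_mul_assoc]; exact Submodule.smul_mem _ c ha
    · rw [forestVec_add_single, map_mul, h, ← toSym_treeVec, unshuffle_toSym]
      simp only [mul_add, add_mul, Algebra.TensorProduct.tmul_mul_tmul, mul_one, one_mul]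
      abel

variable {k}

theorem IsGuinOudomExtension.one_left {τ : ForestAlg k α →ₗ[k] ForestAlg k α →ₗ[k] ForestAlg k α}
    (hτ : IsGuinOudomExtension k τ) {n : ℕ} {F : Forest α} (hF : F.degree = n + 1) :
    τ 1 (forestVec k F) = 0 := by
  induction n using Nat.strong_induction_on generalizing F with
  | _ n ih =>
  obtain ⟨r, hr, h⟩ := unshuffle_forestVec k hF
  have hr0 : TensorProduct.map (τ 1) (τ 1) r = 0 := by
    refine Submodule.span_induction (p := fun r _ => TensorProduct.map (τ 1) (τ 1) r = 0)
      ?_ ?_ ?_ ?_ hr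
    · rintro _ ⟨G, H, hG, hH, hGH, rfl⟩
      obtain ⟨m, hm⟩ := Nat.exists_eq_succ_of_ne_zero hG
      rw [TensorProduct.map_tmul, ih m (by omega) hm, TensorProduct.zero_tmul]
    · exact map_zero _
    · intro a b _ _ ha hb; rw [map_add, ha, hb, add_zero]
    · intro c a _ ha; rw [map_smul, ha, smul_zero]
  have key := hτ.mul_left 1 1 (forestVec k F)
  rw [h, map_add, map_add, hr0, map_zero, add_zero, map_add, TensorProduct.map_tmul, TensorProduct.map_tmul,
    map_add, LinearMap.mul'_apply, LinearMap.mul'_apply, hτ.one_right, mul_one, mul_one,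
    one_mul] at key
  exact left_eq_add.1 key

theorem IsGuinOudomExtension.toSym_right {τ : ForestAlg k α →ₗ[k] ForestAlg k α →ₗ[k] ForestAlg k α}
    (hτ : IsGuinOudomExtension k τ) (A : ForestAlg k α) (y : TreeSpace k α) :
    τ A (toSym k y) = actDeriv k y A := by
  have h1 : τ 1 (toSym k y) = 0 := by
    have key := hτ.mul_left 1 1 (toSym k y)
    rw [unshuffle_toSym, map_add, TensorProduct.map_tmul, TensorProduct.map_tmul,
      map_add, LinearMap.mul'_apply, LinearMap.mul'_apply, hτ.one_right, mul_one, mul_one,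
      one_mul] at key
    exact left_eq_add.1 key
  induction A using MvPolynomial.induction_on with
  | C c =>
    rw [← MvPolynomial.algebraMap_eq, Algebra.algebraMap_eq_smul_one, map_smul,
      LinearMap.smul_apply, h1, Derivation.map_smul, Derivation.map_one_eq_zero]
  | add A B hA hB => simp only [map_add, LinearMap.add_apply, hA, hB]
  | mul_X A T hA =>
    rw [hτ.mul_left, unshuffle_toSym, map_add, TensorProduct.map_tmul, TensorProduct.map_tmul,
      map_add, LinearMap.mul'_apply, LinearMap.mul'_apply, hτ.one_right, hτ.one_right, hA,
      Derivation.leibniz, smul_eq_mul, smul_eq_mul, ← toSym_treeVec, hτ.base, actDeriv_toSym]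
    ring

theorem IsGuinOudomExtension.unique {τ τ' : ForestAlg k α →ₗ[k] ForestAlg k α →ₗ[k] ForestAlg k α}
    (hτ : IsGuinOudomExtension k τ) (hτ' : IsGuinOudomExtension k τ') : τ = τ' := by
  suffices H : ∀ (n : ℕ) (F : Forest α), F.degree = n → ∀ A,
      τ A (forestVec k F) = τ' A (forestVec k F) by
    refine LinearMap.ext fun A => LinearMap.ext fun B => ?_
    induction B using forestAlg_induction k with
    | add B B' h h' => simp only [map_add, h, h']
    | smul c B h => simp only [map_smul, h]
    | mon F => exact H _ F rfl A
  intro n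
  induction n using Nat.strong_induction_on with
  | _ n ih =>
  intro F hF
  cases n with
  | zero =>
    intro A
    rw [Finsupp.degree_eq_zero_iff] at hF
    subst hF
    rw [forestVec_zero, hτ.one_right, hτ'.one_right]
  | succ n =>
  have hX : ∀ S : BinTree α, τ (MvPolynomial.X S) (forestVec k F) =
      τ' (MvPolynomial.X S) (forestVec k F) := by
    intro S
    obtain ⟨G, T, rfl, hG⟩ := exists_add_single hF
    have hG' : (forestVec k G).IsHomogeneous n := hG ▸ isHomogeneous_forestVec k G
    rw [forestVec_add_single, ← toSym_treeVec, ← toSym_treeVec, hτ.mul_right, hτ'.mul_right,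
      ih n (Nat.lt_succ_self n) G hG, hτ.toSym_right, hτ'.toSym_right, hτ.toSym_right,
      hτ'.toSym_right]
    congr 1
    refine homogeneous_induction (p := fun B => τ (toSym k (treeVec k S)) B =
      τ' (toSym k (treeVec k S)) B) k (isHomogeneous_actDeriv k (treeVec k T) hG') ?_ ?_ ?_ ?_
    · simp
    · intro B B' h h'; simp only [map_add, h, h']
    · intro c B h; simp only [map_smul, h]
    · intro H hH; exact ih n (Nat.lt_succ_self n) H hH _
  intro A
  induction A using MvPolynomial.induction_on with
  | C c =>
    rw [← MvPolynomial.algebraMap_eq, Algebra.algebraMap_eq_smul_one, map_smul, map_smul,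
      LinearMap.smul_apply, LinearMap.smul_apply, hτ.one_left hF, hτ'.one_left hF]
  | add A B hA hB => simp only [map_add, LinearMap.add_apply, hA, hB]
  | mul_X A S hA =>
    obtain ⟨r, hr, h⟩ := unshuffle_forestVec k hF
    have hr' : TensorProduct.map (τ A) (τ (MvPolynomial.X S)) r =
        TensorProduct.map (τ' A) (τ' (MvPolynomial.X S)) r := by
      refine Submodule.span_induction (p := fun r _ => TensorProduct.map (τ A)
        (τ (MvPolynomial.X S)) r = TensorProduct.map (τ' A) (τ' (MvPolynomial.X S)) r)
        ?_ ?_ ?_ ?_ hr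
      · rintro _ ⟨G, H, hG, hH, hGH, rfl⟩
        rw [TensorProduct.map_tmul, TensorProduct.map_tmul, ih _ (by omega) G rfl,
          ih _ (by omega) H rfl]
      · rw [map_zero, map_zero]
      · intro a b _ _ ha hb; rw [map_add, map_add, ha, hb]
      · intro c a _ ha; rw [map_smul, map_smul, ha]
    rw [hτ.mul_left, hτ'.mul_left, h]
    simp only [map_add, TensorProduct.map_tmul, hτ.one_right, hτ'.one_right, hA, hX, hr']

variable (k)

theorem existsUnique_isGuinOudomExtension :
    ∃! τ : ForestAlg k α →ₗ[k] ForestAlg k α →ₗ[k] ForestAlg k α, IsGuinOudomExtension k τ :=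
  ⟨_, isGuinOudomExtension_extFlip k, fun _ h => h.unique (isGuinOudomExtension_extFlip k)⟩

/-- The extension of `◁` to `Sym(L)`: the unique bilinear operation with the properties in
`IsGuinOudomExtension`. -/
def symInsertion : ForestAlg k α →ₗ[k] ForestAlg k α →ₗ[k] ForestAlg k α :=
  (existsUnique_isGuinOudomExtension k).choose

theorem isGuinOudomExtension_symInsertion :
    IsGuinOudomExtension k (symInsertion k (α := α)) :=
  (existsUnique_isGuinOudomExtension k).choose_spec.1

/-- The Guin–Oudom product `A ∗ B = ∑ (A ◁ B₍₁₎) B₍₂₎` on `Sym(L)`. -/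
def guinOudomMul : ForestAlg k α →ₗ[k] ForestAlg k α →ₗ[k] ForestAlg k α :=
  LinearMap.mk₂ k
    (fun A B => LinearMap.mul' k (ForestAlg k α)
      ((symInsertion k A).rTensor (ForestAlg k α) (unshuffle k B)))
    (fun A A' B => by simp only [map_add, LinearMap.rTensor_add, LinearMap.add_apply])
    (fun c A B => by simp only [map_smul, LinearMap.rTensor_smul, LinearMap.smul_apply])
    (fun A B B' => by simp only [map_add])
    (fun c A B => by simp only [map_smul])

end GuinOudom

/-! ### The cut coproduct, the pairing and Hopf algebras -/

section Duality

variable (k : Type v) {α : Type u} [Field k]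

/-- The forest `P^C(T)` of the trees below the edges of a cut `C`. -/
def pruned (t : PlaneTree α) (C : Finset t.Vertex) : Forest α :=
  ∑ v ∈ C, Finsupp.single (t.subtree v).toBinTree 1

/-- The forest `R^C(T)` above the edges of a cut `C`, with at most one tree. -/
def remainderForest (t : PlaneTree α) (C : Finset t.Vertex) : Forest α :=
  (t.remainder C).elim 0 fun s => Finsupp.single s.toBinTree 1

/-- The coproduct of a tree, `∑_C P^C(T) ⊗ R^C(T)` over the binary-admissible cuts `C` of `T`. -/
def treeCoproduct (T : BinTree α) : ForestAlg k α ⊗[k] ForestAlg k α :=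
  ∑ C ∈ T.plane.cuts,
    forestVec k (pruned T.plane C) ⊗ₜ[k] forestVec k (remainderForest T.plane C)

/-- The coproduct `Δ` of `H`: the multiplicative extension of the coproduct of trees. -/
def cutCoproduct : ForestAlg k α →ₐ[k] ForestAlg k α ⊗[k] ForestAlg k α :=
  MvPolynomial.aeval (treeCoproduct k)

/-- The pairing with `⟨F, F'⟩ = s_F δ_{F, F'}` for forests. -/
def pairing : ForestAlg k α →ₗ[k] ForestAlg k α →ₗ[k] k :=
  (MvPolynomial.basisMonomials (BinTree α) k).constr k fun F =>
    (Forest.symmetryFactor F : k) • MvPolynomial.lcoeff k F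

/-- The induced pairing of tensors, `⟨A ⊗ B, A' ⊗ B'⟩ = ⟨A, A'⟩ ⟨B, B'⟩`. -/
def tensorPairing :
    ForestAlg k α ⊗[k] ForestAlg k α →ₗ[k] ForestAlg k α ⊗[k] ForestAlg k α →ₗ[k] k :=
  (TensorProduct.map₂ (pairing k) (pairing k)).compr₂ (LinearMap.mul' k k)

theorem tensorPairing_tmul (A B A' B' : ForestAlg k α) :
    tensorPairing k (A ⊗ₜ B) (A' ⊗ₜ B') = pairing k A A' * pairing k B B' := rfl

open Classical in
theorem pairing_forestVec (F F' : Forest α) :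
    pairing k (forestVec k F) (forestVec k F') =
      if F = F' then (Forest.symmetryFactor F : k) else 0 := by
  have h : forestVec k F = MvPolynomial.basisMonomials (BinTree α) k F := by simp [forestVec]
  rw [pairing, h, Module.Basis.constr_basis]
  simp [forestVec, MvPolynomial.coeff_monomial, eq_comm]

/-- The number `n(F₁, F₂; F₃)`: the coefficient of `F₃` in `F₂ ∗ F₁`. -/
def graftCoeff (F₁ F₂ F₃ : Forest α) : k :=
  MvPolynomial.coeff F₃ (guinOudomMul k (forestVec k F₂) (forestVec k F₁))

/-- The number `m(F₁, F₂; F₃)`: the coefficient of `F₁ ⊗ F₂` in `Δ(F₃)`. -/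
def cutCoeff (F₁ F₂ F₃ : Forest α) : k :=
  ((MvPolynomial.basisMonomials (BinTree α) k).tensorProduct
    (MvPolynomial.basisMonomials (BinTree α) k)).repr
      (cutCoproduct k (forestVec k F₃)) (F₁, F₂)

/-- The counit: the coefficient of the empty forest. -/
def forestCounit : ForestAlg k α →ₗ[k] k := MvPolynomial.lcoeff k 0

/-- The span of the forests with `n` leaves. -/
def gradedPart (n : ℕ) : Submodule k (ForestAlg k α) :=
  MvPolynomial.weightedHomogeneousSubmodule k BinTree.numLeaves n

/-- The pairing between the parts of degree `n`. -/
def gradedPairing (n : ℕ) :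
    gradedPart k (α := α) n →ₗ[k] gradedPart k (α := α) n →ₗ[k] k :=
  (pairing k).domRestrict₁₂ (gradedPart k n) (gradedPart k n)

end Duality

/-- A vector space with a product, a unit, a coproduct, a counit and an `ℕ`-grading is a graded
connected Hopf algebra. -/
structure IsGradedConnectedHopfAlgebra {k : Type v} {V : Type u} [Field k] [AddCommGroup V]
    [Module k V] (mul : V →ₗ[k] V →ₗ[k] V) (one : V) (comul : V →ₗ[k] V ⊗[k] V)
    (counit : V →ₗ[k] k) (deg : ℕ → Submodule k V) : Prop where
  one_mul : ∀ x, mul one x = x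
  mul_one : ∀ x, mul x one = x
  mul_assoc : ∀ x y z, mul (mul x y) z = mul x (mul y z)
  coassoc : ∀ x, TensorProduct.assoc k V V V (comul.rTensor V (comul x)) =
    comul.lTensor V (comul x)
  counit_left : ∀ x, counit.rTensor V (comul x) = (1 : k) ⊗ₜ[k] x
  counit_right : ∀ x, counit.lTensor V (comul x) = x ⊗ₜ[k] (1 : k)
  comul_one : comul one = one ⊗ₜ[k] one
  comul_mul : ∀ x y, comul (mul x y) = TensorProduct.map₂ mul mul (comul x) (comul y)
  counit_one : counit one = 1
  counit_mul : ∀ x y, counit (mul x y) = counit x * counit y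
  antipode : ∃ S : V →ₗ[k] V, ∀ x,
    TensorProduct.lift mul (S.rTensor V (comul x)) = counit x • one ∧
      TensorProduct.lift mul (S.lTensor V (comul x)) = counit x • one
  isInternal : DirectSum.IsInternal deg
  mul_mem : ∀ m n x y, x ∈ deg m → y ∈ deg n → mul x y ∈ deg (m + n)
  comul_mem : ∀ n x, x ∈ deg n → comul x ∈ ⨆ p ∈ Finset.HasAntidiagonal.antidiagonal n,
    LinearMap.range (TensorProduct.map (deg p.1).subtype (deg p.2).subtype)
  connected : deg 0 = Submodule.span k {one}

end BinForest

end

open BinForest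

/-! Everything rests on the operators A ↦ A ∗ y = A ◁ y + A y for y in L (`rightOp`). They generate
Sym(L) from 1 (`rightOp_induction`), and the pre-Lie identity says exactly that they define a right
L-module, which is free of rank one (`exists_rightOp_lift`). Hence an identity that is linear in B
needs to be checked only at B = 1 and under B ↦ B ∗ y. Associativity of ∗, its compatibility with Ш
and with ε, and the antipode of U(L) follow in this way. Freeness also provides the inverse of the
canonical map from the enveloping algebra, so that the Poincaré–Birkhoff–Witt theorem is not needed.

The duality of ∗ and Δ is proved first for a single tree T in the last argument. The projection π
from Sym(L) to L satisfies π(A ∗ B) = ε(A) π(B) + π(A) ◁ B (`treePart_guinOudomMul`). The first term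
is dual to the total cut, so x ◁ B must be dual to the other cuts. Write x ∨ y for grafting to a
common root. In (x ∨ y) ◁ B, either all trees of B are inserted inside the two branches, or a
topmost tree sits at the root edge and the remaining trees are inserted into x ∨ y
(`treeAct_merge`). In a cut of l ∨ r other than the total one, either both branches are cut
properly, or one of them is cut off as a whole and the other is cut properly; cutting off both would
use two edges with the same parent (`properCuts_node`, `sum_properCuts`). These two recursions are
adjoint because ⟨x ∨ y, z ∨ w⟩ = ⟨x, z⟩⟨y, w⟩ + ⟨x, w⟩⟨y, z⟩ (`treePairing_merge`), which is where
the symmetry factors enter, and because Ш is dual to ⊔ (`treePairing_treeAct`). The step from trees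
to forests uses that Ш is multiplicative for ∗ and that Δ is multiplicative for ⊔
(`pairing_guinOudomMul`).

The symmetry factors come from a count of isomorphisms: those of a disjoint union are a bijection of
the components together with isomorphisms of matched components (`card_familyIso`). This gives s_F =
∏ n_T! s_T^{n_T} and the factor 2 for a tree T ∨ T. In characteristic 0 all s_F are invertible, so
forests separate points. Uniqueness, the coalgebra axioms and the grading of ∗ are then transported
through the pairing, and the antipode of H is a geometric series in the convolution algebra. -/

noncomputable section

namespace BinForest

universe u v w

/-! ### Sym(L) as a free right L-module of rank one -/

section Module

variable (k : Type v) {α : Type u} [Field k]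

/-- Right multiplication by `y ∈ L` for the Guin–Oudom product: `A ∗ y = A ◁ y + A y`. -/
def rightOp (y : TreeSpace k α) : ForestAlg k α →ₗ[k] ForestAlg k α :=
  (actDeriv k y : ForestAlg k α →ₗ[k] ForestAlg k α) + LinearMap.mulRight k (toSym k y)

theorem rightOp_apply (y : TreeSpace k α) (A : ForestAlg k α) :
    rightOp k y A = actDeriv k y A + A * toSym k y := rfl

/-- `Sym(L)` is generated by `1` under the operators `A ↦ A ∗ y`. -/
theorem rightOp_induction {p : ForestAlg k α → Prop} (A : ForestAlg k α) (one : p 1)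
    (add : ∀ A B, p A → p B → p (A + B)) (smul : ∀ (c : k) A, p A → p (c • A))
    (op : ∀ (y : TreeSpace k α) A, p A → p (rightOp k y A)) : p A := by
  suffices H : ∀ (n : ℕ) (A : ForestAlg k α), A.IsHomogeneous n → p A by
    induction A using forestAlg_induction k with
    | add A B h h' => exact add _ _ h h'
    | smul c A h => exact smul _ _ h
    | mon F => exact H _ _ (isHomogeneous_forestVec k F)
  have zero : p 0 := by simpa using smul 0 _ one
  intro n
  induction n with
  | zero =>
    intro A hA
    refine homogeneous_induction k hA zero add smul fun F hF => ?_
    rw [Finsupp.degree_eq_zero_iff] at hF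
    subst hF
    exact one
  | succ n ih =>
    intro A hA
    refine homogeneous_induction k hA zero add smul fun F hF => ?_
    obtain ⟨G, T, rfl, hG⟩ := exists_add_single hF
    have hG' : (forestVec k G).IsHomogeneous n := hG ▸ isHomogeneous_forestVec k G
    -- The formula for A ∗ T is solved for A T. Since A ◁ T has as many trees as A, the induction
    -- hypothesis covers both terms.
    have h : forestVec k (G + Finsupp.single T 1) = rightOp k (treeVec k T) (forestVec k G) +
        (-1 : k) • actDeriv k (treeVec k T) (forestVec k G) := by
      rw [rightOp_apply, forestVec_add_single, toSym_treeVec]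
      simp
    rw [h]
    exact add _ _ (op _ _ (ih _ hG')) (smul _ _ (ih _ (isHomogeneous_actDeriv k _ hG')))

variable {V : Type w} [AddCommGroup V] [Module k V] (ρ : TreeSpace k α →ₗ[k] V →ₗ[k] V) (v₀ : V)

open Classical in
/-- Auxiliary recursion for the module map `Sym(L) → V`, on forests with `n` trees. -/
def liftAux : ℕ → ForestAlg k α →ₗ[k] V
  | 0 => (MvPolynomial.basisMonomials (BinTree α) k).constr k fun _ => v₀
  | n + 1 => (MvPolynomial.basisMonomials (BinTree α) k).constr k fun F =>
      if h : ∃ (G : Forest α) (T : BinTree α), F = G + Finsupp.single T 1 then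
        ρ (treeVec k h.choose_spec.choose) (liftAux n (forestVec k h.choose)) -
          liftAux n (actDeriv k (treeVec k h.choose_spec.choose) (forestVec k h.choose))
      else 0

theorem liftAux_zero_one : liftAux k ρ v₀ 0 (1 : ForestAlg k α) = v₀ := by
  have : (1 : ForestAlg k α) = MvPolynomial.basisMonomials (BinTree α) k 0 := by simp
  rw [this, liftAux, Module.Basis.constr_basis]

theorem liftAux_succ_exists (n : ℕ) (F : Forest α)
    (hF : ∃ (G : Forest α) (T : BinTree α), F = G + Finsupp.single T 1) :
    ∃ (G : Forest α) (T : BinTree α), F = G + Finsupp.single T 1 ∧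
      liftAux k ρ v₀ (n + 1) (forestVec k F) =
        ρ (treeVec k T) (liftAux k ρ v₀ n (forestVec k G)) -
          liftAux k ρ v₀ n (actDeriv k (treeVec k T) (forestVec k G)) := by
  refine ⟨hF.choose, hF.choose_spec.choose, hF.choose_spec.choose_spec, ?_⟩
  have h : forestVec k F = MvPolynomial.basisMonomials (BinTree α) k F := by simp [forestVec]
  conv_lhs => rw [liftAux, h, Module.Basis.constr_basis, dif_pos hF]

variable {ρ}

/-- `liftAux` splits off an arbitrarily chosen tree; here the choice is shown not to matter. Two
different choices are compared by splitting off both trees, and the results agree because the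
relation `hρ` for V matches the pre-Lie relation `actDeriv_comm` for Sym(L). -/
theorem liftAux_mul_toSym
    (hρ : ∀ y z v, ρ z (ρ y v) - ρ (y * z) v = ρ y (ρ z v) - ρ (z * y) v)
    (n : ℕ) {B : ForestAlg k α} (hB : B.IsHomogeneous n) (y : TreeSpace k α) :
    liftAux k ρ v₀ (n + 1) (B * toSym k y) =
      ρ y (liftAux k ρ v₀ n B) - liftAux k ρ v₀ n (actDeriv k y B) := by
  induction n using Nat.strong_induction_on generalizing B y with
  | _ n ih =>
  refine homogeneous_induction (p := fun B => liftAux k ρ v₀ (n + 1) (B * toSym k y) =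
      ρ y (liftAux k ρ v₀ n B) - liftAux k ρ v₀ n (actDeriv k y B)) k hB ?_ ?_ ?_ ?_
  · simp
  · intro B B' h h'
    simp only [add_mul, map_add, h, h']; abel
  · intro c B h
    simp only [smul_mul_assoc, map_smul, Derivation.map_smul, h, smul_sub]
  intro F hF
  induction y using treeSpace_induction k with
  | zero => simp [actDeriv_zero]
  | add y z hy hz =>
    simp only [mul_add, map_add, LinearMap.add_apply, actDeriv_add, hy, hz]; abel
  | smul c y hy =>
    simp only [mul_smul_comm, map_smul, LinearMap.smul_apply, actDeriv_smul, hy, smul_sub]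
  | vec t =>
  rw [toSym_treeVec]
  generalize t.toBinTree = T
  rw [← forestVec_add_single]
  obtain ⟨G, S, hGS, h⟩ := liftAux_succ_exists k ρ v₀ n (F + Finsupp.single T 1) ⟨F, T, rfl⟩
  rw [h]
  by_cases hST : S = T
  · subst hST
    rw [add_right_cancel hGS]
  cases n with
  | zero =>
    -- If F is empty, the two decompositions of a single tree force S = T.
    exfalso
    rw [Finsupp.degree_eq_zero_iff] at hF
    subst hF
    have := DFunLike.congr_fun hGS S
    simp [Ne.symm hST] at this
  | succ m =>
  have hSF : Finsupp.single S 1 ≤ F := by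
    rw [Finsupp.single_le_iff]
    have h2 := DFunLike.congr_fun hGS S
    simp [Ne.symm hST] at h2
    omega
  -- As S ≠ T, the forests F and G are K + S and K + T with a common K.
  set K := F - Finsupp.single S 1 with hK
  have hFK : F = K + Finsupp.single S 1 := (tsub_add_cancel_of_le hSF).symm
  have hGK : G = K + Finsupp.single T 1 := by
    have h3 : G + Finsupp.single S 1 = (K + Finsupp.single T 1) + Finsupp.single S 1 := by
      rw [← hGS, hFK]; abel
    exact add_right_cancel h3
  have hKd : K.degree = m := by
    rw [hFK, map_add, Finsupp.degree_single] at hF; omega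
  have hKh : (forestVec k K).IsHomogeneous m := hKd ▸ isHomogeneous_forestVec k K
  clear_value K
  subst hFK hGK
  -- Splitting off U and then W leaves three groups of terms, each symmetric in U and W: the first
  -- by `hρ`, the second visibly, the third by the pre-Lie relation in `e₂`.
  have e₁ : ∀ (U W : BinTree α),
      ρ (treeVec k U) (liftAux k ρ v₀ (m + 1) (forestVec k (K + Finsupp.single W 1))) -
        liftAux k ρ v₀ (m + 1) (actDeriv k (treeVec k U) (forestVec k (K + Finsupp.single W 1))) =
      (ρ (treeVec k U) (ρ (treeVec k W) (liftAux k ρ v₀ m (forestVec k K))) -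
        ρ (treeVec k W * treeVec k U) (liftAux k ρ v₀ m (forestVec k K))) -
      (ρ (treeVec k U) (liftAux k ρ v₀ m (actDeriv k (treeVec k W) (forestVec k K))) +
        ρ (treeVec k W) (liftAux k ρ v₀ m (actDeriv k (treeVec k U) (forestVec k K)))) +
      (liftAux k ρ v₀ m (actDeriv k (treeVec k W) (actDeriv k (treeVec k U) (forestVec k K)) +
        actDeriv k (treeVec k W * treeVec k U) (forestVec k K))) := by
    intro U W
    rw [forestVec_add_single, Derivation.leibniz, smul_eq_mul, smul_eq_mul, actDeriv_X,
      mul_comm (MvPolynomial.X W), ← toSym_treeVec]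
    rw [map_add, ih m (Nat.lt_succ_self m) hKh,
      ih m (Nat.lt_succ_self m) hKh, ih m (Nat.lt_succ_self m) (isHomogeneous_actDeriv k _ hKh)]
    simp only [map_sub, map_add]
    abel
  rw [e₁ S T, e₁ T S, hρ (treeVec k T) (treeVec k S)]
  have e₂ : actDeriv k (treeVec k T) (actDeriv k (treeVec k S) (forestVec k K)) +
        actDeriv k (treeVec k T * treeVec k S) (forestVec k K) =
      actDeriv k (treeVec k S) (actDeriv k (treeVec k T) (forestVec k K)) +
        actDeriv k (treeVec k S * treeVec k T) (forestVec k K) := by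
    have := actDeriv_comm k (treeVec k T) (treeVec k S) (forestVec k K)
    rw [sub_eq_sub_iff_add_eq_add] at this
    rw [this]
  rw [e₂]
  abel

/-- `Sym(L)` with the operators `A ↦ A ∗ y` is the free right module of rank one over `L`. -/
theorem exists_rightOp_lift
    (hρ : ∀ y z v, ρ z (ρ y v) - ρ (y * z) v = ρ y (ρ z v) - ρ (z * y) v) :
    ∃ f : ForestAlg k α →ₗ[k] V, f 1 = v₀ ∧ ∀ y B, f (rightOp k y B) = ρ y (f B) := by
  let f : ForestAlg k α →ₗ[k] V := (MvPolynomial.basisMonomials (BinTree α) k).constr k fun F =>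
    liftAux k ρ v₀ F.degree (forestVec k F)
  have hf : ∀ F : Forest α, f (forestVec k F) = liftAux k ρ v₀ F.degree (forestVec k F) := by
    intro F
    have h : forestVec k F = MvPolynomial.basisMonomials (BinTree α) k F := by simp [forestVec]
    conv_lhs => rw [h, Module.Basis.constr_basis]
  have hf' : ∀ (n : ℕ) (B : ForestAlg k α), B.IsHomogeneous n → f B = liftAux k ρ v₀ n B := by
    intro n B hB
    refine homogeneous_induction (p := fun B => f B = liftAux k ρ v₀ n B) k hB ?_ ?_ ?_ ?_
    · simp
    · intro B B' h h'; simp only [map_add, h, h']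
    · intro c B h; simp only [map_smul, h]
    · intro F hF; rw [hf, hF]
  refine ⟨f, ?_, fun y B => ?_⟩
  · rw [hf' 0 1 (MvPolynomial.isHomogeneous_one _ _), liftAux_zero_one]
  · induction B using forestAlg_induction k with
    | add B B' h h' => simp only [map_add, h, h']
    | smul c B h => simp only [map_smul, h]
    | mon F =>
      have hF := isHomogeneous_forestVec k F
      rw [rightOp_apply, map_add, hf' _ _ (isHomogeneous_actDeriv k y hF),
        hf' _ _ (hF.mul (isHomogeneous_toSym k y)), hf' _ _ hF, liftAux_mul_toSym k v₀ hρ _ hF]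
      abel

end Module

/-! ### The bialgebra U(L), its antipode, and the universal enveloping algebra -/

section Product

variable (k : Type v) {α : Type u} [Field k]

/-- Uniqueness identifies the abstractly chosen extension with the constructed one, whose recursion
is thereby available for arbitrary A, not only for A in L. -/
theorem symInsertion_eq : symInsertion k (α := α) = (extFlip k).flip :=
  (isGuinOudomExtension_symInsertion k).unique (isGuinOudomExtension_extFlip k)

theorem symInsertion_mul_toSym (A B : ForestAlg k α) (y : TreeSpace k α) :
    symInsertion k A (B * toSym k y) =
      actDeriv k y (symInsertion k A B) - symInsertion k A (actDeriv k y B) := by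
  rw [symInsertion_eq]
  exact extFlip_mul_toSym k B y A

theorem symInsertion_one (A : ForestAlg k α) : symInsertion k A 1 = A :=
  (isGuinOudomExtension_symInsertion k).one_right A

theorem guinOudomMul_apply (A B : ForestAlg k α) :
    guinOudomMul k A B = LinearMap.mul' k (ForestAlg k α)
      ((symInsertion k A).rTensor (ForestAlg k α) (unshuffle k B)) := rfl

theorem guinOudomMul_one (A : ForestAlg k α) : guinOudomMul k A 1 = A := by
  rw [guinOudomMul_apply, map_one, Algebra.TensorProduct.one_def, LinearMap.rTensor_tmul,
    LinearMap.mul'_apply, symInsertion_one, mul_one]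

/-- This is A ∗ (B ∗ y) = (A ∗ B) ∗ y. As y is primitive, Ш(B ∗ y) is explicit; the terms A ◁ (B₍₁₎
◁ y) cancel against those in A ◁ (B₍₁₎ y), and what remains is the Leibniz rule for (A ◁ B₍₁₎) B₍₂₎.
-/
theorem guinOudomMul_rightOp (A B : ForestAlg k α) (y : TreeSpace k α) :
    guinOudomMul k A (rightOp k y B) = rightOp k y (guinOudomMul k A B) := by
  rw [rightOp_apply, rightOp_apply, guinOudomMul_apply, guinOudomMul_apply, map_add (unshuffle k),
    unshuffle_actDeriv, map_mul, unshuffle_toSym]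
  generalize unshuffle k B = t
  induction t using TensorProduct.induction_on with
  | zero => simp
  | add s t hs ht =>
    simp only [add_mul, map_add] at *
    linear_combination hs + ht
  | tmul a b =>
    simp only [mul_add, map_add, coDeriv_tmul, Algebra.TensorProduct.tmul_mul_tmul, mul_one,
      LinearMap.rTensor_tmul, LinearMap.mul'_apply, symInsertion_mul_toSym, Derivation.leibniz,
      smul_eq_mul]
    ring

theorem one_guinOudomMul (A : ForestAlg k α) : guinOudomMul k 1 A = A := by
  induction A using rightOp_induction k with
  | one => exact guinOudomMul_one k 1
  | add A B h h' => rw [map_add, h, h']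
  | smul c A h => rw [map_smul, h]
  | op y A h => rw [guinOudomMul_rightOp, h]

theorem guinOudomMul_toSym (A : ForestAlg k α) (y : TreeSpace k α) :
    guinOudomMul k A (toSym k y) = rightOp k y A := by
  have h : toSym k y = rightOp k y 1 := by simp [rightOp_apply]
  rw [h, guinOudomMul_rightOp, guinOudomMul_one]

/-- As functions of C, both sides agree at 1 and commute with every `rightOp`, and such maps
coincide by generation. -/
theorem guinOudomMul_assoc (A B C : ForestAlg k α) :
    guinOudomMul k (guinOudomMul k A B) C = guinOudomMul k A (guinOudomMul k B C) := by
  induction C using rightOp_induction k with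
  | one => simp only [guinOudomMul_one]
  | add C D h h' => simp only [map_add, h, h']
  | smul c C h => simp only [map_smul, h]
  | op y C h => simp only [guinOudomMul_rightOp, h]

/-- The term A (y ◁ z) cancels on the left and A (z ◁ y) on the right. The other terms are symmetric
in y and z, or reduce to `actDeriv_comm`. This is the relation that makes Sym(L) an L-module. -/
theorem rightOp_comm (y z : TreeSpace k α) (A : ForestAlg k α) :
    rightOp k z (rightOp k y A) - rightOp k (y * z) A =
      rightOp k y (rightOp k z A) - rightOp k (z * y) A := by
  have h := actDeriv_comm k y z A
  simp only [rightOp_apply, map_add, Derivation.leibniz, smul_eq_mul, actDeriv_toSym]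
  linear_combination h

/-- The action of `y` on `Sym(L) ⊗ Sym(L)` by `rightOp`. -/
def coRightOp (y : TreeSpace k α) :
    ForestAlg k α ⊗[k] ForestAlg k α →ₗ[k] ForestAlg k α ⊗[k] ForestAlg k α :=
  (rightOp k y).rTensor (ForestAlg k α) + (rightOp k y).lTensor (ForestAlg k α)

theorem coRightOp_tmul (y : TreeSpace k α) (a b : ForestAlg k α) :
    coRightOp k y (a ⊗ₜ b) = rightOp k y a ⊗ₜ b + a ⊗ₜ rightOp k y b := rfl

theorem unshuffle_rightOp (y : TreeSpace k α) (A : ForestAlg k α) :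
    unshuffle k (rightOp k y A) = coRightOp k y (unshuffle k A) := by
  rw [rightOp_apply, map_add, map_mul, unshuffle_actDeriv, unshuffle_toSym]
  generalize unshuffle k A = t
  induction t using TensorProduct.induction_on with
  | zero => simp
  | add s t hs ht =>
    simp only [add_mul, map_add] at *
    rw [← hs, ← ht]; abel
  | tmul a b =>
    simp only [mul_add, coDeriv_tmul, coRightOp_tmul, Algebra.TensorProduct.tmul_mul_tmul, mul_one,
      rightOp_apply, TensorProduct.add_tmul, TensorProduct.tmul_add]
    abel

theorem map₂_guinOudomMul_coRightOp (y : TreeSpace k α)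
    (s t : ForestAlg k α ⊗[k] ForestAlg k α) :
    TensorProduct.map₂ (guinOudomMul k) (guinOudomMul k) s (coRightOp k y t) =
      coRightOp k y (TensorProduct.map₂ (guinOudomMul k) (guinOudomMul k) s t) := by
  induction t using TensorProduct.induction_on with
  | zero => simp
  | add t t' h h' => simp only [map_add, h, h']
  | tmul a b =>
  induction s using TensorProduct.induction_on with
  | zero => simp
  | add s s' h h' => simp only [map_add, LinearMap.add_apply, h, h']
  | tmul c d =>
    simp only [coRightOp_tmul, map_add, TensorProduct.map₂_apply_tmul, TensorProduct.map_tmul,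
      guinOudomMul_rightOp]

/-- Both sides carry B ↦ B ∗ y into the coderivation `coRightOp`, so it suffices to compare them at
B = 1. -/
theorem unshuffle_guinOudomMul (A B : ForestAlg k α) :
    unshuffle k (guinOudomMul k A B) =
      TensorProduct.map₂ (guinOudomMul k) (guinOudomMul k) (unshuffle k A) (unshuffle k B) := by
  induction B using rightOp_induction k with
  | one =>
    rw [guinOudomMul_one, map_one]
    generalize unshuffle k A = t
    induction t using TensorProduct.induction_on with
    | zero => simp
    | add s t hs ht => simp only [map_add, LinearMap.add_apply, ← hs, ← ht]
    | tmul a b =>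
      rw [Algebra.TensorProduct.one_def, TensorProduct.map₂_apply_tmul, TensorProduct.map_tmul,
        guinOudomMul_one, guinOudomMul_one]
  | add B C h h' => simp only [map_add, h, h']
  | smul c B h => simp only [map_smul, h]
  | op y B h => rw [guinOudomMul_rightOp, unshuffle_rightOp, h, unshuffle_rightOp,
      map₂_guinOudomMul_coRightOp]

theorem forestCounit_one : forestCounit k (1 : ForestAlg k α) = 1 := by
  simp [forestCounit]

theorem forestCounit_mul (A B : ForestAlg k α) :
    forestCounit k (A * B) = forestCounit k A * forestCounit k B := by
  simp only [forestCounit, MvPolynomial.lcoeff_apply, ← MvPolynomial.constantCoeff_eq, map_mul]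

theorem forestCounit_toSym (y : TreeSpace k α) : forestCounit k (toSym k y) = 0 :=
  (isHomogeneous_toSym k y).coeff_eq_zero (by simp)

theorem forestCounit_actDeriv (y : TreeSpace k α) (A : ForestAlg k α) :
    forestCounit k (actDeriv k y A) = 0 := by
  induction A using MvPolynomial.induction_on with
  | C c => rw [← MvPolynomial.algebraMap_eq, Derivation.map_algebraMap, map_zero]
  | add A B hA hB => rw [map_add, map_add, hA, hB, add_zero]
  | mul_X A T hA =>
    rw [Derivation.leibniz, smul_eq_mul, smul_eq_mul, map_add, forestCounit_mul, forestCounit_mul,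
      hA, actDeriv_X, forestCounit_toSym, mul_zero, mul_zero, add_zero]

theorem forestCounit_rightOp (y : TreeSpace k α) (A : ForestAlg k α) :
    forestCounit k (rightOp k y A) = 0 := by
  rw [rightOp_apply, map_add, forestCounit_actDeriv, forestCounit_mul, forestCounit_toSym,
    mul_zero, add_zero]

theorem forestCounit_guinOudomMul (A B : ForestAlg k α) :
    forestCounit k (guinOudomMul k A B) = forestCounit k A * forestCounit k B := by
  induction B using rightOp_induction k with
  | one => rw [guinOudomMul_one, forestCounit_one, mul_one]
  | add B C h h' => simp only [map_add, h, h', mul_add]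
  | smul c B h => simp only [map_smul, h, smul_eq_mul]; ring
  | op y B h => rw [guinOudomMul_rightOp, forestCounit_rightOp, forestCounit_rightOp, mul_zero]

/-- The antipode of `U(L)`. -/
theorem exists_antipode_guinOudomMul : ∃ S : ForestAlg k α →ₗ[k] ForestAlg k α, ∀ x,
    TensorProduct.lift (guinOudomMul k) (S.rTensor _ (unshuffle k x)) = forestCounit k x • 1 ∧
    TensorProduct.lift (guinOudomMul k) (S.lTensor _ (unshuffle k x)) = forestCounit k x • 1 := by
  -- An antipode reverses products and changes the sign of primitive elements, so S(A ∗ y) = -y ∗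
  -- S(A). The module relation for this action is `rightOp_comm` at 1, multiplied on the right.
  obtain ⟨S, hS1, hS⟩ := exists_rightOp_lift k (ρ := -(guinOudomMul k ∘ₗ toSym k))
    (1 : ForestAlg k α) (fun y z A => by
      have h := rightOp_comm k y z 1
      simp only [← guinOudomMul_toSym, one_guinOudomMul] at h
      have h' := congrArg (fun B => guinOudomMul k B A) h
      simp only [map_sub, LinearMap.sub_apply, guinOudomMul_assoc] at h'
      simp only [LinearMap.neg_apply, LinearMap.comp_apply, map_neg, neg_neg]
      linear_combination -h')
  simp only [LinearMap.neg_apply, LinearMap.comp_apply] at hS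
  refine ⟨S, fun x => ?_⟩
  induction x using rightOp_induction k with
  | one =>
    rw [map_one, Algebra.TensorProduct.one_def, LinearMap.rTensor_tmul, LinearMap.lTensor_tmul,
      TensorProduct.lift.tmul, TensorProduct.lift.tmul, hS1, one_guinOudomMul, forestCounit_one,
      one_smul]
    exact ⟨rfl, rfl⟩
  | add A B h h' => simp only [map_add, h, h', add_smul, and_self]
  | smul c A h => simp only [map_smul, h, smul_assoc, and_self]
  | op y A h =>
    rw [unshuffle_rightOp, forestCounit_rightOp, zero_smul]
    constructor
    · have key : ∀ t : ForestAlg k α ⊗[k] ForestAlg k α,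
          TensorProduct.lift (guinOudomMul k) (S.rTensor _ (coRightOp k y t)) =
            rightOp k y (TensorProduct.lift (guinOudomMul k) (S.rTensor _ t)) -
            guinOudomMul k (toSym k y) (TensorProduct.lift (guinOudomMul k) (S.rTensor _ t)) := by
        intro t
        induction t using TensorProduct.induction_on with
        | zero => simp
        | add s t hs ht => simp only [map_add, hs, ht]; abel
        | tmul a b =>
          simp only [coRightOp_tmul, map_add, LinearMap.rTensor_tmul, TensorProduct.lift.tmul, hS,
            guinOudomMul_rightOp, map_neg, LinearMap.neg_apply, guinOudomMul_assoc]
          abel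
      -- By induction the inner sum is a multiple of 1, which commutes with y.
      rw [key, h.1, map_smul, map_smul, guinOudomMul_one, rightOp_apply,
        Derivation.map_one_eq_zero, zero_add, one_mul, sub_self]
    -- Here a ∗ y ∗ S(b) cancels in every tensor separately, without the induction hypothesis.
    · generalize unshuffle k A = t
      induction t using TensorProduct.induction_on with
      | zero => simp
      | add s t hs ht => simp only [map_add, hs, ht, add_zero]
      | tmul a b =>
        simp only [coRightOp_tmul, map_add, LinearMap.lTensor_tmul, TensorProduct.lift.tmul, hS,
          map_neg, ← guinOudomMul_assoc, guinOudomMul_toSym, add_neg_cancel]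

/-- `Sym(L)` with the Guin–Oudom product. -/
def GuinOudomAlg (k : Type v) (α : Type u) [Field k] : Type (max u v) := ForestAlg k α

instance : AddCommGroup (GuinOudomAlg k α) := inferInstanceAs (AddCommGroup (ForestAlg k α))

instance : Module k (GuinOudomAlg k α) := inferInstanceAs (Module k (ForestAlg k α))

instance : Ring (GuinOudomAlg k α) where
  __ := (inferInstance : AddCommGroup (GuinOudomAlg k α))
  mul A B := guinOudomMul k A B
  one := (1 : ForestAlg k α)
  left_distrib A B C := map_add (guinOudomMul k A) B C
  right_distrib A B C := LinearMap.map_add₂ (guinOudomMul k) A B C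
  zero_mul A := LinearMap.map_zero₂ (guinOudomMul k) A
  mul_zero A := map_zero (guinOudomMul k A)
  mul_assoc A B C := guinOudomMul_assoc k A B C
  one_mul A := one_guinOudomMul k A
  mul_one A := guinOudomMul_one k A

attribute [local instance 100] LieRing.ofAssociativeRing

instance : Algebra k (GuinOudomAlg k α) :=
  Algebra.ofModule (fun c A B => LinearMap.map_smul₂ (guinOudomMul k) c A B)
    (fun c A B => map_smul (guinOudomMul k A) c B)

/-- The inclusion of `L` into `Sym(L)` as a morphism of Lie algebras. -/
def toGuinOudomAlg : TreeSpace k α →ₗ⁅k⁆ GuinOudomAlg k α where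
  toFun := toSym k
  map_add' := map_add (toSym k)
  map_smul' := map_smul (toSym k)
  map_lie' {x y} := by
    have h := rightOp_comm k x y 1
    simp only [← guinOudomMul_toSym, one_guinOudomMul] at h
    change toSym k (x * y - y * x) =
      guinOudomMul k (toSym k x) (toSym k y) - guinOudomMul k (toSym k y) (toSym k x)
    rw [map_sub]
    linear_combination -h

/-- `(Sym(L), ∗)` is the universal enveloping algebra of `L`. -/
theorem exists_universalEnvelopingAlgebra_equiv :
    ∃ e : UniversalEnvelopingAlgebra k (TreeSpace k α) ≃ₗ[k] ForestAlg k α,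
      e 1 = 1 ∧ (∀ a b, e (a * b) = guinOudomMul k (e a) (e b)) ∧
        ∀ x : TreeSpace k α, e (UniversalEnvelopingAlgebra.ι k x) = toSym k x := by
  let U := UniversalEnvelopingAlgebra k (TreeSpace k α)
  let ι : TreeSpace k α →ₗ⁅k⁆ U := UniversalEnvelopingAlgebra.ι k
  let e : U →ₐ[k] GuinOudomAlg k α := UniversalEnvelopingAlgebra.lift k (toGuinOudomAlg k)
  have he : ∀ x, e (ι x) = toSym k x := UniversalEnvelopingAlgebra.lift_ι_apply' k _
  -- The inverse of e is the module map for which y acts on the enveloping algebra by right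
  -- multiplication by ι(y).
  obtain ⟨f, hf1, hf⟩ := exists_rightOp_lift k
    (ρ := (LinearMap.mul k U).flip ∘ₗ (ι : TreeSpace k α →ₗ[k] U)) (1 : U) (fun y z v => by
      have h := ι.map_lie y z
      have h' : ⁅y, z⁆ = y * z - z * y := rfl
      rw [LieRing.of_associative_ring_bracket, h', map_sub] at h
      simp only [LinearMap.comp_apply, LinearMap.flip_apply, LinearMap.mul_apply',
        LieHom.coe_toLinearMap, mul_assoc]
      rw [sub_eq_sub_iff_sub_eq_sub, ← mul_sub, ← mul_sub, h])
  have hf' : ∀ y B, f (rightOp k y B) = f B * ι y := hf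
  have hmul : ∀ A B, f (guinOudomMul k A B) = f A * f B := by
    intro A B
    induction B using rightOp_induction k with
    | one => rw [guinOudomMul_one, hf1, mul_one]
    | add B C h h' => simp only [map_add, h, h', mul_add]
    | smul c B h => simp only [map_smul, h, mul_smul_comm]
    | op y B h => rw [guinOudomMul_rightOp, hf', hf', h, mul_assoc]
  let f' : GuinOudomAlg k α →ₐ[k] U := AlgHom.ofLinearMap f hf1 hmul
  have h₁ : f'.comp e = AlgHom.id k U := by
    refine UniversalEnvelopingAlgebra.hom_ext (R := k) (LieHom.ext fun x => ?_)
    change f (e (ι x)) = ι x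
    have h : toSym k x = rightOp k x 1 := by simp [rightOp_apply]
    rw [he, h, hf', hf1, one_mul]
  have h₂ : ∀ A, e (f A) = A := by
    intro A
    induction A using rightOp_induction k with
    | one => rw [hf1, map_one]; rfl
    | add A B h h' => rw [map_add, map_add, h, h']; rfl
    | smul c A h => rw [map_smul, map_smul, h]; rfl
    | op y A h =>
      rw [hf', map_mul, h, he]
      exact guinOudomMul_toSym k A y
  let e' : U →ₗ[k] ForestAlg k α := e.toLinearMap
  exact ⟨LinearEquiv.ofLinearMap e' f (LinearMap.ext h₂)
    (LinearMap.ext fun u => DFunLike.congr_fun h₁ u), map_one e, map_mul e, he⟩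

end Product

/-! ### Isomorphisms of labelled rooted trees -/

namespace PlaneTree

variable {α : Type u}

/-- Isomorphisms of plane trees as labelled rooted trees. -/
def Iso (t s : PlaneTree α) : Type :=
  {σ : t.Vertex ≃ s.Vertex // σ t.root = s.root ∧
    (∀ v w, s.IsParent (σ v) (σ w) ↔ t.IsParent v w) ∧ ∀ v, s.label (σ v) = t.label v}

instance (t s : PlaneTree α) : Finite (Iso t s) := by
  classical exact inferInstanceAs (Finite (Subtype _))

def Iso.trans {t s u : PlaneTree α} (σ : Iso t s) (τ : Iso s u) : Iso t u :=
  ⟨σ.1.trans τ.1, by simp [σ.2.1, τ.2.1], fun v w => by simp [σ.2.2.1, τ.2.2.1], fun v => by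
    simp [σ.2.2.2, τ.2.2.2]⟩

def Iso.symm {t s : PlaneTree α} (σ : Iso t s) : Iso s t :=
  ⟨σ.1.symm, by rw [Equiv.symm_apply_eq, σ.2.1], fun v w => by
    simpa using (σ.2.2.1 (σ.1.symm v) (σ.1.symm w)).symm, fun v => by
    simpa using (σ.2.2.2 (σ.1.symm v)).symm⟩

def Iso.refl (t : PlaneTree α) : Iso t t := ⟨Equiv.refl _, rfl, fun _ _ => Iff.rfl, fun _ => rfl⟩

def Iso.congrRight {s u : PlaneTree α} (t : PlaneTree α) (τ : Iso s u) : Iso t s ≃ Iso t u where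
  toFun σ := σ.trans τ
  invFun σ := σ.trans τ.symm
  left_inv _ := Subtype.ext (Equiv.ext fun _ => τ.1.symm_apply_apply _)
  right_inv _ := Subtype.ext (Equiv.ext fun _ => τ.1.apply_symm_apply _)

def Iso.congrLeft {t u : PlaneTree α} (τ : Iso t u) (s : PlaneTree α) : Iso t s ≃ Iso u s where
  toFun σ := τ.symm.trans σ
  invFun σ := τ.trans σ
  left_inv σ := Subtype.ext (Equiv.ext fun _ => congrArg σ.1 (τ.1.symm_apply_apply _))
  right_inv σ := Subtype.ext (Equiv.ext fun _ => congrArg σ.1 (τ.1.apply_symm_apply _))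

theorem reflTransGen_root : ∀ (t : PlaneTree α) (v : t.Vertex),
    Relation.ReflTransGen t.IsParent t.root v
  | leaf _, _ => .refl
  | node _ _, none => .refl
  | node l r, some (.inl v) =>
    have h : (node l r).IsParent none (some (.inl l.root)) := (rfl : l.root = l.root)
    .head h (Relation.ReflTransGen.lift (p := (node l r).IsParent)
      (fun w : l.Vertex => some (Sum.inl w)) (fun _ _ h => h) _ _ (reflTransGen_root l v))
  | node l r, some (.inr v) =>
    have h : (node l r).IsParent none (some (.inr r.root)) := (rfl : r.root = r.root)
    .head h (Relation.ReflTransGen.lift (p := (node l r).IsParent)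
      (fun w : r.Vertex => some (Sum.inr w)) (fun _ _ h => h) _ _ (reflTransGen_root r v))

end PlaneTree

/-! ### Isomorphisms of disjoint unions of trees -/

section Family

variable {α : Type u} {ι : Type v} {κ : Type w} (t : ι → PlaneTree α) (s : κ → PlaneTree α)

/-- The parent relation of the disjoint union of a family of trees. -/
def FamilyParent (v w : Σ i, (t i).Vertex) : Prop :=
  ∃ (i : ι) (x y : (t i).Vertex), v = ⟨i, x⟩ ∧ w = ⟨i, y⟩ ∧ (t i).IsParent x y

theorem familyParent_mk (t : ι → PlaneTree α) {i : ι} {x y : (t i).Vertex} :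
    FamilyParent t ⟨i, x⟩ ⟨i, y⟩ ↔ (t i).IsParent x y := by
  constructor
  · rintro ⟨j, x', y', h, h', hp⟩
    obtain rfl : i = j := congrArg Sigma.fst h
    rw [eq_of_heq (Sigma.mk.inj h).2, eq_of_heq (Sigma.mk.inj h').2]
    exact hp
  · exact fun h => ⟨i, x, y, rfl, rfl, h⟩

theorem FamilyParent.fst_eq {t : ι → PlaneTree α} {v w : Σ i, (t i).Vertex}
    (h : FamilyParent t v w) : v.1 = w.1 := by
  obtain ⟨i, x, y, rfl, rfl, -⟩ := h
  rfl

def FamilyRoot (v : Σ i, (t i).Vertex) : Prop := v.2 = PlaneTree.root _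

def familyLabel (v : Σ i, (t i).Vertex) : Option α := PlaneTree.label _ v.2

/-- Isomorphisms of disjoint unions of families of labelled rooted trees. -/
def FamilyIso : Type _ :=
  {σ : (Σ i, (t i).Vertex) ≃ Σ j, (s j).Vertex //
    (∀ v, FamilyRoot s (σ v) ↔ FamilyRoot t v) ∧
    (∀ v w, FamilyParent s (σ v) (σ w) ↔ FamilyParent t v w) ∧
    ∀ v, familyLabel s (σ v) = familyLabel t v}

variable {t s}

def FamilyIso.symm (σ : FamilyIso t s) : FamilyIso s t :=
  ⟨σ.1.symm, fun v => by simpa using (σ.2.1 (σ.1.symm v)).symm, fun v w => by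
    simpa using (σ.2.2.1 (σ.1.symm v) (σ.1.symm w)).symm, fun v => by
    simpa using (σ.2.2.2 (σ.1.symm v)).symm⟩

/-- Edges stay within a component and every vertex is reached from its root, so an isomorphism maps
a component into a single component. -/
theorem FamilyIso.fst_apply (σ : FamilyIso t s) (i : ι) (v : (t i).Vertex) :
    (σ.1 ⟨i, v⟩).1 = (σ.1 ⟨i, (t i).root⟩).1 := by
  induction (t i).reflTransGen_root v with
  | refl => rfl
  | tail _ h ih => rw [← ih, ((σ.2.2.1 _ _).2 ((familyParent_mk _).2 h)).fst_eq]

theorem FamilyIso.apply_root (σ : FamilyIso t s) (i : ι) :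
    σ.1 ⟨i, (t i).root⟩ = ⟨(σ.1 ⟨i, (t i).root⟩).1, PlaneTree.root _⟩ :=
  Sigma.ext rfl (heq_of_eq ((σ.2.1 ⟨i, (t i).root⟩).2 rfl))

theorem FamilyIso.symm_fst (σ : FamilyIso t s) (i : ι) :
    (σ.symm.1 ⟨(σ.1 ⟨i, (t i).root⟩).1, PlaneTree.root _⟩).1 = i := by
  rw [← σ.apply_root i]
  exact congrArg Sigma.fst (σ.1.symm_apply_apply _)

/-- The bijection of components induced by an isomorphism. -/
def FamilyIso.component (σ : FamilyIso t s) : ι ≃ κ where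
  toFun i := (σ.1 ⟨i, (t i).root⟩).1
  invFun j := (σ.symm.1 ⟨j, (s j).root⟩).1
  left_inv i := σ.symm_fst i
  right_inv j := σ.symm.symm_fst j

/-- An isomorphism of families from isomorphisms of the components. -/
def FamilyIso.ofComponents (x : Σ π : ι ≃ κ, ∀ i, PlaneTree.Iso (t i) (s (π i))) :
    FamilyIso t s :=
  ⟨Equiv.sigmaCongr x.1 fun i => (x.2 i).1, by
    rintro ⟨i, v⟩
    change (x.2 i).1 v = (s (x.1 i)).root ↔ v = (t i).root
    constructor
    · exact fun h => (x.2 i).1.injective (h.trans (x.2 i).2.1.symm)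
    · rintro rfl
      exact (x.2 i).2.1, by
    rintro ⟨i, v⟩ ⟨j, w⟩
    change FamilyParent s ⟨x.1 i, (x.2 i).1 v⟩ ⟨x.1 j, (x.2 j).1 w⟩ ↔ _
    constructor
    · intro h
      obtain rfl : i = j := x.1.injective h.fst_eq
      exact (familyParent_mk _).2 (((x.2 i).2.2.1 v w).1 ((familyParent_mk _).1 h))
    · intro h
      obtain rfl : i = j := h.fst_eq
      exact (familyParent_mk _).2 (((x.2 i).2.2.1 v w).2 ((familyParent_mk _).1 h)), by
    rintro ⟨i, v⟩
    exact (x.2 i).2.2.2 v⟩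

/-- Both σ and its inverse respect components and their roots, so σ is the same as a matching of the
components together with isomorphisms of matched trees. -/
theorem FamilyIso.ofComponents_bijective :
    Function.Bijective (ofComponents (t := t) (s := s)) := by
  constructor
  · rintro ⟨π, φ⟩ ⟨π', φ'⟩ h
    have h' : ∀ i v, (⟨π i, (φ i).1 v⟩ : Σ j, (s j).Vertex) = ⟨π' i, (φ' i).1 v⟩ := fun i v =>
      congrArg (fun τ => τ.1 ⟨i, v⟩) h
    obtain rfl : π = π' := Equiv.ext fun i => congrArg Sigma.fst (h' i (t i).root)
    congr 1
    exact funext fun i => Subtype.ext (Equiv.ext fun v => eq_of_heq (Sigma.mk.inj (h' i v)).2)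
  · intro σ
    -- Stating the images as pairs with a fixed first entry makes f and g maps between the trees
    -- themselves, without transport along equalities of components.
    have h₁ : ∀ i (v : (t i).Vertex), ∃ w, σ.1 ⟨i, v⟩ = ⟨σ.component i, w⟩ := by
      intro i v
      have h := σ.fst_apply i v
      change _ = σ.component i at h
      rw [← h]
      exact ⟨_, rfl⟩
    have h₂ : ∀ i (w : (s (σ.component i)).Vertex), ∃ v, σ.1.symm ⟨σ.component i, w⟩ = ⟨i, v⟩ := by
      intro i w
      have h : (σ.1.symm ⟨σ.component i, w⟩).1 = i :=
        (σ.symm.fst_apply _ w).trans (σ.component.symm_apply_apply i)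
      generalize σ.1.symm ⟨σ.component i, w⟩ = z at h
      subst h
      exact ⟨_, rfl⟩
    choose f hf using h₁
    choose g hg using h₂
    have hgf : ∀ i v, g i (f i v) = v := fun i v => by
      have h : (⟨i, g i (f i v)⟩ : Σ i, (t i).Vertex) = ⟨i, v⟩ := by
        rw [← hg, ← hf, Equiv.symm_apply_apply]
      exact eq_of_heq (Sigma.mk.inj h).2
    have hfg : ∀ i w, f i (g i w) = w := fun i w => by
      have h : (⟨σ.component i, f i (g i w)⟩ : Σ i, (s i).Vertex) = ⟨σ.component i, w⟩ := by
        rw [← hf, ← hg, Equiv.apply_symm_apply]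
      exact eq_of_heq (Sigma.mk.inj h).2
    refine ⟨⟨σ.component, fun i => ⟨⟨f i, g i, hgf i, hfg i⟩, ?_, fun v w => ?_, fun v => ?_⟩⟩,
      Subtype.ext (Equiv.ext fun ⟨i, v⟩ => (hf i v).symm)⟩
    · have h := (hf i (t i).root).symm.trans (σ.apply_root i)
      exact eq_of_heq (Sigma.mk.inj h).2
    · change (s _).IsParent (f i v) (f i w) ↔ _
      rw [← familyParent_mk, ← hf, ← hf, σ.2.2.1, familyParent_mk]
    · have h := σ.2.2.2 ⟨i, v⟩
      rw [hf] at h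
      exact h

/-- A permanent: every matching of components contributes the product of the numbers of
isomorphisms. It serves both for the two branches at a vertex and for the components of a forest. -/
theorem card_familyIso [Fintype ι] [Fintype κ] [DecidableEq ι] [DecidableEq κ] :
    Nat.card (FamilyIso t s) = ∑ π : ι ≃ κ, ∏ i, Nat.card (PlaneTree.Iso (t i) (s (π i))) := by
  rw [← Nat.card_congr (Equiv.ofBijective _ FamilyIso.ofComponents_bijective), Nat.card_sigma]
  simp only [Nat.card_pi]

end Family

/-! ### Counting isomorphisms through the branches at the root -/

namespace PlaneTree

variable {α : Type u}

/-- The two branches of `node l r` as a family. -/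
def branches (l r : PlaneTree α) : Bool → PlaneTree α
  | false => l
  | true => r

/-- The vertices of `node l r` other than the root. -/
def branchVertex (l r : PlaneTree α) : (Σ b, (branches l r b).Vertex) ≃ l.Vertex ⊕ r.Vertex where
  toFun
    | ⟨false, v⟩ => .inl v
    | ⟨true, v⟩ => .inr v
  invFun
    | .inl v => ⟨false, v⟩
    | .inr v => ⟨true, v⟩
  left_inv := by rintro ⟨_ | _, v⟩ <;> rfl
  right_inv := by rintro (v | v) <;> rfl

def branchInclusion (l r : PlaneTree α) (v : Σ b, (branches l r b).Vertex) : (node l r).Vertex :=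
  some (branchVertex l r v)

theorem isParent_none_branchInclusion {l r : PlaneTree α} (v : Σ b, (branches l r b).Vertex) :
    (node l r).IsParent none (branchInclusion l r v) ↔
      FamilyRoot (branches l r) v := by
  obtain ⟨_ | _, v⟩ := v <;> exact Iff.rfl

theorem isParent_branchInclusion {l r : PlaneTree α} (v w : Σ b, (branches l r b).Vertex) :
    (node l r).IsParent (branchInclusion l r v) (branchInclusion l r w) ↔
      FamilyParent (branches l r) v w := by
  obtain ⟨_ | _, v⟩ := v <;> obtain ⟨_ | _, w⟩ := w
  · exact (familyParent_mk (branches l r) (i := false) (x := v) (y := w)).symm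
  · exact ⟨False.elim, fun h => Bool.noConfusion h.fst_eq⟩
  · exact ⟨False.elim, fun h => Bool.noConfusion h.fst_eq⟩
  · exact (familyParent_mk (branches l r) (i := true) (x := v) (y := w)).symm

theorem not_isParent_none {l r : PlaneTree α} (v : (node l r).Vertex) :
    ¬ (node l r).IsParent v none := by
  rcases v with _ | v | v <;> exact id

theorem label_branchInclusion {l r : PlaneTree α} (v : Σ b, (branches l r b).Vertex) :
    (node l r).label (branchInclusion l r v) = familyLabel (branches l r) v := by
  obtain ⟨_ | _, v⟩ := v <;> rfl

theorem vertex_cases {l r : PlaneTree α} {p : (node l r).Vertex → Prop} (v : (node l r).Vertex)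
    (none : p none) (some : ∀ v, p (branchInclusion l r v)) : p v := by
  rcases v with _ | v
  · exact none
  · have := some ((branchVertex l r).symm v)
    rwa [branchInclusion, Equiv.apply_symm_apply] at this

/-- Isomorphisms of trees from isomorphisms of their families of branches. -/
def isoOfBranches {l r l' r' : PlaneTree α} (σ : FamilyIso (branches l r) (branches l' r')) :
    Iso (node l r) (node l' r') :=
  let τ : (node l r).Vertex ≃ (node l' r').Vertex :=
    Equiv.optionCongr (((branchVertex l r).symm.trans σ.1).trans (branchVertex l' r'))
  have h₀ : τ none = none := rfl
  have h : ∀ v, τ (branchInclusion l r v) = branchInclusion l' r' (σ.1 v) := fun v => by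
    change some (branchVertex l' r' (σ.1 ((branchVertex l r).symm (branchVertex l r v)))) = _
    rw [Equiv.symm_apply_apply]
    rfl
  ⟨τ, h₀, fun v w => by
    induction w using vertex_cases with
    | none => rw [h₀]; exact iff_of_false (not_isParent_none _) (not_isParent_none _)
    | some w =>
    induction v using vertex_cases with
    | none => rw [h, h₀, isParent_none_branchInclusion, isParent_none_branchInclusion, σ.2.1]
    | some v => rw [h, h, isParent_branchInclusion, isParent_branchInclusion, σ.2.2.1], fun v => by
    induction v using vertex_cases with
    | none => rfl
    | some v => rw [h, label_branchInclusion, label_branchInclusion, σ.2.2.2]⟩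

theorem isoOfBranches_apply {l r l' r' : PlaneTree α}
    (σ : FamilyIso (branches l r) (branches l' r')) (v) :
    (isoOfBranches σ).1 (branchInclusion l r v) = branchInclusion l' r' (σ.1 v) := by
  change some (branchVertex l' r' (σ.1 ((branchVertex l r).symm (branchVertex l r v)))) = _
  rw [Equiv.symm_apply_apply]
  rfl

theorem branchInclusion_injective (l r : PlaneTree α) : Function.Injective (branchInclusion l r) :=
  (Option.some_injective _).comp (branchVertex l r).injective

/-- The root is preserved and the roots of the branches are its children, so an isomorphism of two
grafted trees is determined by, and may be any, isomorphism of the families of branches. -/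
theorem isoOfBranches_bijective {l r l' r' : PlaneTree α} :
    Function.Bijective (isoOfBranches (l := l) (r := r) (l' := l') (r' := r')) := by
  constructor
  · intro σ σ' h
    refine Subtype.ext (Equiv.ext fun v => branchInclusion_injective _ _ ?_)
    rw [← isoOfBranches_apply, ← isoOfBranches_apply, h]
  · intro τ
    have key : ∀ {l r l' r' : PlaneTree α} (τ : Iso (node l r) (node l' r')) v,
        ∃ w, τ.1 (branchInclusion l r v) = branchInclusion l' r' w := by
      intro l r l' r' τ v
      cases h : τ.1 (branchInclusion l r v) using vertex_cases with
      | none =>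
        have h' : τ.1 none = none := τ.2.1
        have := τ.1.injective (h.trans h'.symm)
        cases this
      | some w => exact ⟨w, rfl⟩
    choose f hf using key τ
    choose g hg using key τ.symm
    have hf' : ∀ v, (τ.1 : _ → (node l' r').Vertex) (branchInclusion l r v) =
      branchInclusion l' r' (f v) := hf
    have hg' : ∀ v, τ.1.symm (branchInclusion l' r' v) = branchInclusion l r (g v) := hg
    have hroot : τ.1 none = none := τ.2.1
    refine ⟨⟨⟨f, g, fun v => branchInclusion_injective _ _ ?_,
      fun v => branchInclusion_injective _ _ ?_⟩, fun v => ?_, fun v w => ?_, fun v => ?_⟩, ?_⟩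
    · rw [← hg', ← hf', Equiv.symm_apply_apply]
    · rw [← hf', ← hg', Equiv.apply_symm_apply]
    -- Being the root of a branch means being a child of the root, a condition that τ preserves.
    · change FamilyRoot _ (f v) ↔ _
      rw [← isParent_none_branchInclusion, ← hf', ← isParent_none_branchInclusion]
      exact (iff_of_eq (congrArg (fun x => IsParent _ x _) hroot.symm)).trans (τ.2.2.1 none _)
    · change FamilyParent _ (f v) (f w) ↔ _
      rw [← isParent_branchInclusion, ← hf', ← hf', τ.2.2.1, isParent_branchInclusion]
    · change familyLabel _ (f v) = _
      rw [← label_branchInclusion, ← hf', τ.2.2.2, label_branchInclusion]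
    · refine Subtype.ext (Equiv.ext fun v => ?_)
      induction v using vertex_cases with
      | none => exact hroot.symm
      | some v => exact (isoOfBranches_apply _ v).trans (hf v).symm

/-- The two summands belong to the two permutations of a set of two branches. -/
theorem card_iso_node (l r l' r' : PlaneTree α) :
    Nat.card (Iso (node l r) (node l' r')) = Nat.card (Iso l l') * Nat.card (Iso r r') +
      Nat.card (Iso l r') * Nat.card (Iso r l') := by
  rw [← Nat.card_congr (Equiv.ofBijective _ isoOfBranches_bijective), card_familyIso]
  have h : (Finset.univ : Finset (Bool ≃ Bool)) = {Equiv.refl Bool, Equiv.boolNot} := by decide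
  rw [h, Finset.sum_pair (by decide), Fintype.prod_bool, Fintype.prod_bool, mul_comm,
    mul_comm (Nat.card (Iso l r'))]
  rfl

theorem Iso.label_root {t s : PlaneTree α} (σ : Iso t s) : s.label s.root = t.label t.root := by
  rw [← σ.2.1, σ.2.2.2]

/-- The two summands of `card_iso_node` correspond to the constructors `node` and `swap`, so
nonvanishing counts and equivalence obey the same recursion. -/
theorem nonempty_iso_iff {t s : PlaneTree α} : Nonempty (Iso t s) ↔ t.Equivalent s := by
  constructor
  · intro h
    induction t generalizing s with
    | leaf a =>
      cases s with
      | leaf b =>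
        obtain rfl : b = a := Option.some.inj h.some.label_root
        exact .leaf b
      | node l r => exact absurd h.some.label_root (Option.some_ne_none a).symm
    | node l r hl hr =>
      cases s with
      | leaf b => exact absurd h.some.label_root (Option.some_ne_none b)
      | node l' r' =>
        have h' : Nat.card (Iso (node l r) (node l' r')) ≠ 0 := Nat.card_pos.ne'
        rw [card_iso_node] at h'
        by_cases h₁ : Nat.card (Iso l l') * Nat.card (Iso r r') = 0
        · rw [h₁, zero_add] at h'
          exact .swap (hl (Nat.card_ne_zero.1 (left_ne_zero_of_mul h')).1)
            (hr (Nat.card_ne_zero.1 (right_ne_zero_of_mul h')).1)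
        · exact .node (hl (Nat.card_ne_zero.1 (left_ne_zero_of_mul h₁)).1)
            (hr (Nat.card_ne_zero.1 (right_ne_zero_of_mul h₁)).1)
  · intro h
    induction h with
    | leaf a => exact ⟨.refl _⟩
    | node _ _ h₁ h₂ =>
      refine (Nat.card_ne_zero.1 ?_).1
      rw [card_iso_node]
      exact (Nat.add_pos_left (Nat.mul_pos Nat.card_pos Nat.card_pos) _).ne'
    | swap _ _ h₁ h₂ =>
      refine (Nat.card_ne_zero.1 ?_).1
      rw [card_iso_node]
      exact (Nat.add_pos_right _ (Nat.mul_pos Nat.card_pos Nat.card_pos)).ne'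

-- Composition with one isomorphism identifies all isomorphisms with automorphisms of the source.
open Classical in
theorem card_iso (t s : PlaneTree α) :
    Nat.card (Iso t s) = if t.toBinTree = s.toBinTree then Nat.card (Iso t t) else 0 := by
  split_ifs with h
  · obtain ⟨σ⟩ := nonempty_iso_iff.2 (Quotient.exact h : t.Equivalent s)
    exact (Nat.card_congr (σ.congrRight t)).symm
  · have : IsEmpty (Iso t s) := not_nonempty_iff.1 fun h' => h (toBinTree_eq (nonempty_iso_iff.1 h'))
    exact Nat.card_of_isEmpty

end PlaneTree

/-! ### Symmetry factors of trees and forests -/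

section SymmetryFactor

variable {α : Type u}

/-- The order of the automorphism group of a tree. -/
def BinTree.symmetryFactor (T : BinTree α) : ℕ := Nat.card (PlaneTree.Iso T.plane T.plane)

theorem symmetryFactor_toBinTree (t : PlaneTree α) :
    t.toBinTree.symmetryFactor = Nat.card (PlaneTree.Iso t t) := by
  obtain ⟨σ⟩ := PlaneTree.nonempty_iso_iff.2 (plane_toBinTree t)
  exact Nat.card_congr ((σ.congrRight _).trans (σ.congrLeft t))

-- The two summands count the automorphisms that keep and that exchange the branches; the latter
-- exist only for T = S.
open Classical in
theorem symmetryFactor_merge (T S : BinTree α) :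
    (T.merge S).symmetryFactor = T.symmetryFactor * S.symmetryFactor +
      if T = S then T.symmetryFactor * S.symmetryFactor else 0 := by
  rw [BinTree.merge, symmetryFactor_toBinTree, PlaneTree.card_iso_node,
    PlaneTree.card_iso T.plane S.plane, PlaneTree.card_iso S.plane T.plane, toBinTree_plane,
    toBinTree_plane]
  congr 1
  by_cases h : T = S
  · subst h; simp [BinTree.symmetryFactor]
  · simp [h]

instance (F : Forest α) : Fintype (Forest.Component F) :=
  inferInstanceAs (Fintype (Σ T : F.support, Fin (F T.1)))

/-- In the permanent only permutations preserving the isomorphism types of the components survive.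
Each contributes the product of the symmetry factors of the components, and they form a stabilizer
of order ∏ F(T)!. -/
theorem symmetryFactor_eq_prod (F : Forest α) :
    F.symmetryFactor = F.prod fun T n => n.factorial * T.symmetryFactor ^ n := by
  classical
  let t : Forest.Component F → PlaneTree α := fun c => c.1.1.plane
  have h₁ : F.symmetryFactor = Nat.card (FamilyIso t t) := rfl
  let p : Forest.Component F → F.support := Sigma.fst
  have h₂ : ∀ π : Equiv.Perm (Forest.Component F),
      ∏ c, Nat.card (PlaneTree.Iso (t c) (t (π c))) =
        if p ∘ π = p then ∏ c, (p c).1.symmetryFactor else 0 := by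
    intro π
    have h : ∀ c, Nat.card (PlaneTree.Iso (t c) (t (π c))) =
        if (p c).1 = (p (π c)).1 then (p c).1.symmetryFactor else 0 := by
      intro c
      rw [PlaneTree.card_iso, toBinTree_plane, toBinTree_plane]
      rfl
    rw [Finset.prod_congr rfl fun c _ => h c]
    split_ifs with h'
    · refine Finset.prod_congr rfl fun c _ => ?_
      exact if_pos (congrArg Subtype.val (congrFun h' c).symm)
    · obtain ⟨c, hc⟩ := Function.ne_iff.1 h'
      exact Finset.prod_eq_zero (Finset.mem_univ c) (if_neg fun h' => hc (Subtype.ext h'.symm))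
  have h₃ : ∏ c, (p c).1.symmetryFactor = ∏ T : F.support, T.1.symmetryFactor ^ F T.1 := by
    refine (Fintype.prod_sigma (fun c : Σ T : F.support, Fin (F T.1) => c.1.1.symmetryFactor)).trans
      (Finset.prod_congr rfl fun T _ => ?_)
    have h : ∏ _i : Fin (F T.1), T.1.symmetryFactor = T.1.symmetryFactor ^ F T.1 := by
      rw [Finset.prod_const, Finset.card_univ, Fintype.card_fin]
    exact h
  have h₄ : Fintype.card {π : Equiv.Perm (Forest.Component F) // p ∘ π = p} =
      ∏ T : F.support, (F T.1).factorial := by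
    rw [DomMulAct.stabilizer_card]
    refine Finset.prod_congr rfl fun T _ => ?_
    have e : {c // p c = T} ≃ Fin (F T.1) :=
      Equiv.sigmaSubtype (β := fun T : F.support => Fin (F T.1)) T
    rw [Fintype.card_congr e, Fintype.card_fin]
  rw [h₁, card_familyIso]
  simp only [h₂]
  rw [← Finset.sum_filter, Finset.sum_const, ← Fintype.card_subtype, h₄, h₃, smul_eq_mul,
    ← Finset.prod_mul_distrib]
  exact Finset.prod_coe_sort F.support fun T => (F T).factorial * T.symmetryFactor ^ F T

theorem symmetryFactor_zero : (0 : Forest α).symmetryFactor = 1 := by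
  rw [symmetryFactor_eq_prod, Finsupp.prod_zero_index]

/-- The factor F(T) + 1 is the exponent produced by differentiating with respect to T; this makes
multiplication by T adjoint to s_T ∂/∂T. -/
theorem symmetryFactor_add_single (F : Forest α) (T : BinTree α) :
    (F + Finsupp.single T 1).symmetryFactor =
      T.symmetryFactor * (F T + 1) * F.symmetryFactor := by
  classical
  have key : ∀ G : Forest α, (∀ U, U ≠ T → G U = F U) → G.symmetryFactor =
      (G T).factorial * T.symmetryFactor ^ G T *
        ∏ U ∈ F.support.erase T, ((F U).factorial * U.symmetryFactor ^ F U) := by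
    intro G hG
    rw [symmetryFactor_eq_prod, Finsupp.prod_of_support_subset G
      (s := insert T (F.support.erase T)) _ _ (fun _ _ => by simp),
      Finset.prod_insert (Finset.notMem_erase _ _)]
    · congr 1
      exact Finset.prod_congr rfl fun U hU => by rw [hG U (Finset.ne_of_mem_erase hU)]
    · intro U hU
      by_cases h : U = T
      · simp [h]
      · rw [Finsupp.mem_support_iff, hG U h] at hU
        simp [h, hU]
  rw [key F fun _ _ => rfl, key (F + Finsupp.single T 1) fun U hU => by simp [hU.symm]]
  simp only [Finsupp.add_apply, Finsupp.single_eq_same, Nat.factorial_succ, pow_succ]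
  ring

theorem symmetryFactor_pos (F : Forest α) : 0 < F.symmetryFactor := by
  rw [symmetryFactor_eq_prod]
  refine Finset.prod_pos fun T _ => Nat.mul_pos (Nat.factorial_pos _) (pow_pos ?_ _)
  have : Nonempty (PlaneTree.Iso T.plane T.plane) := ⟨.refl _⟩
  exact Nat.card_pos

end SymmetryFactor

/-! ### The pairing, and the duality of ⊔ and Ш -/

section Pairing

variable (k : Type v) {α : Type u} [Field k]

theorem coeff_forestVec [DecidableEq (Forest α)] (F G : Forest α) :
    MvPolynomial.coeff F (forestVec k G) = if G = F then 1 else 0 := by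
  classical
  rw [forestVec, MvPolynomial.coeff_monomial]
  congr

theorem pairing_forestVec_left (F : Forest α) (A : ForestAlg k α) :
    pairing k (forestVec k F) A = F.symmetryFactor * MvPolynomial.coeff F A := by
  have h : forestVec k F = MvPolynomial.basisMonomials (BinTree α) k F := by simp [forestVec]
  rw [pairing, h, Module.Basis.constr_basis]
  rfl

theorem pairing_forestVec_right (F : Forest α) (A : ForestAlg k α) :
    pairing k A (forestVec k F) = F.symmetryFactor * MvPolynomial.coeff F A := by
  classical
  induction A using forestAlg_induction k with
  | add A B h h' => simp only [map_add, LinearMap.add_apply, h, h', MvPolynomial.coeff_add, mul_add]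
  | smul c A h =>
    simp only [map_smul, LinearMap.smul_apply, h, MvPolynomial.coeff_smul, smul_eq_mul]
    ring
  | mon G =>
    rw [pairing_forestVec, coeff_forestVec]
    split_ifs with h
    · rw [h, mul_one]
    · rw [mul_zero]

theorem pairing_comm (A B : ForestAlg k α) : pairing k A B = pairing k B A := by
  induction B using forestAlg_induction k with
  | add B C h h' => simp only [map_add, LinearMap.add_apply, h, h']
  | smul c B h => simp only [map_smul, LinearMap.smul_apply, h]
  | mon F => rw [pairing_forestVec_left, pairing_forestVec_right]

theorem pairing_one_left (A : ForestAlg k α) : pairing k 1 A = forestCounit k A := by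
  rw [← forestVec_zero, pairing_forestVec_left, symmetryFactor_zero, Nat.cast_one, one_mul]
  rfl

theorem pairing_one_right (A : ForestAlg k α) : pairing k A 1 = forestCounit k A := by
  rw [pairing_comm, pairing_one_left]

/-- Multiplication by a tree `T` is adjoint to `s_T ∂/∂T`. -/
theorem pairing_mul_X (A B : ForestAlg k α) (T : BinTree α) :
    pairing k (A * MvPolynomial.X T) B = T.symmetryFactor * pairing k A (MvPolynomial.pderiv T B) := by
  classical
  induction A using forestAlg_induction k with
  | add A B h h' => simp only [add_mul, map_add, LinearMap.add_apply, h, h', mul_add]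
  | smul c A h => simp only [smul_mul_assoc, map_smul, LinearMap.smul_apply, h, mul_smul_comm]
  | mon F =>
  induction B using forestAlg_induction k with
  | add A B h h' => simp only [map_add, h, h', mul_add]
  | smul c A h => simp only [map_smul, h, mul_smul_comm, Derivation.map_smul]
  | mon G =>
    rw [← forestVec_add_single, pairing_forestVec_left, pairing_forestVec_left,
      coeff_forestVec, symmetryFactor_add_single, forestVec, MvPolynomial.pderiv_monomial,
      MvPolynomial.coeff_monomial]
    by_cases h : G = F + Finsupp.single T 1
    · subst h
      simp
      ring
    · rw [if_neg h, mul_zero]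
      split_ifs with h'
      -- Subtraction of exponents is truncated: G - T can equal F without G = F + T only if T does
      -- not occur in G, and then the derivative has coefficient 0.
      · have hT : G T = 0 := by
          by_contra h0
          refine h ?_
          rw [← h', tsub_add_cancel_of_le]
          exact Finsupp.single_le_iff.2 (Nat.one_le_iff_ne_zero.2 h0)
        simp [hT]
      · simp

theorem unshuffle_X (T : BinTree α) : unshuffle k (MvPolynomial.X T) =
    MvPolynomial.X T ⊗ₜ[k] (1 : ForestAlg k α) + 1 ⊗ₜ[k] MvPolynomial.X T := by
  simp [unshuffle]

/-- The disjoint union product is dual to the unshuffle coproduct. -/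
theorem tensorPairing_unshuffle (A B C : ForestAlg k α) :
    tensorPairing k (unshuffle k A) (B ⊗ₜ[k] C) = pairing k A (B * C) := by
  induction A using MvPolynomial.induction_on generalizing B C with
  | C c =>
    rw [← MvPolynomial.algebraMap_eq, Algebra.algebraMap_eq_smul_one, map_smul, map_smul, map_smul,
      map_one, Algebra.TensorProduct.one_def, LinearMap.smul_apply, LinearMap.smul_apply,
      tensorPairing_tmul]
    simp only [pairing_one_left, forestCounit_mul]
  | add A A' h h' => simp only [map_add, LinearMap.add_apply, h, h']
  | mul_X A T h =>
    -- The Leibniz rule for ∂/∂T on B C is the adjoint of T being primitive for Ш.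
    rw [pairing_mul_X, Derivation.leibniz, smul_eq_mul, smul_eq_mul, map_add,
      mul_comm C, ← h, ← h, map_mul, unshuffle_X]
    generalize unshuffle k A = t
    induction t using TensorProduct.induction_on with
    | zero => simp
    | add s t hs ht =>
      simp only [add_mul, map_add, LinearMap.add_apply] at *
      linear_combination hs + ht
    | tmul a b =>
      simp only [mul_add, Algebra.TensorProduct.tmul_mul_tmul, mul_one, map_add,
        LinearMap.add_apply, tensorPairing_tmul, pairing_mul_X]
      ring

/-- Needed for insertions at a root edge. It is derived by generation and not from the pairing, and
hence holds in every characteristic. -/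
theorem counit_lTensor_unshuffle (A : ForestAlg k α) :
    (forestCounit k).lTensor (ForestAlg k α) (unshuffle k A) = A ⊗ₜ[k] (1 : k) := by
  induction A using rightOp_induction k with
  | one => rw [map_one, Algebra.TensorProduct.one_def, LinearMap.lTensor_tmul, forestCounit_one]
  | add A B h h' => simp only [map_add, h, h', TensorProduct.add_tmul]
  | smul c A h => simp only [map_smul, h, TensorProduct.smul_tmul']
  | op y A h =>
    rw [unshuffle_rightOp]
    have key : ∀ t : ForestAlg k α ⊗[k] ForestAlg k α,
        (forestCounit k).lTensor (ForestAlg k α) (coRightOp k y t) =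
          (rightOp k y).rTensor k ((forestCounit k).lTensor (ForestAlg k α) t) := by
      intro t
      induction t using TensorProduct.induction_on with
      | zero => simp
      | add s t hs ht => simp only [map_add, hs, ht]
      | tmul a b =>
        simp only [coRightOp_tmul, map_add, LinearMap.lTensor_tmul, LinearMap.rTensor_tmul,
          forestCounit_rightOp, TensorProduct.tmul_zero, add_zero]
    rw [key, h, LinearMap.rTensor_tmul]

end Pairing

/-! ### The projection to L, and the recursion for insertions into a grafted tree -/

section TreePart

variable (k : Type v) {α : Type u} [Field k]

open Classical in
/-- The projection of `Sym(L)` to `L`. -/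
def treePart : ForestAlg k α →ₗ[k] TreeSpace k α :=
  (MvPolynomial.basisMonomials (BinTree α) k).constr k fun F =>
    if h : ∃ T : BinTree α, F = Finsupp.single T 1 then treeVec k h.choose else 0

theorem treePart_X (T : BinTree α) : treePart k (MvPolynomial.X T) = treeVec k T := by
  have h : (MvPolynomial.X T : ForestAlg k α) =
    MvPolynomial.basisMonomials (BinTree α) k (Finsupp.single T 1) := by simp [MvPolynomial.X]
  have h' : ∃ S : BinTree α, (Finsupp.single T 1 : Forest α) = Finsupp.single S 1 := ⟨T, rfl⟩
  rw [treePart, h, Module.Basis.constr_basis, dif_pos h',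
    ← Finsupp.single_left_injective one_ne_zero h'.choose_spec]

theorem treePart_forestVec {F : Forest α} (hF : F.degree ≠ 1) : treePart k (forestVec k F) = 0 := by
  have h : forestVec k F = MvPolynomial.basisMonomials (BinTree α) k F := by simp [forestVec]
  rw [treePart, h, Module.Basis.constr_basis, dif_neg]
  rintro ⟨T, rfl⟩
  exact hF (Finsupp.degree_single _ _)

theorem treePart_one : treePart k (1 : ForestAlg k α) = 0 :=
  treePart_forestVec k (F := 0) (by simp)

theorem treePart_toSym (x : TreeSpace k α) : treePart k (toSym k x) = x := by
  induction x using treeSpace_induction k with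
  | zero => simp
  | add x y hx hy => simp only [map_add, hx, hy]
  | smul c x hx => simp only [map_smul, hx]
  | vec t => rw [toSym_treeVec, treePart_X]

/-- A factor y adds one tree, so only the constant term of A can contribute to L. -/
theorem treePart_mul_toSym (A : ForestAlg k α) (y : TreeSpace k α) :
    treePart k (A * toSym k y) = forestCounit k A • y := by
  induction A using forestAlg_induction k with
  | add A B h h' => simp only [add_mul, map_add, h, h', add_smul]
  | smul c A h => simp only [smul_mul_assoc, map_smul, h, smul_assoc]
  | mon F =>
  by_cases hF : F = 0
  · subst hF
    rw [forestVec_zero, one_mul, treePart_toSym, forestCounit_one, one_smul]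
  · have h0 : forestCounit k (forestVec k F) = 0 := by
      classical
      change MvPolynomial.coeff 0 (forestVec k F) = 0
      rw [coeff_forestVec, if_neg hF]
    rw [h0, zero_smul]
    induction y using treeSpace_induction k with
    | zero => simp
    | add x y hx hy => simp only [map_add, mul_add, hx, hy, add_zero]
    | smul c x hx => simp only [map_smul, mul_smul_comm, hx, smul_zero]
    | vec t =>
      rw [toSym_treeVec, ← forestVec_add_single]
      refine treePart_forestVec k ?_
      rw [map_add, Finsupp.degree_single]
      have := (Finsupp.degree_eq_zero_iff F).not.2 hF
      omega

/-- Insertion of y does not change the number of trees. -/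
theorem treePart_actDeriv (y : TreeSpace k α) (A : ForestAlg k α) :
    treePart k (actDeriv k y A) = treePart k A * y := by
  induction A using MvPolynomial.induction_on with
  | C c =>
    rw [← MvPolynomial.algebraMap_eq, Derivation.map_algebraMap, Algebra.algebraMap_eq_smul_one,
      map_smul, treePart_one, smul_zero, zero_mul, map_zero]
  | add A B hA hB => simp only [map_add, hA, hB, add_mul]
  | mul_X A T hA =>
    rw [Derivation.leibniz, smul_eq_mul, smul_eq_mul, actDeriv_X, map_add,
      mul_comm (MvPolynomial.X T), ← toSym_treeVec, treePart_mul_toSym, treePart_mul_toSym,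
      treePart_mul_toSym, forestCounit_actDeriv, zero_smul, add_zero, smul_mul_assoc]

theorem treePart_rightOp (y : TreeSpace k α) (A : ForestAlg k α) :
    treePart k (rightOp k y A) = treePart k A * y + forestCounit k A • y := by
  rw [rightOp_apply, map_add, treePart_actDeriv, treePart_mul_toSym]

/-- The operation `x ◁ B` for `x ∈ L` and `B ∈ Sym(L)`, with values in `L`. -/
def treeAct (x : TreeSpace k α) : ForestAlg k α →ₗ[k] TreeSpace k α :=
  treePart k ∘ₗ symInsertion k (toSym k x)

theorem symInsertion_rightOp (A B : ForestAlg k α) (y : TreeSpace k α) :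
    symInsertion k A (rightOp k y B) = actDeriv k y (symInsertion k A B) := by
  rw [rightOp_apply, map_add, symInsertion_mul_toSym]
  abel

theorem treeAct_one (x : TreeSpace k α) : treeAct k x 1 = x := by
  rw [treeAct, LinearMap.comp_apply, symInsertion_one, treePart_toSym]

/-- With `treeAct_one` this makes L a right module over U(L), and by generation the two rules
determine `treeAct`. -/
theorem treeAct_rightOp (x y : TreeSpace k α) (B : ForestAlg k α) :
    treeAct k x (rightOp k y B) = treeAct k x B * y := by
  rw [treeAct, LinearMap.comp_apply, symInsertion_rightOp, treePart_actDeriv]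
  rfl

theorem treeAct_add (x y : TreeSpace k α) : treeAct k (x + y) = treeAct k x + treeAct k y := by
  simp only [treeAct, map_add, LinearMap.comp_add]

theorem treeAct_smul (c : k) (x : TreeSpace k α) : treeAct k (c • x) = c • treeAct k x := by
  simp only [treeAct, map_smul, LinearMap.comp_smul]

theorem treeAct_zero : treeAct k (0 : TreeSpace k α) = 0 := by
  simp only [treeAct, map_zero, LinearMap.comp_zero]

/-- A single tree in A ∗ B comes from B alone, with the constant term of A, or from inserting all of
B into one tree of A. Both sides satisfy the same recursion under B ↦ B ∗ y. -/
theorem treePart_guinOudomMul (A B : ForestAlg k α) :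
    treePart k (guinOudomMul k A B) =
      forestCounit k A • treePart k B + treeAct k (treePart k A) B := by
  induction B using rightOp_induction k with
  | one => rw [guinOudomMul_one, treePart_one, smul_zero, zero_add, treeAct_one]
  | add B C h h' => simp only [map_add, h, h', smul_add]; abel
  | smul c B h => simp only [map_smul, h, smul_add, smul_comm c]
  | op y B h =>
    rw [guinOudomMul_rightOp, treePart_rightOp, h, treePart_rightOp, treeAct_rightOp, add_mul,
      smul_mul_assoc, smul_add, smul_smul, forestCounit_guinOudomMul]
    abel

/-- `∑ merge (x ◁ B₍₁₎) (y ◁ B₍₂₎)` as a function of the tensor `∑ B₍₁₎ ⊗ B₍₂₎`. -/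
def mergeAct (x y : TreeSpace k α) : ForestAlg k α ⊗[k] ForestAlg k α →ₗ[k] TreeSpace k α :=
  TensorProduct.lift ((mergeBilin k).compl₁₂ (treeAct k x) (treeAct k y))

/-- `∑ merge (x ◁ B₍₁₎) (B₍₂₎)` as a function of the tensor `∑ B₍₁₎ ⊗ B₍₂₎`, where only the part of
`B₍₂₎` in `L` counts. -/
def rootAct (x : TreeSpace k α) : ForestAlg k α ⊗[k] ForestAlg k α →ₗ[k] TreeSpace k α :=
  TensorProduct.lift ((mergeBilin k).compl₁₂ (treeAct k x) (treePart k))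

theorem mergeAct_tmul (x y : TreeSpace k α) (A B : ForestAlg k α) :
    mergeAct k x y (A ⊗ₜ B) = mergeBilin k (treeAct k x A) (treeAct k y B) := rfl

theorem rootAct_tmul (x : TreeSpace k α) (A B : ForestAlg k α) :
    rootAct k x (A ⊗ₜ B) = mergeBilin k (treeAct k x A) (treePart k B) := rfl

theorem mergeBilin_mul (x y z : TreeSpace k α) :
    mergeBilin k x y * z =
      mergeBilin k (mergeBilin k x y) z + mergeBilin k (x * z) y + mergeBilin k x (y * z) :=
  insertionBilin_merge k x y z

/-- The subtracted term is the insertion of z at the root edge, which is not an insertion into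
either branch. -/
theorem mergeAct_coRightOp (x y z : TreeSpace k α) (t : ForestAlg k α ⊗[k] ForestAlg k α) :
    mergeAct k x y (coRightOp k z t) =
      mergeAct k x y t * z - mergeBilin k (mergeAct k x y t) z := by
  induction t using TensorProduct.induction_on with
  | zero => simp
  | add s t hs ht => simp only [map_add, hs, ht, add_mul, LinearMap.add_apply]; abel
  | tmul a b =>
    simp only [coRightOp_tmul, map_add, mergeAct_tmul, treeAct_rightOp, mergeBilin_mul]
    abel

/-- The last term, in which z itself is the topmost tree at the root edge, comes from the summand
ε(b) z of π(b ∗ z). -/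
theorem rootAct_coRightOp (x z : TreeSpace k α) (t : ForestAlg k α ⊗[k] ForestAlg k α) :
    rootAct k x (coRightOp k z t) =
      rootAct k x t * z - mergeBilin k (rootAct k x t) z +
        mergeBilin k (treeAct k x (TensorProduct.rid k (ForestAlg k α)
          ((forestCounit k).lTensor (ForestAlg k α) t))) z := by
  induction t using TensorProduct.induction_on with
  | zero => simp
  | add s t hs ht => simp only [map_add, hs, ht, add_mul, LinearMap.add_apply]; abel
  | tmul a b =>
    simp only [coRightOp_tmul, map_add, rootAct_tmul, treeAct_rightOp, treePart_rightOp,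
      mergeBilin_mul, LinearMap.lTensor_tmul, TensorProduct.rid_tmul, map_smul,
      LinearMap.smul_apply]
    abel

/-- Insertion into a grafted tree: either something is inserted at the root edge, or all insertions
take place in the two branches. -/
theorem treeAct_merge (x y : TreeSpace k α) (B : ForestAlg k α) :
    treeAct k (mergeBilin k x y) B =
      mergeAct k x y (unshuffle k B) + rootAct k (mergeBilin k x y) (unshuffle k B) := by
  induction B using rightOp_induction k with
  | one =>
    rw [map_one (unshuffle k), Algebra.TensorProduct.one_def, mergeAct_tmul, rootAct_tmul, treePart_one,
      map_zero, add_zero, treeAct_one, treeAct_one, treeAct_one]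
  | add A B h h' => simp only [map_add, h, h']; abel
  | smul c A h => simp only [map_smul, h, smul_add]
  | op z B h =>
    -- By the induction hypothesis, the tree grafted with z in the last term of `rootAct_coRightOp`
    -- is the sum of the two trees grafted with z in the subtracted terms, so all corrections
    -- cancel.
    rw [treeAct_rightOp, unshuffle_rightOp, mergeAct_coRightOp, rootAct_coRightOp,
      counit_lTensor_unshuffle, TensorProduct.rid_tmul, one_smul, h, add_mul, map_add,
      LinearMap.add_apply]
    abel

/-- A leaf has only the root edge, so the branch term of `treeAct_merge` is replaced by the case
that nothing is inserted. -/
theorem treeAct_leaf (a : α) (B : ForestAlg k α) :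
    treeAct k (treeVec k (PlaneTree.leaf a).toBinTree) B =
      forestCounit k B • treeVec k (PlaneTree.leaf a).toBinTree +
        rootAct k (treeVec k (PlaneTree.leaf a).toBinTree) (unshuffle k B) := by
  induction B using rightOp_induction k with
  | one =>
    rw [map_one (unshuffle k), Algebra.TensorProduct.one_def, rootAct_tmul, treePart_one, map_zero, add_zero,
      treeAct_one, forestCounit_one, one_smul]
  | add A B h h' => simp only [map_add, h, h', add_smul]; abel
  | smul c A h => simp only [map_smul, h, smul_add, smul_assoc]
  | op z B h =>
    rw [treeAct_rightOp, unshuffle_rightOp, rootAct_coRightOp, forestCounit_rightOp,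
      counit_lTensor_unshuffle, TensorProduct.rid_tmul, one_smul, h, add_mul, map_add,
      LinearMap.add_apply, smul_mul_assoc, mul_eq_insertionBilin k (treeVec k _),
      insertionBilin_leaf, map_smul, LinearMap.smul_apply]
    module

end TreePart

/-! ### Insertions into a tree are dual to proper cuts -/

section Duality

variable (k : Type v) {α : Type u} [Field k]

/-- The pairing of `L` with itself. -/
def treePairing : TreeSpace k α →ₗ[k] TreeSpace k α →ₗ[k] k :=
  (pairing k).compl₁₂ (toSym k) (toSym k)

theorem treePairing_apply (x y : TreeSpace k α) :
    treePairing k x y = pairing k (toSym k x) (toSym k y) := rfl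

open Classical in
theorem treePairing_treeVec (T S : BinTree α) :
    treePairing k (treeVec k T) (treeVec k S) = if T = S then (T.symmetryFactor : k) else 0 := by
  rw [treePairing_apply, toSym_treeVec, toSym_treeVec]
  have h := pairing_forestVec k (Finsupp.single T 1) (Finsupp.single S 1)
  have h' := symmetryFactor_add_single 0 T
  rw [zero_add, symmetryFactor_zero] at h'
  simp only [Finsupp.coe_zero, Pi.zero_apply, zero_add, mul_one] at h'
  rw [h'] at h
  refine h.trans ?_
  congr 1
  exact propext (Finsupp.single_left_injective one_ne_zero).eq_iff

/-- Distinct forests are orthogonal, so L pairs only with the one-tree part of A. -/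
theorem pairing_toSym (A : ForestAlg k α) (y : TreeSpace k α) :
    pairing k A (toSym k y) = treePairing k (treePart k A) y := by
  induction y using treeSpace_induction k with
  | zero => simp
  | add x y hx hy => simp only [map_add, hx, hy]
  | smul c x hx => simp only [map_smul, hx]
  | vec t =>
  rw [toSym_treeVec]
  induction A using forestAlg_induction k with
  | add A B h h' => simp only [map_add, LinearMap.add_apply, h, h']
  | smul c A h => simp only [map_smul, LinearMap.smul_apply, h]
  | mon F =>
    classical
    by_cases hF : F.degree = 1
    · obtain ⟨G, T, rfl, hG⟩ := exists_add_single hF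
      rw [Finsupp.degree_eq_zero_iff] at hG
      subst hG
      rw [forestVec_add_single, forestVec_zero, one_mul, treePart_X, treePairing_apply,
        toSym_treeVec, toSym_treeVec]
    · rw [treePart_forestVec k hF, map_zero, LinearMap.zero_apply]
      refine (pairing_forestVec k F (Finsupp.single _ 1)).trans (if_neg ?_)
      rintro rfl
      exact hF (Finsupp.degree_single _ _)

theorem merge_eq_iff (T S T' S' : BinTree α) :
    T.merge S = T'.merge S' ↔ (T = T' ∧ S = S') ∨ (T = S' ∧ S = T') := by
  constructor
  · intro h
    have h' : (PlaneTree.node T.plane S.plane).Equivalent (PlaneTree.node T'.plane S'.plane) :=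
      Quotient.exact h
    rw [← toBinTree_plane T, ← toBinTree_plane S, ← toBinTree_plane T', ← toBinTree_plane S']
    cases h' with
    | node h₁ h₂ => exact .inl ⟨toBinTree_eq h₁, toBinTree_eq h₂⟩
    | swap h₁ h₂ => exact .inr ⟨toBinTree_eq h₁, toBinTree_eq h₂⟩
  · rintro (⟨rfl, rfl⟩ | ⟨rfl, rfl⟩)
    · rfl
    · exact merge_comm _ _

/-- There are two ways to match the branches. On basis trees both matchings apply exactly when all
four trees agree, and there the symmetry factor of T ∨ T is doubled as well. -/
theorem treePairing_merge (x y z w : TreeSpace k α) :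
    treePairing k (mergeBilin k x y) (mergeBilin k z w) =
      treePairing k x z * treePairing k y w + treePairing k x w * treePairing k y z := by
  induction x using treeSpace_induction k with
  | zero => simp
  | add x y hx hy => simp only [map_add, LinearMap.add_apply, hx, hy]; ring
  | smul c x hx => simp only [map_smul, LinearMap.smul_apply, hx, smul_eq_mul]; ring
  | vec t =>
  induction y using treeSpace_induction k with
  | zero => simp
  | add x y hx hy => simp only [map_add, LinearMap.add_apply, hx, hy]; ring
  | smul c x hx => simp only [map_smul, LinearMap.smul_apply, hx, smul_eq_mul]; ring
  | vec s =>
  induction z using treeSpace_induction k with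
  | zero => simp
  | add x y hx hy => simp only [map_add, LinearMap.add_apply, hx, hy]; ring
  | smul c x hx => simp only [map_smul, LinearMap.smul_apply, hx, smul_eq_mul]; ring
  | vec t' =>
  induction w using treeSpace_induction k with
  | zero => simp
  | add x y hx hy => simp only [map_add, hx, hy]; ring
  | smul c x hx => simp only [map_smul, hx, smul_eq_mul]; ring
  | vec s' =>
  classical
  simp only [mergeBilin_treeVec, treePairing_treeVec, symmetryFactor_merge, merge_eq_iff]
  generalize t.toBinTree = T
  generalize s.toBinTree = S
  generalize t'.toBinTree = T'
  generalize s'.toBinTree = S'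
  by_cases h₁ : T = T' <;> by_cases h₂ : S = S' <;> by_cases h₃ : T = S' <;>
    by_cases h₄ : S = T' <;> simp_all

theorem treePairing_merge_leaf (x y : TreeSpace k α) (a : α) :
    treePairing k (mergeBilin k x y) (treeVec k (PlaneTree.leaf a).toBinTree) = 0 := by
  induction x using treeSpace_induction k with
  | zero => simp
  | add x y hx hy => simp only [map_add, LinearMap.add_apply, hx, hy, add_zero]
  | smul c x hx => simp only [map_smul, LinearMap.smul_apply, hx, smul_zero]
  | vec t =>
  induction y using treeSpace_induction k with
  | zero => simp
  | add x y hx hy => simp only [map_add, LinearMap.add_apply, hx, hy, add_zero]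
  | smul c x hx => simp only [map_smul, LinearMap.smul_apply, hx, smul_zero]
  | vec s =>
  rw [mergeBilin_treeVec, treePairing_treeVec, if_neg]
  intro h
  rw [merge_toBinTree] at h
  cases (Quotient.exact h : (PlaneTree.node t s).Equivalent (.leaf a))

theorem treePairing_comm (x y : TreeSpace k α) : treePairing k x y = treePairing k y x :=
  pairing_comm k _ _

/-- The contraction `A ⊗ z ↦ ⟨x, z⟩ A`. -/
def contract (x : TreeSpace k α) : ForestAlg k α ⊗[k] TreeSpace k α →ₗ[k] ForestAlg k α :=
  (TensorProduct.rid k (ForestAlg k α)).toLinearMap ∘ₗ (treePairing k x).lTensor (ForestAlg k α)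

theorem contract_tmul (x z : TreeSpace k α) (A : ForestAlg k α) :
    contract k x (A ⊗ₜ z) = treePairing k x z • A := by
  simp [contract]

/-- The sum of `P^C(T) ⊗ R^C(T)` over all cuts other than the total cut. -/
def properCoproduct : PlaneTree α → ForestAlg k α ⊗[k] TreeSpace k α
  | .leaf a => 1 ⊗ₜ treeVec k (PlaneTree.leaf a).toBinTree
  | .node l r =>
    -- Either both branches are cut properly and their remainders grafted, or one branch is cut off
    -- entirely and its parent contracted. Two whole branches may not be cut off, since their edges
    -- share a parent.
    TensorProduct.map₂ (LinearMap.mul k (ForestAlg k α)) (mergeBilin k)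
        (properCoproduct l) (properCoproduct r) +
      ((LinearMap.mulLeft k (MvPolynomial.X l.toBinTree)).rTensor _ (properCoproduct r) +
        (LinearMap.mulLeft k (MvPolynomial.X r.toBinTree)).rTensor _ (properCoproduct l))

theorem contract_mulLeft (x : TreeSpace k α) (A : ForestAlg k α)
    (t : ForestAlg k α ⊗[k] TreeSpace k α) :
    contract k x ((LinearMap.mulLeft k A).rTensor _ t) = A * contract k x t := by
  induction t using TensorProduct.induction_on with
  | zero => simp
  | add s t hs ht => simp only [map_add, hs, ht, mul_add]
  | tmul B z =>
    rw [LinearMap.rTensor_tmul, LinearMap.mulLeft_apply, contract_tmul, contract_tmul,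
      mul_smul_comm]

theorem contract_add (x y : TreeSpace k α) : contract k (x + y) = contract k x + contract k y := by
  simp only [contract, map_add, LinearMap.lTensor_add, LinearMap.comp_add]

theorem contract_smul (c : k) (x : TreeSpace k α) : contract k (c • x) = c • contract k x := by
  simp only [contract, map_smul, LinearMap.lTensor_smul, LinearMap.comp_smul]

theorem contract_zero : contract k (0 : TreeSpace k α) = 0 := by
  simp only [contract, map_zero, LinearMap.lTensor_zero, LinearMap.comp_zero]

/-- `treePairing_merge` with forest coefficients carried along in the first tensor factor. -/
theorem contract_merge (x y : TreeSpace k α) (s t : ForestAlg k α ⊗[k] TreeSpace k α) :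
    contract k (mergeBilin k x y)
        (TensorProduct.map₂ (LinearMap.mul k (ForestAlg k α)) (mergeBilin k) s t) =
      contract k x s * contract k y t + contract k x t * contract k y s := by
  induction s using TensorProduct.induction_on with
  | zero => simp
  | add s s' h h' => simp only [map_add, LinearMap.add_apply, h, h']; ring
  | tmul A z =>
  induction t using TensorProduct.induction_on with
  | zero => simp
  | add s s' h h' => simp only [map_add, h, h']; ring
  | tmul B w =>
    simp only [TensorProduct.map₂_apply_tmul, TensorProduct.map_tmul, contract_tmul,
      treePairing_merge, LinearMap.mul_apply', smul_mul_smul_comm, add_smul, mul_comm B A]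

theorem contract_leaf (a : α) (s t : ForestAlg k α ⊗[k] TreeSpace k α) :
    contract k (treeVec k (PlaneTree.leaf a).toBinTree)
        (TensorProduct.map₂ (LinearMap.mul k (ForestAlg k α)) (mergeBilin k) s t) = 0 := by
  induction s using TensorProduct.induction_on with
  | zero => simp
  | add s s' h h' => simp only [map_add, LinearMap.add_apply, h, h', add_zero]
  | tmul A z =>
  induction t using TensorProduct.induction_on with
  | zero => simp
  | add s s' h h' => simp only [map_add, h, h', add_zero]
  | tmul B w =>
    rw [TensorProduct.map₂_apply_tmul, TensorProduct.map_tmul, contract_tmul, treePairing_comm,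
      treePairing_merge_leaf, zero_smul]

/-- The coproduct without the total cut is dual to the operation `x ◁ B`. -/
theorem treePairing_treeAct (t : PlaneTree α) (x : TreeSpace k α) (B : ForestAlg k α) :
    treePairing k (treeAct k x B) (treeVec k t.toBinTree) =
      pairing k B (contract k x (properCoproduct k t)) := by
  induction t generalizing x B with
  | leaf a =>
    have hroot : ∀ (x : TreeSpace k α) (s : ForestAlg k α ⊗[k] ForestAlg k α),
        treePairing k (rootAct k x s) (treeVec k (PlaneTree.leaf a).toBinTree) = 0 := by
      intro x s
      induction s using TensorProduct.induction_on with
      | zero => simp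
      | add s t hs ht => simp only [map_add, LinearMap.add_apply, hs, ht, add_zero]
      | tmul A B => rw [rootAct_tmul, treePairing_merge_leaf]
    have hmerge : ∀ (x y : TreeSpace k α) (s : ForestAlg k α ⊗[k] ForestAlg k α),
        treePairing k (mergeAct k x y s) (treeVec k (PlaneTree.leaf a).toBinTree) = 0 := by
      intro x y s
      induction s using TensorProduct.induction_on with
      | zero => simp
      | add s t hs ht => simp only [map_add, LinearMap.add_apply, hs, ht, add_zero]
      | tmul A B => rw [mergeAct_tmul, treePairing_merge_leaf]
    rw [properCoproduct, contract_tmul, map_smul, pairing_one_right, smul_eq_mul]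
    induction x using treeSpace_induction k with
    | zero => simp [treeAct_zero]
    | add x y hx hy =>
      simp only [treeAct_add, map_add, LinearMap.add_apply, hx, hy]
      ring
    | smul c x hx =>
      simp only [treeAct_smul, map_smul, LinearMap.smul_apply, hx, smul_eq_mul]
      ring
    | vec s =>
    cases s with
    | leaf b =>
      rw [treeAct_leaf, map_add, LinearMap.add_apply, hroot, add_zero, map_smul,
        LinearMap.smul_apply, smul_eq_mul, mul_comm]
    | node l r =>
      rw [← merge_toBinTree, ← mergeBilin_treeVec, treeAct_merge, map_add, LinearMap.add_apply,
        hroot, hmerge, treePairing_merge_leaf, zero_mul, add_zero]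
  | node l r hl hr =>
    -- If a tree was inserted topmost at the root edge, it is one branch of the result, and the
    -- other branch contains all other insertions. This is dual to cutting off a whole branch.
    have hroot : ∀ (x : TreeSpace k α) (s : ForestAlg k α ⊗[k] ForestAlg k α),
        treePairing k (rootAct k x s) (treeVec k (PlaneTree.node l r).toBinTree) =
          tensorPairing k s
            (contract k x (properCoproduct k l) ⊗ₜ MvPolynomial.X r.toBinTree +
              contract k x (properCoproduct k r) ⊗ₜ MvPolynomial.X l.toBinTree) := by
      intro x s
      induction s using TensorProduct.induction_on with
      | zero => simp
      | add s t hs ht => simp only [map_add, LinearMap.add_apply, hs, ht]; ring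
      | tmul A B =>
        rw [rootAct_tmul, ← merge_toBinTree, ← mergeBilin_treeVec, treePairing_merge, hl, hr,
          map_add, tensorPairing_tmul, tensorPairing_tmul, ← toSym_treeVec, ← toSym_treeVec,
          pairing_toSym, pairing_toSym]
    -- Insertions inside x and y produce the two branches independently, in either order; this is
    -- dual to proper cuts of both branches.
    have hmerge : ∀ (x y : TreeSpace k α) (s : ForestAlg k α ⊗[k] ForestAlg k α),
        treePairing k (mergeAct k x y s) (treeVec k (PlaneTree.node l r).toBinTree) =
          tensorPairing k s
            (contract k x (properCoproduct k l) ⊗ₜ contract k y (properCoproduct k r) +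
              contract k x (properCoproduct k r) ⊗ₜ contract k y (properCoproduct k l)) := by
      intro x y s
      induction s using TensorProduct.induction_on with
      | zero => simp
      | add s t hs ht => simp only [map_add, LinearMap.add_apply, hs, ht]; ring
      | tmul A B =>
        rw [mergeAct_tmul, ← merge_toBinTree, ← mergeBilin_treeVec, treePairing_merge, hl, hr, hl,
          hr, map_add, tensorPairing_tmul, tensorPairing_tmul]
    induction x using treeSpace_induction k with
    | zero => simp [treeAct_zero, contract_zero]
    | add x y hx hy =>
      simp only [treeAct_add, contract_add, map_add, LinearMap.add_apply, hx, hy]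
    | smul c x hx =>
      simp only [treeAct_smul, contract_smul, map_smul, LinearMap.smul_apply, hx]
    | vec s =>
    cases s with
    | leaf b =>
      rw [treeAct_leaf, map_add, LinearMap.add_apply, hroot, map_smul, LinearMap.smul_apply,
        ← merge_toBinTree, ← mergeBilin_treeVec, treePairing_comm, treePairing_merge_leaf,
        smul_zero, zero_add]
      simp only [map_add, tensorPairing_unshuffle, properCoproduct, contract_leaf,
        contract_mulLeft, mul_comm (MvPolynomial.X _), zero_add]
      rw [add_comm]
    | node l' r' =>
      rw [← merge_toBinTree l' r', ← mergeBilin_treeVec, treeAct_merge, map_add,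
        LinearMap.add_apply, hroot, hmerge]
      simp only [map_add, tensorPairing_unshuffle, properCoproduct, contract_merge,
        contract_mulLeft, mul_comm (MvPolynomial.X _)]
      ring

end Duality

/-! ### Binary-admissible cuts of a grafted tree -/

namespace PlaneTree

variable {α : Type u}

theorem transGen_root (t : PlaneTree α) {v : t.Vertex} (hv : v ≠ t.root) :
    Relation.TransGen t.IsParent t.root v := by
  rcases Relation.reflTransGen_iff_eq_or_transGen.1 (t.reflTransGen_root v) with h | h
  · exact absurd h hv
  · exact h

theorem not_isParent_root : ∀ (t : PlaneTree α) (v : t.Vertex), ¬ t.IsParent v t.root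
  | leaf _, _ => id
  | node _ _, v => not_isParent_none v

theorem not_transGen_root (t : PlaneTree α) (v : t.Vertex) :
    ¬ Relation.TransGen t.IsParent v t.root := by
  intro h
  obtain ⟨w, -, hw⟩ := Relation.TransGen.tail'_iff.1 h
  exact not_isParent_root t w hw

/-- The inclusions of the vertices of the branches. -/
def inLeft (l r : PlaneTree α) (v : l.Vertex) : (node l r).Vertex := some (.inl v)

def inRight (l r : PlaneTree α) (v : r.Vertex) : (node l r).Vertex := some (.inr v)

theorem inLeft_injective (l r : PlaneTree α) : Function.Injective (inLeft l r) := fun _ _ h =>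
  Sum.inl_injective (Option.some_injective _ h)

theorem inRight_injective (l r : PlaneTree α) : Function.Injective (inRight l r) := fun _ _ h =>
  Sum.inr_injective (Option.some_injective _ h)

/-- Descent never leaves a branch, so the path condition on a cut can be tested in each branch. -/
theorem transGen_inLeft_iff {l r : PlaneTree α} {v : l.Vertex} {x : (node l r).Vertex} :
    Relation.TransGen (node l r).IsParent (inLeft l r v) x ↔
      ∃ w, x = inLeft l r w ∧ Relation.TransGen l.IsParent v w := by
  constructor
  · intro h
    induction h with
    | @single x h =>
      rcases x with _ | w | w
      · exact h.elim
      · exact ⟨w, rfl, .single h⟩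
      · exact h.elim
    | @tail y x _ h ih =>
      obtain ⟨w, rfl, hw⟩ := ih
      rcases x with _ | x | x
      · exact h.elim
      · exact ⟨x, rfl, .tail hw h⟩
      · exact h.elim
  · rintro ⟨w, rfl, h⟩
    exact Relation.TransGen.lift (p := (node l r).IsParent) (inLeft l r) (fun _ _ h => h) _ _ h

theorem transGen_inRight_iff {l r : PlaneTree α} {v : r.Vertex} {x : (node l r).Vertex} :
    Relation.TransGen (node l r).IsParent (inRight l r v) x ↔
      ∃ w, x = inRight l r w ∧ Relation.TransGen r.IsParent v w := by
  constructor
  · intro h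
    induction h with
    | @single x h =>
      rcases x with _ | w | w
      · exact h.elim
      · exact h.elim
      · exact ⟨w, rfl, .single h⟩
    | @tail y x _ h ih =>
      obtain ⟨w, rfl, hw⟩ := ih
      rcases x with _ | x | x
      · exact h.elim
      · exact h.elim
      · exact ⟨x, rfl, .tail hw h⟩
  · rintro ⟨w, rfl, h⟩
    exact Relation.TransGen.lift (p := (node l r).IsParent) (inRight l r) (fun _ _ h => h) _ _ h

/-- The union of sets of edges of the two branches. -/
def join (l r : PlaneTree α) (C : Finset l.Vertex) (D : Finset r.Vertex) :
    Finset (node l r).Vertex :=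
  (C.disjSum D).map ⟨some, Option.some_injective _⟩

theorem inLeft_mem_join {l r : PlaneTree α} {C : Finset l.Vertex} {D : Finset r.Vertex}
    {v : l.Vertex} : inLeft l r v ∈ join l r C D ↔ v ∈ C := by
  refine (Finset.mem_map' ⟨some, Option.some_injective (l.Vertex ⊕ r.Vertex)⟩).trans ?_
  exact Finset.inl_mem_disjSum

theorem inRight_mem_join {l r : PlaneTree α} {C : Finset l.Vertex} {D : Finset r.Vertex}
    {v : r.Vertex} : inRight l r v ∈ join l r C D ↔ v ∈ D := by
  refine (Finset.mem_map' ⟨some, Option.some_injective (l.Vertex ⊕ r.Vertex)⟩).trans ?_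
  exact Finset.inr_mem_disjSum

theorem root_notMem_join {l r : PlaneTree α} {C : Finset l.Vertex} {D : Finset r.Vertex} :
    (node l r).root ∉ join l r C D := by
  intro h
  obtain ⟨x, -, hx⟩ := Finset.mem_map.1 h
  exact Option.some_ne_none x hx

theorem node_vertex_cases {l r : PlaneTree α} {p : (node l r).Vertex → Prop}
    (v : (node l r).Vertex) (root : p (node l r).root) (left : ∀ v, p (inLeft l r v))
    (right : ∀ v, p (inRight l r v)) : p v := by
  rcases v with _ | v | v
  · exact root
  · exact left v
  · exact right v

theorem mem_join {l r : PlaneTree α} {C : Finset l.Vertex} {D : Finset r.Vertex}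
    {x : (node l r).Vertex} :
    x ∈ join l r C D ↔ (∃ v ∈ C, x = inLeft l r v) ∨ ∃ v ∈ D, x = inRight l r v := by
  constructor
  · intro h
    induction x using node_vertex_cases with
    | root => exact absurd h root_notMem_join
    | left v => exact .inl ⟨v, inLeft_mem_join.1 h, rfl⟩
    | right v => exact .inr ⟨v, inRight_mem_join.1 h, rfl⟩
  · rintro (⟨v, hv, rfl⟩ | ⟨v, hv, rfl⟩)
    · exact inLeft_mem_join.2 hv
    · exact inRight_mem_join.2 hv

open Classical in
theorem filter_left_join (l r : PlaneTree α) (C : Finset l.Vertex) (D : Finset r.Vertex) :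
    (Finset.univ.filter fun v => inLeft l r v ∈ join l r C D) = C := by
  ext v
  simp [inLeft_mem_join]

open Classical in
theorem filter_right_join (l r : PlaneTree α) (C : Finset l.Vertex) (D : Finset r.Vertex) :
    (Finset.univ.filter fun v => inRight l r v ∈ join l r C D) = D := by
  ext v
  simp [inRight_mem_join]

open Classical in
theorem join_filter (l r : PlaneTree α) {C : Finset (node l r).Vertex}
    (hC : (node l r).root ∉ C) :
    join l r (Finset.univ.filter fun v => inLeft l r v ∈ C)
      (Finset.univ.filter fun v => inRight l r v ∈ C) = C := by
  ext x
  induction x using node_vertex_cases with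
  | root => exact iff_of_false root_notMem_join hC
  | left v => simp [inLeft_mem_join]
  | right v => simp [inRight_mem_join]

theorem join_inj {l r : PlaneTree α} {C C' : Finset l.Vertex} {D D' : Finset r.Vertex}
    (h : join l r C D = join l r C' D') : C = C' ∧ D = D' := by
  classical
  constructor
  · rw [← filter_left_join l r C D, h, filter_left_join]
  · rw [← filter_right_join l r C D, h, filter_right_join]

/-- The only interaction between the branches is that their two topmost edges share the root as
parent. -/
theorem isBinaryAdmissible_join {l r : PlaneTree α} {C : Finset l.Vertex} {D : Finset r.Vertex} :
    (node l r).IsBinaryAdmissible (join l r C D) ↔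
      l.IsBinaryAdmissible C ∧ r.IsBinaryAdmissible D ∧ ¬ (l.root ∈ C ∧ r.root ∈ D) := by
  constructor
  · rintro ⟨h₁, h₂⟩
    refine ⟨⟨fun v hv w hw h => ?_, fun x v hv w hw hxv hxw => ?_⟩,
      ⟨fun v hv w hw h => ?_, fun x v hv w hw hxv hxw => ?_⟩, fun ⟨hl, hr⟩ => ?_⟩
    · exact h₁ _ (inLeft_mem_join.2 hv) _ (inLeft_mem_join.2 hw)
        (transGen_inLeft_iff.2 ⟨w, rfl, h⟩)
    · exact inLeft_injective l r (h₂ (inLeft l r x) _ (inLeft_mem_join.2 hv) _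
        (inLeft_mem_join.2 hw) hxv hxw)
    · exact h₁ _ (inRight_mem_join.2 hv) _ (inRight_mem_join.2 hw)
        (transGen_inRight_iff.2 ⟨w, rfl, h⟩)
    · exact inRight_injective l r (h₂ (inRight l r x) _ (inRight_mem_join.2 hv) _
        (inRight_mem_join.2 hw) hxv hxw)
    · have := h₂ (node l r).root _ (inLeft_mem_join.2 hl) _ (inRight_mem_join.2 hr)
        (rfl : l.root = l.root) (rfl : r.root = r.root)
      exact Sum.inl_ne_inr (Option.some_injective _ this)
  · rintro ⟨⟨h₁, h₂⟩, ⟨h₃, h₄⟩, h₅⟩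
    refine ⟨fun v hv w hw h => ?_, fun x v hv w hw hxv hxw => ?_⟩
    · rcases mem_join.1 hv with ⟨v, hv', rfl⟩ | ⟨v, hv', rfl⟩
      · obtain ⟨w, rfl, h'⟩ := transGen_inLeft_iff.1 h
        exact h₁ v hv' w (inLeft_mem_join.1 hw) h'
      · obtain ⟨w, rfl, h'⟩ := transGen_inRight_iff.1 h
        exact h₃ v hv' w (inRight_mem_join.1 hw) h'
    · rcases mem_join.1 hv with ⟨v, hv', rfl⟩ | ⟨v, hv', rfl⟩ <;>
      rcases mem_join.1 hw with ⟨w, hw', rfl⟩ | ⟨w, hw', rfl⟩ <;>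
      rcases x with _ | x | x
      · rw [show v = l.root from hxv, show w = l.root from hxw]
      · exact congrArg _ (h₂ x v hv' w hw' hxv hxw)
      · exact hxv.elim
      · have e₁ : v = l.root := hxv
        have e₂ : w = r.root := hxw
        exact absurd ⟨e₁ ▸ hv', e₂ ▸ hw'⟩ h₅
      · exact hxw.elim
      · exact hxv.elim
      · have e₁ : v = r.root := hxv
        have e₂ : w = l.root := hxw
        exact absurd ⟨e₂ ▸ hw', e₁ ▸ hv'⟩ h₅
      · exact hxv.elim
      · exact hxw.elim
      · rw [show v = r.root from hxv, show w = r.root from hxw]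
      · exact hxv.elim
      · exact congrArg _ (h₄ x v hv' w hw' hxv hxw)

theorem isBinaryAdmissible_singleton_root (t : PlaneTree α) :
    t.IsBinaryAdmissible {t.root} := by
  refine ⟨fun v hv w hw h => ?_, fun x v hv w hw _ _ => ?_⟩
  · rw [Finset.mem_singleton.1 hw] at h
    exact not_transGen_root t v h
  · rw [Finset.mem_singleton.1 hv, Finset.mem_singleton.1 hw]

theorem IsBinaryAdmissible.eq_singleton {t : PlaneTree α} {C : Finset t.Vertex}
    (hC : t.IsBinaryAdmissible C) (h : t.root ∈ C) : C = {t.root} := by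
  refine Finset.eq_singleton_iff_unique_mem.2 ⟨h, fun v hv => ?_⟩
  by_contra hne
  exact hC.1 _ h _ hv (t.transGen_root hne)

open Classical in
/-- The binary-admissible cuts other than the total cut. -/
def properCuts (t : PlaneTree α) : Finset (Finset t.Vertex) :=
  t.cuts.filter fun C => t.root ∉ C

theorem mem_cuts {t : PlaneTree α} {C : Finset t.Vertex} :
    C ∈ t.cuts ↔ t.IsBinaryAdmissible C := by
  simp [cuts]

theorem mem_properCuts {t : PlaneTree α} {C : Finset t.Vertex} :
    C ∈ t.properCuts ↔ t.IsBinaryAdmissible C ∧ t.root ∉ C := by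
  simp [properCuts, mem_cuts]

open Classical in
theorem cuts_eq (t : PlaneTree α) : t.cuts = insert {t.root} t.properCuts := by
  ext C
  rw [Finset.mem_insert, mem_cuts, mem_properCuts]
  constructor
  · intro h
    by_cases h' : t.root ∈ C
    · exact .inl (h.eq_singleton h')
    · exact .inr ⟨h, h'⟩
  · rintro (rfl | h)
    · exact t.isBinaryAdmissible_singleton_root
    · exact h.1

theorem singleton_root_notMem_properCuts (t : PlaneTree α) : {t.root} ∉ t.properCuts := fun h =>
  (mem_properCuts.1 h).2 (Finset.mem_singleton_self _)

theorem properCuts_leaf (a : α) : (leaf a).properCuts = {∅} := by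
  ext C
  rw [mem_properCuts, Finset.mem_singleton]
  constructor
  · rintro ⟨-, h⟩
    refine Finset.eq_empty_of_forall_notMem fun v hv => h ?_
    exact hv
  · rintro rfl
    exact ⟨⟨fun v hv => absurd hv (Finset.notMem_empty v),
      fun _ v hv => absurd hv (Finset.notMem_empty v)⟩, Finset.notMem_empty _⟩

-- A cut containing the topmost edge of a branch contains nothing else of that branch, and at most
-- one branch may be cut there. This leaves the three families.
open Classical in
theorem properCuts_node (l r : PlaneTree α) : (node l r).properCuts =
    (l.properCuts ×ˢ r.properCuts).image (fun p => join l r p.1 p.2) ∪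
      (r.properCuts.image (fun D => join l r {l.root} D) ∪
        l.properCuts.image (fun C => join l r C {r.root})) := by
  ext X
  simp only [Finset.mem_union, Finset.mem_image, Finset.mem_product, mem_properCuts, Prod.exists]
  constructor
  · rintro ⟨hX, h⟩
    rw [← join_filter l r h] at hX ⊢
    generalize Finset.univ.filter (fun v => inLeft l r v ∈ X) = C at *
    generalize Finset.univ.filter (fun v => inRight l r v ∈ X) = D at *
    obtain ⟨h₁, h₂, h₃⟩ := isBinaryAdmissible_join.1 hX
    by_cases hl : l.root ∈ C
    · obtain rfl := h₁.eq_singleton hl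
      exact .inr (.inl ⟨D, ⟨h₂, fun h => h₃ ⟨hl, h⟩⟩, rfl⟩)
    · by_cases hr : r.root ∈ D
      · obtain rfl := h₂.eq_singleton hr
        exact .inr (.inr ⟨C, ⟨h₁, hl⟩, rfl⟩)
      · exact .inl ⟨C, D, ⟨⟨h₁, hl⟩, ⟨h₂, hr⟩⟩, rfl⟩
  · rintro (⟨C, D, ⟨⟨h₁, hl⟩, ⟨h₂, hr⟩⟩, rfl⟩ | ⟨D, ⟨h₂, hr⟩, rfl⟩ | ⟨C, ⟨h₁, hl⟩, rfl⟩)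
    · exact ⟨isBinaryAdmissible_join.2 ⟨h₁, h₂, fun h => hl h.1⟩, root_notMem_join⟩
    · exact ⟨isBinaryAdmissible_join.2 ⟨l.isBinaryAdmissible_singleton_root, h₂,
        fun h => hr h.2⟩, root_notMem_join⟩
    · exact ⟨isBinaryAdmissible_join.2 ⟨h₁, r.isBinaryAdmissible_singleton_root,
        fun h => hl h.1⟩, root_notMem_join⟩

/-- The three families do not overlap, because the total cut of a branch is not one of its proper
cuts. -/
theorem sum_properCuts_node {M : Type*} [AddCommMonoid M] (l r : PlaneTree α)
    (f : Finset (node l r).Vertex → M) :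
    ∑ X ∈ (node l r).properCuts, f X =
      ∑ C ∈ l.properCuts, ∑ D ∈ r.properCuts, f (join l r C D) +
        (∑ D ∈ r.properCuts, f (join l r {l.root} D) +
          ∑ C ∈ l.properCuts, f (join l r C {r.root})) := by
  classical
  rw [properCuts_node, Finset.sum_union, Finset.sum_union, Finset.sum_image, Finset.sum_image,
    Finset.sum_image, Finset.sum_product]
  · exact fun C _ D _ h => (join_inj h).1
  · exact fun C _ D _ h => (join_inj h).2
  · exact fun C _ D _ h => Prod.ext (join_inj h).1 (join_inj h).2
  · rw [Finset.disjoint_left]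
    intro X hX hX'
    obtain ⟨D, hD, rfl⟩ := Finset.mem_image.1 hX
    obtain ⟨C, hC, h⟩ := Finset.mem_image.1 hX'
    rw [(join_inj h).1] at hC
    exact l.singleton_root_notMem_properCuts hC
  · rw [Finset.disjoint_left]
    intro X hX hX'
    obtain ⟨⟨C, D⟩, hCD, rfl⟩ := Finset.mem_image.1 hX
    obtain ⟨hC, hD⟩ := Finset.mem_product.1 hCD
    rcases Finset.mem_union.1 hX' with h | h
    · obtain ⟨D', -, h⟩ := Finset.mem_image.1 h
      rw [show C = {l.root} from (join_inj h).1.symm] at hC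
      exact l.singleton_root_notMem_properCuts hC
    · obtain ⟨C', -, h⟩ := Finset.mem_image.1 h
      rw [show D = {r.root} from (join_inj h).2.symm] at hD
      exact r.singleton_root_notMem_properCuts hD

theorem remainder_of_root_mem : ∀ {t : PlaneTree α} {C : Finset t.Vertex}, t.root ∈ C →
    t.remainder C = none
  | leaf _, _, h => if_pos h
  | node _ _, _, h => if_pos h

open Classical in
theorem remainder_node {l r : PlaneTree α} {X : Finset (node l r).Vertex}
    (h : (node l r).root ∉ X) :
    (node l r).remainder X =
      match l.remainder (Finset.univ.filter fun v => inLeft l r v ∈ X),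
        r.remainder (Finset.univ.filter fun v => inRight l r v ∈ X) with
      | some l', some r' => some (node l' r')
      | some l', none => some l'
      | none, some r' => some r'
      | none, none => none := by
  rw [remainder, if_neg h]
  congr!

theorem remainder_join (l r : PlaneTree α) (C : Finset l.Vertex) (D : Finset r.Vertex) :
    (node l r).remainder (join l r C D) =
      match l.remainder C, r.remainder D with
      | some l', some r' => some (node l' r')
      | some l', none => some l'
      | none, some r' => some r'
      | none, none => none := by
  rw [remainder_node root_notMem_join, filter_left_join, filter_right_join]

/-- At every vertex at least one branch is cut properly, so by induction a tree remains. -/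
theorem exists_remainder {t : PlaneTree α} {C : Finset t.Vertex} (hC : C ∈ t.properCuts) :
    ∃ s, t.remainder C = some s := by
  induction t with
  | leaf a => exact ⟨leaf a, if_neg (mem_properCuts.1 hC).2⟩
  | node l r hl hr =>
    classical
    rw [properCuts_node] at hC
    simp only [Finset.mem_union, Finset.mem_image, Finset.mem_product, Prod.exists] at hC
    obtain ⟨C, D, ⟨h₁, h₂⟩, rfl⟩ | ⟨D, h₂, rfl⟩ | ⟨C, h₁, rfl⟩ := hC
    · obtain ⟨l', hl⟩ := hl h₁
      obtain ⟨r', hr⟩ := hr h₂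
      exact ⟨node l' r', by rw [remainder_join, hl, hr]⟩
    · obtain ⟨r', hr⟩ := hr h₂
      exact ⟨r', by rw [remainder_join, remainder_of_root_mem (Finset.mem_singleton_self _), hr]⟩
    · obtain ⟨l', hl⟩ := hl h₁
      exact ⟨l', by rw [remainder_join, remainder_of_root_mem (Finset.mem_singleton_self _), hl]⟩

end PlaneTree

/-! ### The cut coproduct in recursive form -/

section Coproduct

variable {α : Type u}

open PlaneTree

theorem pruned_join (l r : PlaneTree α) (C : Finset l.Vertex) (D : Finset r.Vertex) :
    pruned (node l r) (join l r C D) = pruned l C + pruned r D := by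
  have h := Finset.sum_map (C.disjSum D) ⟨some, Option.some_injective (l.Vertex ⊕ r.Vertex)⟩
    (fun v : (node l r).Vertex => Finsupp.single ((node l r).subtree v).toBinTree 1)
  refine h.trans ?_
  rw [Finset.sum_disjSum]
  rfl

theorem subtree_root : ∀ t : PlaneTree α, t.subtree t.root = t
  | .leaf _ => rfl
  | .node _ _ => rfl

theorem pruned_singleton_root (t : PlaneTree α) :
    pruned t {t.root} = Finsupp.single t.toBinTree 1 := by
  rw [pruned, Finset.sum_singleton, subtree_root]

theorem pruned_empty (t : PlaneTree α) : pruned t ∅ = 0 := Finset.sum_empty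

variable (k : Type v) [Field k]

theorem forestVec_add (F G : Forest α) : forestVec k (F + G) = forestVec k F * forestVec k G := by
  simp [forestVec, MvPolynomial.monomial_mul]

/-- What remains above a cut, as an element of `L`. -/
def remainderVec (t : PlaneTree α) (C : Finset t.Vertex) : TreeSpace k α :=
  (t.remainder C).elim 0 fun s => treeVec k s.toBinTree

/-- The three families of cuts of a grafted tree give the three summands of `properCoproduct`. A
proper cut always leaves a tree, so the default value 0 in `remainderVec` is never used. -/
theorem sum_properCuts (t : PlaneTree α) :
    ∑ C ∈ t.properCuts, forestVec k (pruned t C) ⊗ₜ[k] remainderVec k t C =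
      properCoproduct k t := by
  induction t with
  | leaf a =>
    have h : (leaf a).remainder ∅ = some (leaf a) := if_neg (Finset.notMem_empty _)
    rw [properCuts_leaf, Finset.sum_singleton, pruned_empty, forestVec_zero, remainderVec, h]
    rfl
  | node l r hl hr =>
    rw [sum_properCuts_node, properCoproduct, ← hl, ← hr]
    congr 1
    · simp only [map_sum, LinearMap.sum_apply]
      rw [Finset.sum_comm]
      refine Finset.sum_congr rfl fun D hD => Finset.sum_congr rfl fun C hC => ?_
      obtain ⟨l', hl'⟩ := exists_remainder hC
      obtain ⟨r', hr'⟩ := exists_remainder hD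
      rw [TensorProduct.map₂_apply_tmul, TensorProduct.map_tmul, pruned_join, forestVec_add,
        LinearMap.mul_apply', remainderVec, remainderVec, remainderVec, remainder_join, hl', hr']
      change _ ⊗ₜ treeVec k _ = _ ⊗ₜ mergeBilin k (treeVec k _) (treeVec k _)
      rw [mergeBilin_treeVec, merge_toBinTree]
    · simp only [map_sum]
      congr 1
      · refine Finset.sum_congr rfl fun D hD => ?_
        obtain ⟨r', hr'⟩ := exists_remainder hD
        rw [LinearMap.rTensor_tmul, LinearMap.mulLeft_apply, pruned_join, forestVec_add,
          pruned_singleton_root, remainderVec, remainderVec, remainder_join,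
          remainder_of_root_mem (Finset.mem_singleton_self _), hr']
        rfl
      · refine Finset.sum_congr rfl fun C hC => ?_
        obtain ⟨l', hl'⟩ := exists_remainder hC
        rw [LinearMap.rTensor_tmul, LinearMap.mulLeft_apply, pruned_join, forestVec_add,
          pruned_singleton_root, remainderVec, remainderVec, remainder_join,
          remainder_of_root_mem (Finset.mem_singleton_self _), hl', mul_comm]
        rfl

theorem treeCoproduct_eq (T : BinTree α) :
    treeCoproduct k T = MvPolynomial.X T ⊗ₜ[k] 1 +
      (toSym k).lTensor (ForestAlg k α) (properCoproduct k T.plane) := by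
  classical
  rw [treeCoproduct, cuts_eq, Finset.sum_insert (singleton_root_notMem_properCuts _),
    ← sum_properCuts, map_sum, pruned_singleton_root, toBinTree_plane, remainderForest,
    remainder_of_root_mem (Finset.mem_singleton_self _)]
  refine congrArg₂ _ rfl (Finset.sum_congr rfl fun C hC => ?_)
  obtain ⟨s, hs⟩ := exists_remainder hC
  rw [LinearMap.lTensor_tmul, remainderForest, remainderVec, hs]
  change _ = _ ⊗ₜ toSym k (treeVec k _)
  rw [toSym_treeVec]
  rfl

theorem cutCoproduct_X (T : BinTree α) :
    cutCoproduct k (MvPolynomial.X T) = MvPolynomial.X T ⊗ₜ[k] 1 +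
      (toSym k).lTensor (ForestAlg k α) (properCoproduct k T.plane) := by
  rw [cutCoproduct, MvPolynomial.aeval_X, treeCoproduct_eq]

end Coproduct

/-! ### Duality of ∗ and Δ -/

section

variable (k : Type v) {α : Type u} [Field k]

/-- In π(A ∗ B) the term ε(A) π(B) is dual to the total cut T ⊗ 1, and π(A) ◁ B is dual to the
proper cuts by `treePairing_treeAct`. -/
theorem pairing_guinOudomMul_X (A B : ForestAlg k α) (T : BinTree α) :
    pairing k (guinOudomMul k A B) (MvPolynomial.X T) =
      tensorPairing k (B ⊗ₜ[k] A) (cutCoproduct k (MvPolynomial.X T)) := by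
  have h : ∀ t : ForestAlg k α ⊗[k] TreeSpace k α,
      tensorPairing k (B ⊗ₜ[k] A) ((toSym k).lTensor _ t) =
        pairing k B (contract k (treePart k A) t) := by
    intro t
    induction t using TensorProduct.induction_on with
    | zero => simp
    | add s t hs ht => simp only [map_add, hs, ht]
    | tmul C z =>
      rw [LinearMap.lTensor_tmul, tensorPairing_tmul, contract_tmul, map_smul, pairing_toSym,
        smul_eq_mul, mul_comm]
  rw [cutCoproduct_X, map_add, tensorPairing_tmul, pairing_one_right, h, ← treePairing_treeAct,
    toBinTree_plane, ← toSym_treeVec, pairing_toSym, pairing_toSym, treePart_guinOudomMul, map_add,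
    map_smul, LinearMap.add_apply, LinearMap.smul_apply, smul_eq_mul, mul_comm]

/-- The cut coproduct is dual to the Guin–Oudom product. -/
theorem pairing_guinOudomMul (A B C : ForestAlg k α) :
    pairing k (guinOudomMul k A B) C = tensorPairing k (B ⊗ₜ[k] A) (cutCoproduct k C) := by
  induction C using MvPolynomial.induction_on generalizing A B with
  | C c =>
    rw [← MvPolynomial.algebraMap_eq, Algebra.algebraMap_eq_smul_one, map_smul, map_smul, map_smul,
      map_one (cutCoproduct k), Algebra.TensorProduct.one_def, tensorPairing_tmul, pairing_one_right,
      pairing_one_right, pairing_one_right, forestCounit_guinOudomMul, mul_comm]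
  | add C C' h h' => simp only [map_add, h, h']
  | mul_X C T h =>
    -- the pairing of `Ш(B) ⊗ Ш(A)` with `u ⊗ u'`, up to a permutation of the factors
    have h₁ : ∀ u u' : ForestAlg k α ⊗[k] ForestAlg k α,
        ∃ φ : ForestAlg k α ⊗[k] ForestAlg k α →ₗ[k] ForestAlg k α ⊗[k] ForestAlg k α →ₗ[k] k,
          (∀ a a' b b', φ (a ⊗ₜ a') (b ⊗ₜ b') =
            tensorPairing k (b ⊗ₜ a) u * tensorPairing k (b' ⊗ₜ a') u') ∧
          φ (unshuffle k A) (unshuffle k B) = tensorPairing k (B ⊗ₜ A) (u * u') := by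
      intro u u'
      induction u using TensorProduct.induction_on with
      | zero => exact ⟨0, by simp, by simp⟩
      | add u v hu hv =>
        obtain ⟨φ, h₁, h₂⟩ := hu
        obtain ⟨ψ, h₃, h₄⟩ := hv
        refine ⟨φ + ψ, fun a a' b b' => ?_, ?_⟩
        · rw [LinearMap.add_apply, LinearMap.add_apply, h₁, h₃, map_add, add_mul]
        · rw [LinearMap.add_apply, LinearMap.add_apply, h₂, h₄, add_mul, map_add]
      | tmul p q =>
      induction u' using TensorProduct.induction_on with
      | zero => exact ⟨0, by simp, by simp⟩
      | add u v hu hv =>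
        obtain ⟨φ, h₁, h₂⟩ := hu
        obtain ⟨ψ, h₃, h₄⟩ := hv
        refine ⟨φ + ψ, fun a a' b b' => ?_, ?_⟩
        · rw [LinearMap.add_apply, LinearMap.add_apply, h₁, h₃, map_add, mul_add]
        · rw [LinearMap.add_apply, LinearMap.add_apply, h₂, h₄, mul_add, map_add]
      | tmul p' q' =>
        refine ⟨(LinearMap.mul k k).compl₁₂ ((tensorPairing k).flip (q ⊗ₜ q'))
          ((tensorPairing k).flip (p ⊗ₜ p')), fun a a' b b' => ?_, ?_⟩
        · simp only [LinearMap.compl₁₂_apply, LinearMap.flip_apply, tensorPairing_tmul,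
            LinearMap.mul_apply']
          ring
        · simp only [LinearMap.compl₁₂_apply, LinearMap.flip_apply, tensorPairing_unshuffle,
            LinearMap.mul_apply', Algebra.TensorProduct.tmul_mul_tmul, tensorPairing_tmul]
          ring
    obtain ⟨φ, hφ, hφ'⟩ := h₁ (cutCoproduct k C) (cutCoproduct k (MvPolynomial.X T))
    -- The pairing of A ∗ B with C T is that of Ш(A ∗ B) with C ⊗ T. As Ш is multiplicative for ∗,
    -- it splits into pairings with C and with T, where the induction hypothesis and the case of a
    -- tree apply.
    rw [map_mul (cutCoproduct k), ← hφ', ← tensorPairing_unshuffle, unshuffle_guinOudomMul]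
    generalize unshuffle k A = s
    generalize unshuffle k B = t
    induction s using TensorProduct.induction_on with
    | zero => simp
    | add s s' h h' => simp only [map_add, LinearMap.add_apply, h, h']
    | tmul a a' =>
    induction t using TensorProduct.induction_on with
    | zero => simp
    | add s s' h h' => simp only [map_add, LinearMap.add_apply, h, h']
    | tmul b b' =>
      rw [TensorProduct.map₂_apply_tmul, TensorProduct.map_tmul, tensorPairing_tmul, h,
        pairing_guinOudomMul_X, hφ]

end

/-! ### Forests separate points; axioms transported through the pairing -/

section Nondegenerate

variable {k : Type v} {α : Type u} [Field k]

theorem tensorPairing_eq (A B : ForestAlg k α) (t : ForestAlg k α ⊗[k] ForestAlg k α) :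
    tensorPairing k (A ⊗ₜ B) t =
      pairing k B (TensorProduct.lid k _ ((pairing k A).rTensor _ t)) := by
  induction t using TensorProduct.induction_on with
  | zero => simp
  | add s t hs ht => simp only [map_add, hs, ht]
  | tmul C D =>
    rw [tensorPairing_tmul, LinearMap.rTensor_tmul, TensorProduct.lid_tmul, map_smul, smul_eq_mul]

/-- Reads off the coefficients of a tensor; with it, duality becomes the relation between the
numbers n and m. -/
theorem tensorPairing_forestVec (F G : Forest α) (t : ForestAlg k α ⊗[k] ForestAlg k α) :
    tensorPairing k (forestVec k F ⊗ₜ forestVec k G) t =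
      ((MvPolynomial.basisMonomials (BinTree α) k).tensorProduct
        (MvPolynomial.basisMonomials (BinTree α) k)).repr t (F, G) *
          F.symmetryFactor * G.symmetryFactor := by
  induction t using TensorProduct.induction_on with
  | zero => simp
  | add s t hs ht => simp only [map_add, hs, ht, Finsupp.add_apply]; ring
  | tmul A B =>
    rw [tensorPairing_tmul, pairing_forestVec_left, pairing_forestVec_left,
      Module.Basis.tensorProduct_repr_tmul_apply]
    change _ = MvPolynomial.coeff G B * MvPolynomial.coeff F A * _ * _
    ring

variable [CharZero k]

theorem symmetryFactor_ne_zero (F : Forest α) : (F.symmetryFactor : k) ≠ 0 :=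
  Nat.cast_ne_zero.2 (symmetryFactor_pos F).ne'

theorem ext_pairing {A B : ForestAlg k α}
    (h : ∀ F : Forest α, pairing k (forestVec k F) A = pairing k (forestVec k F) B) : A = B := by
  refine MvPolynomial.ext _ _ fun F => ?_
  have := h F
  rw [pairing_forestVec_left, pairing_forestVec_left] at this
  exact mul_left_cancel₀ (symmetryFactor_ne_zero F) this

/-- Pairing the left factor with F gives s_F times the coordinate of the tensor at F, and s_F is
invertible. The other factor is arbitrary so that triple tensors are covered. -/
theorem ext_pairing_rTensor {W : Type w} [AddCommGroup W] [Module k W] {s t : ForestAlg k α ⊗[k] W}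
    (h : ∀ F : Forest α, (pairing k (forestVec k F)).rTensor W s =
      (pairing k (forestVec k F)).rTensor W t) : s = t := by
  classical
  have key : ∀ (F : Forest α) (t : ForestAlg k α ⊗[k] W),
      (F.symmetryFactor : k) • TensorProduct.equivFinsuppOfBasisLeft
        (MvPolynomial.basisMonomials (BinTree α) k) t F =
      TensorProduct.lid k W ((pairing k (forestVec k F)).rTensor W t) := by
    intro F t
    induction t using TensorProduct.induction_on with
    | zero => simp
    | add s t hs ht => simp only [map_add, Finsupp.add_apply, smul_add, hs, ht]
    | tmul A w =>
      rw [TensorProduct.equivFinsuppOfBasisLeft_apply_tmul_apply, LinearMap.rTensor_tmul,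
        TensorProduct.lid_tmul, pairing_forestVec_left, mul_smul]
      rfl
  refine (TensorProduct.equivFinsuppOfBasisLeft
    (MvPolynomial.basisMonomials (BinTree α) k)).injective (Finsupp.ext fun F => ?_)
  have := key F s
  rw [h F, ← key F t] at this
  exact smul_right_injective W (symmetryFactor_ne_zero F) this

theorem ext_tensorPairing {s t : ForestAlg k α ⊗[k] ForestAlg k α}
    (h : ∀ F G : Forest α, tensorPairing k (forestVec k F ⊗ₜ forestVec k G) s =
      tensorPairing k (forestVec k F ⊗ₜ forestVec k G) t) : s = t := by
  refine ext_pairing_rTensor fun F => (TensorProduct.lid k _).injective (ext_pairing fun G => ?_)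
  rw [← tensorPairing_eq, ← tensorPairing_eq, h]

section Dual

variable {μ : ForestAlg k α →ₗ[k] ForestAlg k α →ₗ[k] ForestAlg k α}
  {δ : ForestAlg k α →ₗ[k] ForestAlg k α ⊗[k] ForestAlg k α}

/-- The dual of an associative product is coassociative. -/
theorem coassoc_of_dual
    (h : ∀ A B C, pairing k (μ A B) C = tensorPairing k (A ⊗ₜ B) (δ C))
    (hμ : ∀ A B C, μ (μ A B) C = μ A (μ B C)) (A : ForestAlg k α) :
    TensorProduct.assoc k _ _ _ (δ.rTensor _ (δ A)) = δ.lTensor _ (δ A) := by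
  refine ext_pairing_rTensor fun F => (TensorProduct.lid k _).injective
    (ext_tensorPairing fun G H => ?_)
  have h₁ : ∀ t : ForestAlg k α ⊗[k] ForestAlg k α,
      tensorPairing k (forestVec k G ⊗ₜ forestVec k H) (TensorProduct.lid k _
        ((pairing k (forestVec k F)).rTensor _ (TensorProduct.assoc k _ _ _ (δ.rTensor _ t)))) =
      tensorPairing k (μ (forestVec k F) (forestVec k G) ⊗ₜ forestVec k H) t := by
    intro t
    induction t using TensorProduct.induction_on with
    | zero => simp
    | add s t hs ht => simp only [map_add, hs, ht]
    | tmul p q =>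
      rw [LinearMap.rTensor_tmul, tensorPairing_tmul, h]
      generalize δ p = s
      induction s using TensorProduct.induction_on with
      | zero => simp
      | add s t hs ht => simp only [TensorProduct.add_tmul, map_add, hs, ht, add_mul]
      | tmul a b =>
        rw [TensorProduct.assoc_tmul, LinearMap.rTensor_tmul, TensorProduct.lid_tmul, map_smul,
          tensorPairing_tmul, tensorPairing_tmul, smul_eq_mul, mul_assoc]
  have h₂ : ∀ t : ForestAlg k α ⊗[k] ForestAlg k α,
      tensorPairing k (forestVec k G ⊗ₜ forestVec k H) (TensorProduct.lid k _
        ((pairing k (forestVec k F)).rTensor _ (δ.lTensor _ t))) =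
      tensorPairing k (forestVec k F ⊗ₜ μ (forestVec k G) (forestVec k H)) t := by
    intro t
    induction t using TensorProduct.induction_on with
    | zero => simp
    | add s t hs ht => simp only [map_add, hs, ht]
    | tmul p q =>
      rw [LinearMap.lTensor_tmul, LinearMap.rTensor_tmul, TensorProduct.lid_tmul, map_smul,
        tensorPairing_tmul, h, smul_eq_mul]
  rw [h₁, h₂, ← h, ← h, hμ]

/-- The counit is the pairing with 1, so this axiom is the dual of the left unit law. -/
theorem counit_rTensor_of_dual
    (h : ∀ A B C, pairing k (μ A B) C = tensorPairing k (A ⊗ₜ B) (δ C))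
    (hμ : ∀ A, μ 1 A = A) (A : ForestAlg k α) :
    (forestCounit k).rTensor _ (δ A) = (1 : k) ⊗ₜ[k] A := by
  have h₁ : forestCounit k = pairing k (1 : ForestAlg k α) :=
    LinearMap.ext fun A => (pairing_one_left k A).symm
  refine (TensorProduct.lid k _).injective (ext_pairing fun F => ?_)
  rw [h₁, ← tensorPairing_eq, ← h, hμ, TensorProduct.lid_tmul, one_smul]

theorem counit_lTensor_of_dual
    (h : ∀ A B C, pairing k (μ A B) C = tensorPairing k (A ⊗ₜ B) (δ C))
    (hμ : ∀ A, μ A 1 = A) (A : ForestAlg k α) :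
    (forestCounit k).lTensor _ (δ A) = A ⊗ₜ[k] (1 : k) := by
  refine (TensorProduct.rid k _).injective (ext_pairing fun F => ?_)
  rw [TensorProduct.rid_tmul, one_smul]
  conv_rhs => rw [← hμ (forestVec k F), h]
  generalize δ A = t
  induction t using TensorProduct.induction_on with
  | zero => simp
  | add s t hs ht => simp only [map_add, hs, ht]
  | tmul p q =>
    rw [LinearMap.lTensor_tmul, TensorProduct.rid_tmul, map_smul, tensorPairing_tmul,
      pairing_one_left, smul_eq_mul, mul_comm]

end Dual

end Nondegenerate

/-! ### The grading by the number of leaves -/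

section Grading

variable {α : Type u}

theorem PlaneTree.numLeaves_pos : ∀ t : PlaneTree α, 0 < t.numLeaves
  | .leaf _ => Nat.one_pos
  | .node l _ => Nat.add_pos_left l.numLeaves_pos _

theorem numLeaves_toBinTree (t : PlaneTree α) : t.toBinTree.numLeaves = t.numLeaves := rfl

theorem numLeaves_plane (T : BinTree α) : T.plane.numLeaves = T.numLeaves := by
  rw [← numLeaves_toBinTree, toBinTree_plane]

theorem BinTree.numLeaves_ne_zero (T : BinTree α) : T.numLeaves ≠ 0 := by
  rw [← numLeaves_plane]
  exact T.plane.numLeaves_pos.ne'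

/-- The number of leaves of a forest. -/
abbrev Forest.numLeaves (F : Forest α) : ℕ := Finsupp.weight BinTree.numLeaves F

theorem Forest.numLeaves_single (T : BinTree α) :
    Forest.numLeaves (Finsupp.single T 1) = T.numLeaves := by
  simp [Forest.numLeaves, Finsupp.weight_single]

theorem Forest.numLeaves_eq_zero_iff {F : Forest α} : F.numLeaves = 0 ↔ F = 0 := by
  constructor
  · intro h
    by_contra hne
    obtain ⟨T, hT⟩ := Finsupp.support_nonempty_iff.2 hne
    have hle := Finsupp.le_weight_of_ne_zero' BinTree.numLeaves (Finsupp.mem_support_iff.1 hT)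
    exact T.numLeaves_ne_zero (by rw [Forest.numLeaves] at h; omega)
  · rintro rfl
    exact map_zero _

variable (k : Type v) [Field k]

theorem forestVec_mem_gradedPart (F : Forest α) : forestVec k F ∈ gradedPart k F.numLeaves :=
  MvPolynomial.isWeightedHomogeneous_monomial _ _ _ rfl

theorem X_mem_gradedPart (T : BinTree α) : MvPolynomial.X T ∈ gradedPart k T.numLeaves :=
  MvPolynomial.isWeightedHomogeneous_X _ _ _

theorem one_mem_gradedPart : (1 : ForestAlg k α) ∈ gradedPart k 0 :=
  MvPolynomial.isWeightedHomogeneous_one _ _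

variable {k} in
theorem mul_mem_gradedPart {m n : ℕ} {A B : ForestAlg k α} (hA : A ∈ gradedPart k m)
    (hB : B ∈ gradedPart k n) : A * B ∈ gradedPart k (m + n) :=
  MvPolynomial.IsWeightedHomogeneous.mul hA hB

theorem gradedPart_eq_span (n : ℕ) :
    gradedPart k (α := α) n = Submodule.span k (forestVec k '' {F | F.numLeaves = n}) := by
  refine le_antisymm (fun A hA => ?_) (Submodule.span_le.2 ?_)
  · rw [MvPolynomial.as_sum A]
    refine Submodule.sum_mem _ fun F hF => ?_
    have h : MvPolynomial.monomial F (A.coeff F) = A.coeff F • forestVec k F := by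
      simp [forestVec, MvPolynomial.smul_monomial]
    rw [h]
    exact Submodule.smul_mem _ _ (Submodule.subset_span
      ⟨F, hA (MvPolynomial.mem_support_iff.1 hF), rfl⟩)
  · rintro _ ⟨F, rfl, rfl⟩
    exact forestVec_mem_gradedPart k F

variable {k} in
theorem gradedPart_induction {n : ℕ} {p : ForestAlg k α → Prop} {A : ForestAlg k α}
    (hA : A ∈ gradedPart k n) (zero : p 0) (add : ∀ A B, p A → p B → p (A + B))
    (smul : ∀ (c : k) A, p A → p (c • A))
    (mon : ∀ F : Forest α, F.numLeaves = n → p (forestVec k F)) : p A := by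
  rw [gradedPart_eq_span] at hA
  refine Submodule.span_induction (p := fun A _ => p A) ?_ zero (fun A B _ _ => add A B)
    (fun c A _ => smul c A) hA
  rintro _ ⟨F, hF, rfl⟩
  exact mon F hF

theorem gradedPart_zero : gradedPart k (α := α) 0 = Submodule.span k {1} := by
  rw [gradedPart_eq_span]
  congr 1
  ext A
  simp only [Forest.numLeaves_eq_zero_iff, Set.ofPred_eq_eq_singleton, Set.image_singleton, forestVec_zero]

theorem isInternal_gradedPart : DirectSum.IsInternal (gradedPart k (α := α)) := by
  let _ := MvPolynomial.weightedDecomposition k (BinTree.numLeaves (α := α))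
  exact DirectSum.Decomposition.isInternal (M := ForestAlg k α)
    (MvPolynomial.weightedHomogeneousSubmodule k (BinTree.numLeaves (α := α)))

/-- The part of degree `n` of `Sym(L) ⊗ Sym(L)`. -/
def tensorGradedPart (n : ℕ) : Submodule k (ForestAlg k α ⊗[k] ForestAlg k α) :=
  ⨆ p ∈ Finset.HasAntidiagonal.antidiagonal n,
    LinearMap.range (TensorProduct.map (gradedPart k p.1).subtype (gradedPart k p.2).subtype)

variable {k} in
theorem tmul_mem_tensorGradedPart {m n d : ℕ} {A B : ForestAlg k α} (hA : A ∈ gradedPart k m)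
    (hB : B ∈ gradedPart k n) (h : m + n = d) : A ⊗ₜ B ∈ tensorGradedPart k (α := α) d :=
  Submodule.mem_iSup_of_mem (m, n) (Submodule.mem_iSup_of_mem
    (Finset.HasAntidiagonal.mem_antidiagonal.2 h) ⟨⟨A, hA⟩ ⊗ₜ ⟨B, hB⟩, rfl⟩)

variable {k} in
theorem tensorGradedPart_le {n : ℕ} {S : Submodule k (ForestAlg k α ⊗[k] ForestAlg k α)}
    (h : ∀ p q A B, p + q = n → A ∈ gradedPart k p → B ∈ gradedPart k q → A ⊗ₜ B ∈ S) :
    tensorGradedPart k n ≤ S := by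
  refine iSup₂_le fun p hp => ?_
  rintro _ ⟨x, rfl⟩
  induction x using TensorProduct.induction_on with
  | zero => rw [map_zero]; exact zero_mem _
  | add x y hx hy => rw [map_add]; exact add_mem hx hy
  | tmul A B => exact h _ _ _ _ (Finset.HasAntidiagonal.mem_antidiagonal.1 hp) A.2 B.2

variable {k} in
theorem mul_mem_tensorGradedPart {m n : ℕ} {s t : ForestAlg k α ⊗[k] ForestAlg k α}
    (hs : s ∈ tensorGradedPart k m) (ht : t ∈ tensorGradedPart k n) :
    s * t ∈ tensorGradedPart k (m + n) := by
  refine tensorGradedPart_le (S := (tensorGradedPart k (m + n)).comap (LinearMap.mulRight k t))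
    (fun p q A B hpq hA hB => ?_) hs
  refine tensorGradedPart_le (S := (tensorGradedPart k (m + n)).comap (LinearMap.mulLeft k _))
    (fun p' q' A' B' hpq' hA' hB' => ?_) ht
  rw [Submodule.mem_comap, LinearMap.mulLeft_apply, Algebra.TensorProduct.tmul_mul_tmul]
  exact tmul_mem_tensorGradedPart (mul_mem_gradedPart hA hA') (mul_mem_gradedPart hB hB')
    (by omega)

-- Trees generate the algebra and products add tensor degrees, so degrees have to be checked on
-- trees only.
variable {k} in
theorem algHom_mem_tensorGradedPart (φ : ForestAlg k α →ₐ[k] ForestAlg k α ⊗[k] ForestAlg k α)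
    (hφ : ∀ T, φ (MvPolynomial.X T) ∈ tensorGradedPart k T.numLeaves) {n : ℕ} {A : ForestAlg k α}
    (hA : A ∈ gradedPart k n) : φ A ∈ tensorGradedPart k n := by
  refine gradedPart_induction (p := fun A => φ A ∈ tensorGradedPart k n) hA ?_ ?_ ?_ ?_
  · rw [map_zero]; exact zero_mem _
  · intro A B h h'; rw [map_add]; exact add_mem h h'
  · intro c A h; rw [map_smul]; exact Submodule.smul_mem _ c h
  · rintro F rfl
    suffices H : ∀ (n : ℕ) (F : Forest α), F.degree = n →
        φ (forestVec k F) ∈ tensorGradedPart k F.numLeaves from H _ F rfl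
    intro n
    induction n with
    | zero =>
      intro F hF
      rw [Finsupp.degree_eq_zero_iff] at hF
      subst hF
      rw [forestVec_zero, map_one, Algebra.TensorProduct.one_def]
      exact tmul_mem_tensorGradedPart (one_mem_gradedPart k) (one_mem_gradedPart k)
        (by rw [Forest.numLeaves_eq_zero_iff.2 rfl])
    | succ n ih =>
      intro F hF
      obtain ⟨G, T, rfl, hG⟩ := exists_add_single hF
      rw [forestVec_add_single, map_mul, Forest.numLeaves, map_add]
      have := mul_mem_tensorGradedPart (ih G hG) (hφ T)
      rwa [← Forest.numLeaves_single] at this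

theorem unshuffle_mem_tensorGradedPart {n : ℕ} {A : ForestAlg k α} (hA : A ∈ gradedPart k n) :
    unshuffle k A ∈ tensorGradedPart k n := by
  refine algHom_mem_tensorGradedPart _ (fun T => ?_) hA
  rw [unshuffle_X]
  exact add_mem
    (tmul_mem_tensorGradedPart (X_mem_gradedPart k T) (one_mem_gradedPart k) (add_zero _))
    (tmul_mem_tensorGradedPart (one_mem_gradedPart k) (X_mem_gradedPart k T) (zero_add _))

/-- A cut distributes the leaves over the pruned forest and the remainder, and contracting a vertex
loses none. -/
theorem properCoproduct_mem_span (t : PlaneTree α) :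
    properCoproduct k t ∈ Submodule.span k {x | ∃ (A : ForestAlg k α) (s : PlaneTree α) (n : ℕ),
      A ∈ gradedPart k n ∧ n + s.numLeaves = t.numLeaves ∧ x = A ⊗ₜ treeVec k s.toBinTree} := by
  induction t with
  | leaf a => exact Submodule.subset_span ⟨1, _, 0, one_mem_gradedPart k, zero_add _, rfl⟩
  | node l r hl hr =>
    rw [properCoproduct]
    refine add_mem ?_ (add_mem ?_ ?_)
    · refine Submodule.span_induction₂ (p := fun x y _ _ =>
        TensorProduct.map₂ (LinearMap.mul k (ForestAlg k α)) (mergeBilin k) x y ∈ _)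
        ?_ ?_ ?_ ?_ ?_ ?_ ?_ hl hr
      · rintro _ _ ⟨A, s, n, hA, hn, rfl⟩ ⟨A', s', n', hA', hn', rfl⟩
        rw [TensorProduct.map₂_apply_tmul, TensorProduct.map_tmul, mergeBilin_treeVec,
          merge_toBinTree]
        refine Submodule.subset_span ⟨_, _, n + n', mul_mem_gradedPart hA hA', ?_, rfl⟩
        simp only [PlaneTree.numLeaves]
        omega
      · intro y _; simp
      · intro x _; simp
      · intro x y z _ _ _ h h'; rw [map_add]; exact add_mem h h'
      · intro x y z _ _ _ h h'; rw [map_add]; exact add_mem h h'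
      · intro c x y _ _ h; rw [map_smul]; exact Submodule.smul_mem _ _ h
      · intro c x y _ _ h; rw [map_smul]; exact Submodule.smul_mem _ _ h
    · refine Submodule.span_induction (p := fun x _ =>
        (LinearMap.mulLeft k (MvPolynomial.X l.toBinTree)).rTensor _ x ∈ _) ?_ ?_ ?_ ?_ hr
      · rintro _ ⟨A, s, n, hA, hn, rfl⟩
        refine Submodule.subset_span
          ⟨_, s, l.numLeaves + n, mul_mem_gradedPart (X_mem_gradedPart k l.toBinTree) hA, ?_, rfl⟩
        simp only [PlaneTree.numLeaves]
        omega
      · simp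
      · intro x y _ _ h h'; rw [map_add]; exact add_mem h h'
      · intro c x _ h; rw [map_smul]; exact Submodule.smul_mem _ _ h
    · refine Submodule.span_induction (p := fun x _ =>
        (LinearMap.mulLeft k (MvPolynomial.X r.toBinTree)).rTensor _ x ∈ _) ?_ ?_ ?_ ?_ hl
      · rintro _ ⟨A, s, n, hA, hn, rfl⟩
        refine Submodule.subset_span
          ⟨_, s, r.numLeaves + n, mul_mem_gradedPart (X_mem_gradedPart k r.toBinTree) hA, ?_, rfl⟩
        simp only [PlaneTree.numLeaves]
        omega
      · simp
      · intro x y _ _ h h'; rw [map_add]; exact add_mem h h'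
      · intro c x _ h; rw [map_smul]; exact Submodule.smul_mem _ _ h

theorem cutCoproduct_mem_tensorGradedPart {n : ℕ} {A : ForestAlg k α} (hA : A ∈ gradedPart k n) :
    cutCoproduct k A ∈ tensorGradedPart k n := by
  refine algHom_mem_tensorGradedPart _ (fun T => ?_) hA
  rw [cutCoproduct_X]
  refine add_mem
    (tmul_mem_tensorGradedPart (X_mem_gradedPart k T) (one_mem_gradedPart k) (add_zero _)) ?_
  refine Submodule.span_induction (p := fun x _ => (toSym k).lTensor _ x ∈ _) ?_ ?_ ?_ ?_
    (properCoproduct_mem_span k T.plane)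
  · rintro _ ⟨A, s, n, hA, hn, rfl⟩
    rw [LinearMap.lTensor_tmul, toSym_treeVec]
    exact tmul_mem_tensorGradedPart hA (X_mem_gradedPart k _) (hn.trans (numLeaves_plane T))
  · simp
  · intro x y _ _ h h'; rw [map_add]; exact add_mem h h'
  · intro c x _ h; rw [map_smul]; exact Submodule.smul_mem _ _ h

variable {k}

/-- Different degrees are orthogonal. -/
theorem pairing_eq_zero {m n : ℕ} (h : m ≠ n) {A B : ForestAlg k α} (hA : A ∈ gradedPart k m)
    (hB : B ∈ gradedPart k n) : pairing k A B = 0 := by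
  refine gradedPart_induction (p := fun A => pairing k A B = 0) hA ?_ ?_ ?_ ?_
  · rw [map_zero, LinearMap.zero_apply]
  · intro A B h h'; rw [map_add, LinearMap.add_apply, h, h', add_zero]
  · intro c A h; rw [map_smul, LinearMap.smul_apply, h, smul_zero]
  · rintro F rfl
    rw [pairing_forestVec_left, MvPolynomial.IsWeightedHomogeneous.coeff_eq_zero hB F h, mul_zero]

theorem tensorPairing_eq_zero {m n d : ℕ} (h : m + n ≠ d) {A B : ForestAlg k α}
    (hA : A ∈ gradedPart k m) (hB : B ∈ gradedPart k n) {t : ForestAlg k α ⊗[k] ForestAlg k α}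
    (ht : t ∈ tensorGradedPart k d) : tensorPairing k (A ⊗ₜ B) t = 0 := by
  refine tensorGradedPart_le (S := LinearMap.ker (tensorPairing k (A ⊗ₜ B)))
    (fun p q C D hpq hC hD => ?_) ht
  rw [LinearMap.mem_ker, tensorPairing_tmul]
  by_cases hp : m = p
  · have hq : n ≠ q := by omega
    rw [pairing_eq_zero hq hB hD, mul_zero]
  · rw [pairing_eq_zero hp hA hC, zero_mul]

/-- By duality: a forest of any other degree pairs to zero with A ∗ B because Δ is graded, and its
symmetry factor is invertible. -/
theorem guinOudomMul_mem_gradedPart [CharZero k] {m n : ℕ} {A B : ForestAlg k α}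
    (hA : A ∈ gradedPart k m) (hB : B ∈ gradedPart k n) :
    guinOudomMul k A B ∈ gradedPart k (m + n) := by
  intro F hF
  by_contra hne
  refine hF ?_
  have h := pairing_guinOudomMul k A B (forestVec k F)
  rw [pairing_forestVec_right, tensorPairing_eq_zero (fun h => hne (h.symm.trans (add_comm _ _)))
    hB hA (cutCoproduct_mem_tensorGradedPart k (forestVec_mem_gradedPart k F))] at h
  exact (mul_eq_zero.1 h).resolve_left (symmetryFactor_ne_zero F)

end Grading

/-! ### The coalgebra axioms and the antipode of H -/

section Antipode

variable (k : Type v) {α : Type u} [Field k]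

/-- The opposite product absorbs the exchange of tensor factors, so the general statements on dual
operations apply to Δ. -/
theorem pairing_flip_guinOudomMul (A B C : ForestAlg k α) :
    pairing k ((guinOudomMul k).flip A B) C =
      tensorPairing k (A ⊗ₜ B) ((cutCoproduct k).toLinearMap C) := by
  rw [LinearMap.flip_apply, pairing_guinOudomMul, AlgHom.toLinearMap_apply]

variable [CharZero k]

theorem cutCoproduct_coassoc (A : ForestAlg k α) :
    TensorProduct.assoc k (ForestAlg k α) (ForestAlg k α) (ForestAlg k α)
      ((cutCoproduct k).toLinearMap.rTensor (ForestAlg k α) ((cutCoproduct k).toLinearMap A)) =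
    (cutCoproduct k).toLinearMap.lTensor (ForestAlg k α) ((cutCoproduct k).toLinearMap A) := by
  refine coassoc_of_dual (pairing_flip_guinOudomMul k) (fun A B C => ?_) A
  simp only [LinearMap.flip_apply, guinOudomMul_assoc]

theorem cutCoproduct_counit_rTensor (A : ForestAlg k α) :
    (forestCounit k).rTensor (ForestAlg k α) ((cutCoproduct k).toLinearMap A) =
      (1 : k) ⊗ₜ[k] A := by
  refine counit_rTensor_of_dual (pairing_flip_guinOudomMul k) (fun A => ?_) A
  rw [LinearMap.flip_apply, guinOudomMul_one]

theorem cutCoproduct_counit_lTensor (A : ForestAlg k α) :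
    (forestCounit k).lTensor (ForestAlg k α) ((cutCoproduct k).toLinearMap A) =
      A ⊗ₜ[k] (1 : k) := by
  refine counit_lTensor_of_dual (pairing_flip_guinOudomMul k) (fun A => ?_) A
  rw [LinearMap.flip_apply, one_guinOudomMul]

/-- `Sym(L)` as a coalgebra with the cut coproduct. -/
abbrev cutCoalgebra : Coalgebra k (ForestAlg k α) where
  comul := (cutCoproduct k).toLinearMap
  counit := forestCounit k
  coassoc := LinearMap.ext (cutCoproduct_coassoc k)
  rTensor_counit_comp_comul := LinearMap.ext (cutCoproduct_counit_rTensor k)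
  lTensor_counit_comp_comul := LinearMap.ext (cutCoproduct_counit_lTensor k)

/-- The antipode of `H`. -/
theorem exists_antipode_cutCoproduct : ∃ S : ForestAlg k α →ₗ[k] ForestAlg k α, ∀ x,
    TensorProduct.lift (LinearMap.mul k (ForestAlg k α)) (S.rTensor _ (cutCoproduct k x)) =
      forestCounit k x • 1 ∧
    TensorProduct.lift (LinearMap.mul k (ForestAlg k α)) (S.lTensor _ (cutCoproduct k x)) =
      forestCounit k x • 1 := by
  let _ := cutCoalgebra k (α := α)
  -- In the convolution algebra E, with unit x ↦ ε(x) 1, an antipode is an inverse of the identity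
  -- map e = 1 - h, hence formally the sum of the powers of h.
  let E := WithConv (ForestAlg k α →ₗ[k] ForestAlg k α)
  let e : E := WithConv.toConv LinearMap.id
  let h : E := 1 - e
  have happly : ∀ x, h.ofConv x = algebraMap k _ (forestCounit k x) - x := fun x => rfl
  have hmul : ∀ (f g : E) x, (f * g).ofConv x =
      LinearMap.mul' k _ (TensorProduct.map f.ofConv g.ofConv (cutCoproduct k x)) :=
    fun f g x => rfl
  have hone : h.ofConv 1 = 0 := by rw [happly, forestCounit_one, map_one, sub_self]
  -- As h vanishes in degree 0, every factor of h ^ i consumes at least one leaf, so h ^ i vanishes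
  -- in degrees below i.
  have hpow : ∀ i n x, x ∈ gradedPart k n → n < i → (h ^ i).ofConv x = 0 := by
    intro i
    induction i with
    | zero => intro n x _ hn; exact absurd hn (Nat.not_lt_zero n)
    | succ i ih =>
      intro n x hx hn
      rw [pow_succ', hmul]
      refine tensorGradedPart_le (S := LinearMap.ker
        (LinearMap.mul' k _ ∘ₗ TensorProduct.map h.ofConv (h ^ i).ofConv))
        (fun p q A B hpq hA hB => ?_) (cutCoproduct_mem_tensorGradedPart k hx)
      rw [LinearMap.mem_ker, LinearMap.comp_apply, TensorProduct.map_tmul, LinearMap.mul'_apply]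
      by_cases hp : p = 0
      · subst hp
        rw [gradedPart_zero] at hA
        obtain ⟨c, rfl⟩ := Submodule.mem_span_singleton.1 hA
        rw [map_smul, hone, smul_zero, zero_mul]
      · rw [ih q B hB (by omega), mul_zero]
  -- The series is only locally finite, so it is truncated forest by forest; powers up to the number
  -- of leaves suffice.
  let S : ForestAlg k α →ₗ[k] ForestAlg k α :=
    (MvPolynomial.basisMonomials (BinTree α) k).constr k fun F =>
      (∑ i ∈ Finset.range (Forest.numLeaves F + 1), h ^ i).ofConv (forestVec k F)
  have hsum : ∀ N x, (∑ i ∈ Finset.range (N + 1), h ^ i).ofConv x =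
      ∑ i ∈ Finset.range (N + 1), (h ^ i).ofConv x := by
    intro N x
    induction N + 1 with
    | zero => rfl
    | succ m ih => rw [Finset.sum_range_succ, Finset.sum_range_succ, ← ih]; rfl
  -- Longer truncations give the same values, so one N serves all tensor factors in a coproduct of
  -- degree N.
  have hS : ∀ N n x, x ∈ gradedPart k n → n ≤ N →
      S x = (∑ i ∈ Finset.range (N + 1), h ^ i).ofConv x := by
    intro N n x hx hn
    refine gradedPart_induction (p := fun x => S x = (∑ i ∈ Finset.range (N + 1), h ^ i).ofConv x)
      hx ?_ ?_ ?_ ?_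
    · rw [map_zero, map_zero]
    · intro A B h h'; rw [map_add, map_add, h, h']
    · intro c A h; rw [map_smul, map_smul, h]
    · rintro F rfl
      have hF : forestVec k F = MvPolynomial.basisMonomials (BinTree α) k F := by simp [forestVec]
      conv_lhs => rw [hF, Module.Basis.constr_basis]
      rw [hsum, hsum]
      refine Finset.sum_subset (Finset.range_subset_range.2 (by omega)) fun i _ hi => ?_
      rw [Finset.mem_range, not_lt] at hi
      exact hpow i _ _ (forestVec_mem_gradedPart k F) (by omega)
  have he : e = 1 - h := (sub_sub_cancel 1 e).symm
  -- The error term h ^ (N + 1) of the finite geometric sum vanishes in degree N.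
  have hgeom : ∀ N x, x ∈ gradedPart k N → ∀ f : E, f = 1 - h ^ (N + 1) →
      f.ofConv x = forestCounit k x • 1 := by
    rintro N x hx _ rfl
    change algebraMap k _ (forestCounit k x) - (h ^ (N + 1)).ofConv x = _
    rw [hpow _ _ _ hx (Nat.lt_succ_self N), sub_zero, Algebra.algebraMap_eq_smul_one]
  have hleft : ∀ N x, x ∈ gradedPart k N →
      TensorProduct.lift (LinearMap.mul k (ForestAlg k α)) (S.rTensor _ (cutCoproduct k x)) =
        forestCounit k x • 1 := by
    intro N x hx
    rw [← hgeom N x hx _ (geom_sum_mul_neg h (N + 1)), ← he, hmul]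
    refine LinearMap.mem_eqLocus.1 (tensorGradedPart_le (S := LinearMap.eqLocus
      (TensorProduct.lift (LinearMap.mul k (ForestAlg k α)) ∘ₗ S.rTensor _)
      (LinearMap.mul' k _ ∘ₗ TensorProduct.map (∑ i ∈ Finset.range (N + 1), h ^ i).ofConv e.ofConv))
        (fun p q A B hpq hA hB => ?_) (cutCoproduct_mem_tensorGradedPart k hx))
    rw [LinearMap.mem_eqLocus, LinearMap.comp_apply, LinearMap.comp_apply, LinearMap.rTensor_tmul,
      TensorProduct.map_tmul, TensorProduct.lift.tmul, hS N p A hA (by omega)]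
    rfl
  have hright : ∀ N x, x ∈ gradedPart k N →
      TensorProduct.lift (LinearMap.mul k (ForestAlg k α)) (S.lTensor _ (cutCoproduct k x)) =
        forestCounit k x • 1 := by
    intro N x hx
    rw [← hgeom N x hx _ (mul_neg_geom_sum h (N + 1)), ← he, hmul]
    refine LinearMap.mem_eqLocus.1 (tensorGradedPart_le (S := LinearMap.eqLocus
      (TensorProduct.lift (LinearMap.mul k (ForestAlg k α)) ∘ₗ S.lTensor _)
      (LinearMap.mul' k _ ∘ₗ TensorProduct.map e.ofConv (∑ i ∈ Finset.range (N + 1), h ^ i).ofConv))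
        (fun p q A B hpq hA hB => ?_) (cutCoproduct_mem_tensorGradedPart k hx))
    rw [LinearMap.mem_eqLocus, LinearMap.comp_apply, LinearMap.comp_apply, LinearMap.lTensor_tmul,
      TensorProduct.map_tmul, TensorProduct.lift.tmul, hS N q B hB (by omega)]
    rfl
  refine ⟨S, fun x => ?_⟩
  induction x using forestAlg_induction k with
  | add A B h h' => simp only [map_add, h, h', add_smul, and_self]
  | smul c A h => simp only [map_smul, h, smul_assoc, and_self]
  | mon F =>
    exact ⟨hleft _ _ (forestVec_mem_gradedPart k F), hright _ _ (forestVec_mem_gradedPart k F)⟩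

end Antipode

/-! ### Finite-dimensional degrees and nondegeneracy -/

section Finiteness

variable {α : Type u}

/-- Both branches of a grafted tree have fewer leaves than the tree, since neither is empty. -/
theorem finite_planeTree_numLeaves_le [Finite α] (n : ℕ) :
    {t : PlaneTree α | t.numLeaves ≤ n}.Finite := by
  induction n with
  | zero =>
    convert Set.finite_empty
    ext t
    simpa using t.numLeaves_pos.ne'
  | succ n ih =>
    refine ((Set.finite_range PlaneTree.leaf).union (ih.image2 PlaneTree.node ih)).subset ?_
    rintro (a | ⟨l, r⟩) h
    · exact .inl ⟨a, rfl⟩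
    · have hl := l.numLeaves_pos
      have hr := r.numLeaves_pos
      simp only [Set.mem_ofPred_eq, PlaneTree.numLeaves] at h
      exact .inr ⟨l, by simp only [Set.mem_ofPred_eq]; omega, r, by simp only [Set.mem_ofPred_eq]; omega, rfl⟩

theorem finite_forest_numLeaves_eq [Finite α] (n : ℕ) :
    {F : Forest α | F.numLeaves = n}.Finite := by
  have h : {T : BinTree α | T.numLeaves ≤ n}.Finite := by
    refine ((finite_planeTree_numLeaves_le (α := α) n).image PlaneTree.toBinTree).subset ?_
    intro T hT
    exact ⟨T.plane, by rw [Set.mem_ofPred_eq, numLeaves_plane]; exact hT, toBinTree_plane T⟩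
  classical
  -- A forest with n leaves uses only trees with at most n leaves, each at most n times, and so lies
  -- in a finite interval of exponents.
  refine (Set.finite_Icc 0 (∑ T ∈ h.toFinset, Finsupp.single T n : Forest α)).subset ?_
  rintro F rfl
  refine ⟨fun T => Nat.zero_le _, fun T => ?_⟩
  by_cases hT : F T = 0
  · rw [hT]; exact Nat.zero_le _
  · have h₁ : T ∈ h.toFinset := by
      rw [Set.Finite.mem_toFinset]
      exact Finsupp.le_weight_of_ne_zero' BinTree.numLeaves hT
    have h₂ := Finsupp.le_weight BinTree.numLeaves T.numLeaves_ne_zero F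
    rw [Finsupp.finsetSum_apply]
    refine h₂.trans ?_
    refine le_trans ?_ (Finset.single_le_sum (f := fun S => Finsupp.single S F.numLeaves T)
      (fun _ _ => Nat.zero_le _) h₁)
    simp

variable (k : Type v) [Field k]

theorem finite_gradedPart [Finite α] (n : ℕ) : Module.Finite k (gradedPart k (α := α) n) := by
  rw [gradedPart_eq_span]
  exact Module.Finite.span_of_finite k ((finite_forest_numLeaves_eq n).image _)

/-- Forests of the same degree pair to zero by assumption and the others by orthogonality, so
nondegeneracy on all of Sym(L) passes to each degree. -/
theorem nondegenerate_gradedPairing [CharZero k] (n : ℕ) :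
    (gradedPairing k (α := α) n).Nondegenerate := by
  have key : ∀ A ∈ gradedPart k (α := α) n,
      (∀ B ∈ gradedPart k (α := α) n, pairing k A B = 0) → A = 0 := by
    intro A hA h
    refine ext_pairing fun F => ?_
    rw [map_zero, pairing_comm]
    by_cases hF : F.numLeaves = n
    · exact h _ (hF ▸ forestVec_mem_gradedPart k F)
    · exact pairing_eq_zero (Ne.symm hF) hA (forestVec_mem_gradedPart k F)
  constructor
  · exact fun A h => Subtype.ext (key A A.2 fun B hB => h ⟨B, hB⟩)
  · exact fun A h => Subtype.ext (key A A.2 fun B hB =>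
      (pairing_comm k _ _).trans (h ⟨B, hB⟩))

end Finiteness

/-! ### The two Hopf algebras and the perfect pairing -/

section HopfAlgebras

variable (k : Type v) {α : Type u} [Field k]

theorem tensorPairing_comm (s t : ForestAlg k α ⊗[k] ForestAlg k α) :
    tensorPairing k s t = tensorPairing k t s := by
  have h : tensorPairing k = (tensorPairing k (α := α)).flip :=
    TensorProduct.ext' fun A B => TensorProduct.ext' fun C D => by
      rw [LinearMap.flip_apply, tensorPairing_tmul, tensorPairing_tmul, pairing_comm k A,
        pairing_comm k B]
  exact LinearMap.congr_fun₂ h s t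

theorem pairing_mul (A B C : ForestAlg k α) :
    pairing k (LinearMap.mul k (ForestAlg k α) A B) C =
      tensorPairing k (A ⊗ₜ B) ((unshuffle k).toLinearMap C) := by
  rw [LinearMap.mul_apply', AlgHom.toLinearMap_apply, tensorPairing_comm, tensorPairing_unshuffle,
    pairing_comm]

theorem map₂_mul_mul (s t : ForestAlg k α ⊗[k] ForestAlg k α) :
    TensorProduct.map₂ (LinearMap.mul k (ForestAlg k α)) (LinearMap.mul k (ForestAlg k α)) s t =
      s * t := by
  induction s using TensorProduct.induction_on with
  | zero => rw [map_zero, LinearMap.zero_apply, zero_mul]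
  | add x y hx hy => rw [map_add, LinearMap.add_apply, hx, hy, add_mul]
  | tmul A B =>
    induction t using TensorProduct.induction_on with
    | zero => rw [map_zero, mul_zero]
    | add x y hx hy => rw [map_add, hx, hy, mul_add]
    | tmul C D =>
      rw [TensorProduct.map₂_apply_tmul, TensorProduct.map_tmul,
        Algebra.TensorProduct.tmul_mul_tmul, LinearMap.mul_apply', LinearMap.mul_apply']

theorem graftCoeff_mul_symmetryFactor (F₁ F₂ F₃ : Forest α) :
    graftCoeff k F₁ F₂ F₃ * (Forest.symmetryFactor F₃ : k) =
      cutCoeff k F₁ F₂ F₃ * (Forest.symmetryFactor F₁ : k) * (Forest.symmetryFactor F₂ : k) := by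
  have h := pairing_guinOudomMul k (forestVec k F₂) (forestVec k F₁) (forestVec k F₃)
  rw [pairing_forestVec_right, tensorPairing_forestVec] at h
  rw [graftCoeff, cutCoeff, mul_comm, h]

theorem linearMap_ext_forestVec {M : Type*} [AddCommGroup M] [Module k M]
    {f g : ForestAlg k α →ₗ[k] M} (h : ∀ F, f (forestVec k F) = g (forestVec k F)) : f = g := by
  refine LinearMap.ext fun A => ?_
  induction A using forestAlg_induction k with
  | add A B h h' => rw [map_add, map_add, h, h']
  | smul c A h => rw [map_smul, map_smul, h]
  | mon F => exact h F

variable [CharZero k]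

/-- The coalgebra axioms of Ш are the duals of the algebra axioms of ⊔. -/
theorem isGradedConnectedHopfAlgebra_guinOudomMul :
    IsGradedConnectedHopfAlgebra (guinOudomMul k (α := α)) 1 (unshuffle k).toLinearMap
      (forestCounit k) (gradedPart k) where
  one_mul := one_guinOudomMul k
  mul_one := guinOudomMul_one k
  mul_assoc := guinOudomMul_assoc k
  coassoc A := by
    refine coassoc_of_dual (pairing_mul k) (fun A B C => ?_) A
    simp only [LinearMap.mul_apply', mul_assoc]
  counit_left A := by
    refine counit_rTensor_of_dual (pairing_mul k) (fun A => ?_) A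
    rw [LinearMap.mul_apply', one_mul]
  counit_right A := by
    refine counit_lTensor_of_dual (pairing_mul k) (fun A => ?_) A
    rw [LinearMap.mul_apply', mul_one]
  comul_one := map_one (unshuffle k)
  comul_mul := unshuffle_guinOudomMul k
  counit_one := forestCounit_one k
  counit_mul := forestCounit_guinOudomMul k
  antipode := exists_antipode_guinOudomMul k
  isInternal := isInternal_gradedPart k
  mul_mem _ _ _ _ := guinOudomMul_mem_gradedPart
  comul_mem _ _ := unshuffle_mem_tensorGradedPart k
  connected := gradedPart_zero k

theorem isGradedConnectedHopfAlgebra_cutCoproduct :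
    IsGradedConnectedHopfAlgebra (LinearMap.mul k (ForestAlg k α)) 1 (cutCoproduct k).toLinearMap
      (forestCounit k) (gradedPart k) where
  one_mul := one_mul
  mul_one := mul_one
  mul_assoc := mul_assoc
  coassoc := cutCoproduct_coassoc k
  counit_left := cutCoproduct_counit_rTensor k
  counit_right := cutCoproduct_counit_lTensor k
  comul_one := map_one (cutCoproduct k)
  comul_mul A B := by
    rw [map₂_mul_mul, LinearMap.mul_apply']
    exact map_mul (cutCoproduct k) A B
  counit_one := forestCounit_one k
  counit_mul := forestCounit_mul k
  antipode := exists_antipode_cutCoproduct k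
  isInternal := isInternal_gradedPart k
  mul_mem _ _ _ _ := mul_mem_gradedPart
  comul_mem _ _ := cutCoproduct_mem_tensorGradedPart k
  connected := gradedPart_zero k

theorem isPerfPair_gradedPairing [Finite α] (n : ℕ) : (gradedPairing k (α := α) n).IsPerfPair := by
  have := finite_gradedPart k (α := α) n
  have h := nondegenerate_gradedPairing k (α := α) n
  exact .of_injective
    (LinearMap.ker_eq_bot.1 (LinearMap.separatingLeft_iff_ker_eq_bot.1 h.1))
    (LinearMap.ker_eq_bot.1 (LinearMap.separatingRight_iff_flip_ker_eq_bot.1 h.2))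

end HopfAlgebras

end BinForest

end

theorem mainTheorem1 {k : Type*} [Field k] [CharZero k] {α : Type*} :
    -- `⟨F₁ ∗ F₂, F₃⟩ = ⟨F₂ ⊗ F₁, Δ(F₃)⟩`
    (∀ F₁ F₂ F₃ : Forest α,
      pairing k (guinOudomMul k (forestVec k F₁) (forestVec k F₂)) (forestVec k F₃) =
        tensorPairing k (forestVec k F₂ ⊗ₜ[k] forestVec k F₁) (cutCoproduct k (forestVec k F₃))) ∧
    -- `Δ = Δ_∗`: no other linear map is dual to `∗`
    (∀ D : ForestAlg k α →ₗ[k] ForestAlg k α ⊗[k] ForestAlg k α,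
      (∀ F₁ F₂ F₃ : Forest α,
        pairing k (guinOudomMul k (forestVec k F₁) (forestVec k F₂)) (forestVec k F₃) =
          tensorPairing k (forestVec k F₂ ⊗ₜ[k] forestVec k F₁) (D (forestVec k F₃))) →
      D = (cutCoproduct k).toLinearMap) ∧
    -- the disjoint union product, and no other bilinear product, is dual to the unshuffle coproduct
    (∀ F₁ F₂ F₃ : Forest α,
      tensorPairing k (unshuffle k (forestVec k F₁)) (forestVec k F₂ ⊗ₜ[k] forestVec k F₃) =
        pairing k (forestVec k F₁) (forestVec k F₂ * forestVec k F₃)) ∧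
    (∀ m : ForestAlg k α →ₗ[k] ForestAlg k α →ₗ[k] ForestAlg k α,
      (∀ F₁ F₂ F₃ : Forest α,
        tensorPairing k (unshuffle k (forestVec k F₁)) (forestVec k F₂ ⊗ₜ[k] forestVec k F₃) =
          pairing k (forestVec k F₁) (m (forestVec k F₂) (forestVec k F₃))) →
      m = LinearMap.mul k (ForestAlg k α)) ∧
    -- units are dual to counits
    (∀ A : ForestAlg k α, pairing k 1 A = forestCounit k A ∧ pairing k A 1 = forestCounit k A) ∧
    -- `n(F₁, F₂; F₃) s_{F₃} = m(F₁, F₂; F₃) s_{F₁} s_{F₂}`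
    (∀ F₁ F₂ F₃ : Forest α,
      graftCoeff k F₁ F₂ F₃ * (Forest.symmetryFactor F₃ : k) =
        cutCoeff k F₁ F₂ F₃ * (Forest.symmetryFactor F₁ : k) *
          (Forest.symmetryFactor F₂ : k)) ∧
    -- `U(L) = (Sym(L), ∗, Ш)` and `H = (k[𝒯], ⊔, Δ)` are graded connected Hopf algebras
    IsGradedConnectedHopfAlgebra (guinOudomMul k (α := α)) 1 (unshuffle k).toLinearMap
      (forestCounit k) (gradedPart k) ∧
    IsGradedConnectedHopfAlgebra (LinearMap.mul k (ForestAlg k α)) 1 (cutCoproduct k).toLinearMap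
      (forestCounit k) (gradedPart k) ∧
    -- `(Sym(L), ∗)` is the universal enveloping algebra of the Lie algebra `L`
    (∃ e : UniversalEnvelopingAlgebra k (TreeSpace k α) ≃ₗ[k] ForestAlg k α,
      e 1 = 1 ∧ (∀ a b, e (a * b) = guinOudomMul k (e a) (e b)) ∧
        ∀ x : TreeSpace k α, e (UniversalEnvelopingAlgebra.ι k x) = toSym k x) ∧
    -- the pairing respects the grading and is nondegenerate in every degree; if there are finitely
    -- many leaf labels, then every degree is finite-dimensional and the pairing is perfect there
    (∀ m n : ℕ, m ≠ n → ∀ A ∈ gradedPart k (α := α) m, ∀ B ∈ gradedPart k (α := α) n,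
      pairing k A B = 0) ∧
    (∀ n : ℕ, (gradedPairing k (α := α) n).Nondegenerate) ∧
    (Finite α → ∀ n : ℕ, Module.Finite k (gradedPart k (α := α) n) ∧
      (gradedPairing k (α := α) n).IsPerfPair) := by
  refine ⟨fun F₁ F₂ F₃ => pairing_guinOudomMul k _ _ _, fun D hD => ?_,
    fun F₁ F₂ F₃ => tensorPairing_unshuffle k _ _ _, fun m hm => ?_,
    fun A => ⟨pairing_one_left k A, pairing_one_right k A⟩, graftCoeff_mul_symmetryFactor k,
    isGradedConnectedHopfAlgebra_guinOudomMul k, isGradedConnectedHopfAlgebra_cutCoproduct k,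
    exists_universalEnvelopingAlgebra_equiv k, fun m n h A hA B hB => pairing_eq_zero h hA hB,
    nondegenerate_gradedPairing k,
    fun _ n => ⟨finite_gradedPart k n, isPerfPair_gradedPairing k n⟩⟩
  -- Uniqueness of both dual operations: values on forests are determined by their pairings with
  -- forests.
  · refine linearMap_ext_forestVec k fun F₃ => ext_tensorPairing fun F₂ F₁ => ?_
    rw [← hD, pairing_guinOudomMul, AlgHom.toLinearMap_apply]
  · refine linearMap_ext_forestVec k fun F₂ => linearMap_ext_forestVec k fun F₃ =>
      ext_pairing fun F₁ => ?_
    rw [← hm, tensorPairing_unshuffle, LinearMap.mul_apply']
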